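/- Let $p\in[1,\infty)$ be real and $\ell=\lfloor p\rfloor$. Let $M$ be a smooth Riemannian manifold of dimension $m\ge \ell+1$ (Hausdorff, $\sigma$-compact, without boundary, not necessarily compact), and let $N$ be a compact smooth Riemannian manifold without boundary, isometrically and smoothly embedded in $\mathbb{R}^\nu$. Let $$W^{1,p}(M,N)=\{u\in L^p(M,\mathbb{R}^\nu) : u \text{ is weakly differentiable},\ \textstyle\int_M|Du|^p<\infty,\ u\in N \text{ a.e.}\},$$ and let $H^{1,p}_{\mathrm{Ei}}(M,N)$ be the set of those $u\in W^{1,p}(M,N)$ for which there is a sequence $(u_j)_{j\in\mathbb{N}}$ in $C^\infty(M,N)$ such that $$\lim_{j\to\infty}\int_M|u_j-u|^p=0\qquad\text{and}\qquad \lim_{t\to\infty}\sup_{j\in\mathbb{N}}\int_M(|Du_j|-t)_+^p=0 .$$ If $u\in H^{1,p}_{\mathrm{Ei}}(M,N)$, then for every smooth differential form $\omega$ of degree $\ell$ on $N$ with $d\omega=0$ and every smooth differential form $\varphi$ of degree $m-\ell-1$ on $M$ with compact support along which $M$ is orientable (that is, there is a continuous choice of orientations of the spaces $T_xM$ for $x\in\operatorname{supp}\varphi$),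 and for every such orientation, the form $u^*\omega\wedge d\varphi$ is integrable on $M$ and $$\int_M u^*\omega\wedge d\varphi=0 .$$ Here $u^*\omega$ is the almost everywhere defined form $(u^*\omega)_x(v_1,\dots,v_\ell)=\omega_{u(x)}(Du(x)v_1,\dots,Du(x)v_\ell)$, where $Du$ is the weak derivative of $u$. When $M$ is compact, every form $\varphi$ has compact support. In other words, $u^*\omega$ is closed in the sense of distributions. -/

import Mathlib

open Set Filter Topology MeasureTheory Bundle
open scoped Manifold ContDiff

noncomputable section

/-! ### Differential forms on a manifold without boundary -/

section Forms

variable {m : ℕ} {M : Type*} [TopologicalSpace M] [ChartedSpace (EuclideanSpace ℝ (Fin m)) M]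

/-- A (not necessarily smooth) differential form of degree `k` on `M`. -/
abbrev DiffForm (m : ℕ) (M : Type*) [TopologicalSpace M]
    [ChartedSpace (EuclideanSpace ℝ (Fin m)) M] (k : ℕ) : Type _ :=
  ∀ x : M, TangentSpace (𝓡 m) x [⋀^Fin k]→L[ℝ] ℝ

/-- The differential at `y` of the inverse of a chart `e`, a linear map `ℝᵐ → T_{e⁻¹(y)} M`. -/
def chartSymmDeriv (e : OpenPartialHomeomorph M (EuclideanSpace ℝ (Fin m)))
    (y : EuclideanSpace ℝ (Fin m)) :
    EuclideanSpace ℝ (Fin m) →L[ℝ] TangentSpace (𝓡 m) (e.symm y) :=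
  mfderiv (𝓡 m) (𝓡 m) e.symm y

/-- The coordinate vector `∂ᵢ` of the chart `e`, at the point with coordinates `y`. -/
def coordVector (e : OpenPartialHomeomorph M (EuclideanSpace ℝ (Fin m)))
    (y : EuclideanSpace ℝ (Fin m)) (i : Fin m) : TangentSpace (𝓡 m) (e.symm y) :=
  chartSymmDeriv e y (EuclideanSpace.basisFun (Fin m) ℝ i)

/-- The expression of a form in the chart `e`: the pull-back of the form by `e⁻¹`. -/
def chartForm {k : ℕ} (e : OpenPartialHomeomorph M (EuclideanSpace ℝ (Fin m)))
    (φ : DiffForm m M k) (y : EuclideanSpace ℝ (Fin m)) :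
    EuclideanSpace ℝ (Fin m) [⋀^Fin k]→L[ℝ] ℝ :=
  (φ (e.symm y)).compContinuousLinearMap (chartSymmDeriv e y)

/-- A form is smooth when its expression in every chart is smooth. -/
def IsSmoothForm {k : ℕ} (φ : DiffForm m M k) : Prop :=
  ∀ e ∈ atlas (EuclideanSpace ℝ (Fin m)) M, ContDiffOn ℝ ∞ (chartForm e φ) e.target

/-- The exterior derivative, computed at each point in the preferred chart at this point. -/
def formDeriv {k : ℕ} (φ : DiffForm m M k) : DiffForm m M (k + 1) := fun x =>
  (extDeriv (chartForm (chartAt (EuclideanSpace ℝ (Fin m)) x) φ)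
    (chartAt (EuclideanSpace ℝ (Fin m)) x x)).compContinuousLinearMap
    (mfderiv (𝓡 m) (𝓡 m) (chartAt (EuclideanSpace ℝ (Fin m)) x) x)

/-- A form is closed when its exterior derivative vanishes everywhere. -/
def IsClosedForm {k : ℕ} (φ : DiffForm m M k) : Prop :=
  ∀ x, formDeriv φ x = 0

/-- The support of a form. -/
def formSupport {k : ℕ} (φ : DiffForm m M k) : Set M :=
  closure {x | φ x ≠ 0}

/-- The exterior product of two alternating forms, normalised as a sum over shuffles. -/
def wedgeForm {V : Type*} [TopologicalSpace V] [AddCommGroup V] [Module ℝ V] {k l : ℕ}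
    (α : V [⋀^Fin k]→L[ℝ] ℝ) (β : V [⋀^Fin l]→L[ℝ] ℝ) : V [⋀^Fin (k + l)]→ₗ[ℝ] ℝ :=
  ((LinearMap.mul' ℝ ℝ).compAlternatingMap
    (α.toAlternatingMap.domCoprod β.toAlternatingMap)).domDomCongr finSumFinEquiv

/-! ### Classical and weak derivatives of maps into `ℝ^ν` -/

/-- The differential of a map from `M` to `ℝ^ν`. -/
def diffAt {ν : ℕ} (f : M → EuclideanSpace ℝ (Fin ν)) (x : M) :
    TangentSpace (𝓡 m) x →L[ℝ] EuclideanSpace ℝ (Fin ν) :=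
  mfderiv (𝓡 m) (𝓡 ν) f x

/-- `Du` is the weak derivative of `u : M → ℝ^ν`: in every chart, both are locally integrable and
the integration by parts formula holds against all test functions. -/
def HasWeakDeriv {ν : ℕ} (u : M → EuclideanSpace ℝ (Fin ν))
    (Du : ∀ x : M, TangentSpace (𝓡 m) x →L[ℝ] EuclideanSpace ℝ (Fin ν)) : Prop :=
  ∀ e ∈ atlas (EuclideanSpace ℝ (Fin m)) M,
    LocallyIntegrableOn (fun y => u (e.symm y)) e.target volume ∧
    LocallyIntegrableOn (fun y => (Du (e.symm y)).comp (chartSymmDeriv e y)) e.target volume ∧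
    ∀ ψ : EuclideanSpace ℝ (Fin m) → ℝ, ContDiff ℝ ∞ ψ → HasCompactSupport ψ →
      tsupport ψ ⊆ e.target → ∀ v : EuclideanSpace ℝ (Fin m),
        ∫ y in e.target, (fderiv ℝ ψ y v) • u (e.symm y) =
          -∫ y in e.target, ψ y • Du (e.symm y) (chartSymmDeriv e y v)

end Forms

/-! ### Riemannian volume, orientations and integration -/

section Riemannian

variable {m : ℕ} {M : Type*} [TopologicalSpace M] [ChartedSpace (EuclideanSpace ℝ (Fin m)) M]
  [RiemannianBundle (fun x : M => TangentSpace (𝓡 m) x)]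

/-- The volume density `√(det (gᵢⱼ))` of the Riemannian metric in the chart `e`. -/
def volumeDensity (e : OpenPartialHomeomorph M (EuclideanSpace ℝ (Fin m)))
    (y : EuclideanSpace ℝ (Fin m)) : ℝ :=
  √(Matrix.of fun i j : Fin m => inner ℝ (coordVector e y i) (coordVector e y j)).det

/-- The Riemannian volume of the domain of the chart `e`, that is, the image under `e⁻¹` of the
measure `√(det (gᵢⱼ)) dy` on the target of `e`. -/
def chartVolume [MeasurableSpace M]
    (e : OpenPartialHomeomorph M (EuclideanSpace ℝ (Fin m))) : Measure M :=
  ((volume.restrict e.target).withDensity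
    fun y => ENNReal.ofReal (volumeDensity e y)).map e.symm

/-- The Riemannian volume measure. Its restriction to the domain of a chart `e` is `chartVolume e`;
since these measures agree on the overlaps of the charts, it is their supremum. -/
def riemannianVolume (m : ℕ) (M : Type*) [TopologicalSpace M]
    [ChartedSpace (EuclideanSpace ℝ (Fin m)) M]
    [RiemannianBundle (fun x : M => TangentSpace (𝓡 m) x)] [MeasurableSpace M] : Measure M :=
  ⨆ e ∈ atlas (EuclideanSpace ℝ (Fin m)) M, chartVolume e

instance factFinrankTangentSpace (x : M) : Fact (Module.finrank ℝ (TangentSpace (𝓡 m) x) = m) :=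
  ⟨finrank_euclideanSpace_fin (𝕜 := ℝ) (n := m)⟩

instance completeSpaceTangentSpace (x : M) : CompleteSpace (TangentSpace (𝓡 m) x) :=
  have : FiniteDimensional ℝ (TangentSpace (𝓡 m) x) :=
    inferInstanceAs (FiniteDimensional ℝ (EuclideanSpace ℝ (Fin m)))
  FiniteDimensional.complete ℝ _

/-- The choice `o` of an orientation of each tangent space is an orientation of `M` along the
set `S` when it is continuous on `S`, that is, when the volume form of `o` is continuous on `S`
in charts. -/
def IsOrientationOn (o : ∀ x : M, Orientation ℝ (TangentSpace (𝓡 m) x) (Fin m)) (S : Set M) :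
    Prop :=
  ∀ e ∈ atlas (EuclideanSpace ℝ (Fin m)) M,
    ContinuousOn (fun y => (o (e.symm y)).volumeForm (coordVector e y)) (e.target ∩ e.symm ⁻¹' S)

/-- The number `c` such that `η = c • vol`, where `η` is an alternating form of top degree on the
oriented space `T_x M` and `vol` is the volume form of `T_x M`; the ratio `η v / vol v` does not
depend on the basis `v` of `T_x M`. -/
def topFormRatio {x : M} (o : Orientation ℝ (TangentSpace (𝓡 m) x) (Fin m))
    (η : TangentSpace (𝓡 m) x [⋀^Fin m]→ₗ[ℝ] ℝ) : ℝ :=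
  let v : Fin m → TangentSpace (𝓡 m) x := fun i => EuclideanSpace.basisFun (Fin m) ℝ i
  η v / o.volumeForm v

/-! ### Sobolev maps into an embedded compact manifold -/

variable {n ν : ℕ} {N : Type*} [TopologicalSpace N] [ChartedSpace (EuclideanSpace ℝ (Fin n)) N]

/-- A smooth isometric embedding of the Riemannian manifold `N` into `ℝ^ν`. -/
structure IsIsometricEmbedding [RiemannianBundle (fun y : N => TangentSpace (𝓡 n) y)]
    (ι : N → EuclideanSpace ℝ (Fin ν)) : Prop where
  contMDiff : ContMDiff (𝓡 n) (𝓡 ν) ∞ ι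
  isEmbedding : IsEmbedding ι
  inner_diffAt : ∀ (y : N) (v w : TangentSpace (𝓡 n) y),
    inner ℝ (diffAt ι y v) (diffAt ι y w) = inner ℝ v w

/-- The Sobolev space `W^{1,p}(M, N)`, where `N` is embedded in `ℝ^ν` by `ι`. -/
def sobolevMaps (m : ℕ) {M : Type*} [TopologicalSpace M]
    [ChartedSpace (EuclideanSpace ℝ (Fin m)) M]
    [RiemannianBundle (fun x : M => TangentSpace (𝓡 m) x)] [MeasurableSpace M] {N : Type*} {ν : ℕ}
    (p : ℝ) (ι : N → EuclideanSpace ℝ (Fin ν)) : Set (M → EuclideanSpace ℝ (Fin ν)) :=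
  {u | MemLp u (ENNReal.ofReal p) (riemannianVolume m M) ∧
    (∃ Du : ∀ x : M, TangentSpace (𝓡 m) x →L[ℝ] EuclideanSpace ℝ (Fin ν),
      HasWeakDeriv u Du ∧ ∫⁻ x, ‖Du x‖ₑ ^ p ∂(riemannianVolume m M) < ⊤) ∧
    ∀ᵐ x ∂(riemannianVolume m M), u x ∈ range ι}

/-- The sequential equi-integrable closure `H^{1,p}_Ei(M, N)` of the smooth maps. -/
def equiIntegrableClosure (m n : ℕ) {M N : Type*} [TopologicalSpace M]
    [ChartedSpace (EuclideanSpace ℝ (Fin m)) M]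
    [RiemannianBundle (fun x : M => TangentSpace (𝓡 m) x)] [MeasurableSpace M]
    [TopologicalSpace N] [ChartedSpace (EuclideanSpace ℝ (Fin n)) N] {ν : ℕ}
    (p : ℝ) (ι : N → EuclideanSpace ℝ (Fin ν)) : Set (M → EuclideanSpace ℝ (Fin ν)) :=
  {u | u ∈ sobolevMaps m p ι ∧
    ∃ U : ℕ → M → N, (∀ j, ContMDiff (𝓡 m) (𝓡 n) ∞ (U j)) ∧
      Tendsto (fun j => ∫⁻ x, ‖ι (U j x) - u x‖ₑ ^ p ∂(riemannianVolume m M)) atTop (𝓝 0) ∧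
      Tendsto (fun t : ℝ => ⨆ j, ∫⁻ x,
          ENNReal.ofReal (‖diffAt (m := m) (fun z => ι (U j z)) x‖ - t) ^ p
          ∂(riemannianVolume m M)) atTop (𝓝 0)}

end Riemannian

section Pullback

variable {m n ν : ℕ} {M N : Type*}
  [TopologicalSpace M] [ChartedSpace (EuclideanSpace ℝ (Fin m)) M]
  [TopologicalSpace N] [ChartedSpace (EuclideanSpace ℝ (Fin n)) N]

/-- The pull-back `u^*α` of a form `α` on `N` by `u : M → ℝ^ν` with weak derivative `Du`, at the
points `x` where `u x` lies in `N`. A vector of `ℝ^ν` is read as a vector tangent to `N` through the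
adjoint of the differential of the isometric embedding `ι`, which inverts this differential on its
image. -/
def sobolevPullback [RiemannianBundle (fun y : N => TangentSpace (𝓡 n) y)] {k : ℕ}
    (ι : N → EuclideanSpace ℝ (Fin ν)) (u : M → EuclideanSpace ℝ (Fin ν))
    (Du : ∀ x : M, TangentSpace (𝓡 m) x →L[ℝ] EuclideanSpace ℝ (Fin ν))
    (α : DiffForm n N k) : DiffForm m M k := fun x =>
  open Classical in
  if h : ∃ y, ι y = u x then
    (α h.choose).compContinuousLinearMap
      ((ContinuousLinearMap.adjoint (diffAt ι h.choose)).comp (Du x))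
  else 0

/-- Where the weak derivative is tangent to `N`, that is, `Du x = dι ∘ A`, the pull-back is the usual
`α (A ·, …, A ·)`. -/
theorem sobolevPullback_of_tangent [RiemannianBundle (fun y : N => TangentSpace (𝓡 n) y)] {k : ℕ}
    {ι : N → EuclideanSpace ℝ (Fin ν)} (hι : IsIsometricEmbedding (n := n) ι)
    (u : M → EuclideanSpace ℝ (Fin ν))
    (Du : ∀ x : M, TangentSpace (𝓡 m) x →L[ℝ] EuclideanSpace ℝ (Fin ν))
    (α : DiffForm n N k) {x : M} {y : N} (hy : ι y = u x)
    (A : TangentSpace (𝓡 m) x →L[ℝ] TangentSpace (𝓡 n) y)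
    (hA : Du x = (diffAt ι y).comp A) :
    sobolevPullback ι u Du α x = (α y).compContinuousLinearMap A := by
  have h : ∃ y, ι y = u x := ⟨y, hy⟩
  have hc : h.choose = y := hι.isEmbedding.injective (h.choose_spec.trans hy.symm)
  rw [sobolevPullback, dif_pos h]
  subst hc
  congr 1
  rw [hA]
  ext1 v
  apply ext_inner_right ℝ
  intro w
  simp [ContinuousLinearMap.adjoint_inner_left, hι.inner_diffAt]

end Pullback

end

noncomputable section

set_option linter.unusedSectionVars false

/-! ### Integration by parts for determinants of differentials -/

section DetIntegration

variable {E : Type*} [NormedAddCommGroup E] [NormedSpace ℝ E]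

/-! For a smooth map `U j` into `N` the form `(U j)^*ω` is closed, so its integral against `dφ`
vanishes by Stokes. The theorem says that this identity survives the limit. The adjoint of `dι`
writes `u^*ω` as a combination of minors of `Du` of order `ℓ ≤ p`, with coefficients that are
continuous functions of `u`. The same formula holds for the smooth maps, so the task is to pass to
the limit in integrals of a coefficient times a minor.

Minors alone need only boundedness of the derivatives in `L^p` on compact sets and convergence in
`L^p`. Replacing the function in one row by another changes the tested minor, after an integration
by parts, by the integral of the undifferentiated difference times `r - 1` derivatives. Since `r - 1
≤ p - 1`, this is controlled by the `L^p` distance, even when the rows carry independent indices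
(`exists_forall_abs_sub_le`). The indices can then go to infinity one row at a time, and each such
limit is just the weak convergence of first derivatives (`isWeakTest_mixed`). This gives
`tendsto_integral_covectorDet`.

Coefficients are where equi-integrability enters: for `ℓ = p` the minors are only bounded in `L^1`.
The coefficient is frozen at a map `f J` with `J` large, so that it becomes part of a smooth test
function. The error is split at a level `t` of the derivative: below `t` the `L^p` closeness of the
maps suffices, above `t` the excess is uniformly small (`tendsto_integral_coeff_covectorDet`).

Everything else is localization. A partition of unity reduces `φ` to forms supported in one chart.
There the Riemannian volume is the density times Lebesgue measure (`restrict_riemannianVolume`), the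
orientation contributes a sign which is locally constant on the support
(`signedChartForm_eventuallyEq`), and Stokes becomes an integration by parts antisymmetrised over
permutations (`sum_sign_integral_mul_extDeriv_eq_zero`). -/

/-- The determinant `det (wₐ (v_b))`, as a function of the covectors `wₐ`. -/
def covectorDet {r : ℕ} (v : Fin r → E) :
    ContinuousMultilinearMap ℝ (fun _ : Fin r => E →L[ℝ] ℝ) ℝ where
  toMultilinearMap := (Matrix.detRowAlternating (R := ℝ) (n := Fin r)).toMultilinearMap.compLinearMap
    fun _ => LinearMap.pi fun b => (ContinuousLinearMap.apply ℝ ℝ (v b)).toLinearMap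
  cont := by
    change Continuous fun w : Fin r → E →L[ℝ] ℝ => (Matrix.of fun a b => w a (v b)).det
    apply Continuous.matrix_det
    apply continuous_matrix
    intro i j
    exact (ContinuousLinearMap.apply ℝ ℝ (v j)).continuous.comp (continuous_apply i)

theorem covectorDet_apply {r : ℕ} (v : Fin r → E) (w : Fin r → E →L[ℝ] ℝ) :
    covectorDet v w = ∑ σ : Equiv.Perm (Fin r), (Equiv.Perm.sign σ : ℝ) * ∏ a, w a (v (σ a)) := by
  change (Matrix.of fun a b => w a (v b)).det = _
  rw [← Matrix.det_transpose, Matrix.det_apply']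
  simp

theorem covectorDet_update_zero {r : ℕ} (v : Fin r → E) (w : Fin r → E →L[ℝ] ℝ) (s : Fin r) :
    covectorDet v (Function.update w s 0) = 0 :=
  (covectorDet v).map_coord_zero s (Function.update_self ..)

theorem exists_contDiff_cutoff [FiniteDimensional ℝ E] {K U : Set E} (hK : IsCompact K)
    (hU : IsOpen U) (hKU : K ⊆ U) :
    ∃ χ : E → ℝ, ContDiff ℝ ∞ χ ∧ HasCompactSupport χ ∧ tsupport χ ⊆ U ∧
      (∀ᶠ x in 𝓝ˢ K, χ x = 1) ∧ ∀ x, χ x ∈ Icc (0 : ℝ) 1 := by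
  obtain ⟨K', hK', hKK', hK'U⟩ := exists_compact_between hK hU hKU
  obtain ⟨f, hf1, hf0, hf⟩ := exists_contMDiffMap_one_nhds_of_subset_interior (n := (⊤ : ℕ∞))
    𝓘(ℝ, E) hK.isClosed hKK'
  have hs : tsupport f ⊆ K' :=
    closure_minimal (fun x hx => by_contra fun h => hx (hf0 x h)) hK'.isClosed
  exact ⟨f, f.contMDiff.contDiff, hK'.of_isClosed_subset (isClosed_tsupport _) hs,
    hs.trans hK'U, hf1, hf⟩

theorem contDiff_mul_of_tsupport_subset {χ g : E → ℝ} {U : Set E} (hU : IsOpen U)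
    (hχ : ContDiff ℝ ∞ χ) (hs : tsupport χ ⊆ U) (hg : ContDiffOn ℝ ∞ g U) :
    ContDiff ℝ ∞ fun x => χ x * g x := by
  rw [contDiff_iff_contDiffAt]
  intro x
  by_cases hx : x ∈ tsupport χ
  · exact hχ.contDiffAt.mul (hg.contDiffAt (hU.mem_nhds (hs hx)))
  · refine contDiffAt_const (c := (0 : ℝ)) |>.congr_of_eventuallyEq ?_
    filter_upwards [notMem_tsupport_iff_eventuallyEq.mp hx] with y hy
    simp [hy]

/-- Right multiplication by the transposition is a bijection which reverses signs and preserves `F`,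
so the sum equals its own negative. -/
theorem sum_sign_mul_eq_zero_of_swap {r : ℕ} {s c : Fin r} (hsc : c ≠ s)
    (F : Equiv.Perm (Fin r) → ℝ) (hF : ∀ σ, F (σ * Equiv.swap s c) = F σ) :
    ∑ σ : Equiv.Perm (Fin r), (Equiv.Perm.sign σ : ℝ) * F σ = 0 := by
  have h := Equiv.sum_comp (Equiv.mulRight (Equiv.swap s c))
    (fun σ : Equiv.Perm (Fin r) => (Equiv.Perm.sign σ : ℝ) * F σ)
  simp only [Equiv.coe_mulRight, Equiv.Perm.sign_mul, Equiv.Perm.sign_swap hsc.symm, hF] at h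
  have h2 : ∑ σ : Equiv.Perm (Fin r), (((Equiv.Perm.sign σ * -1 : ℤˣ) : ℤ) : ℝ) * F σ =
      -∑ σ : Equiv.Perm (Fin r), (Equiv.Perm.sign σ : ℝ) * F σ := by
    rw [← Finset.sum_neg_distrib]
    refine Finset.sum_congr rfl fun σ _ => ?_
    push_cast
    ring
  rw [h2] at h
  linarith

variable [MeasurableSpace E] [BorelSpace E] [FiniteDimensional ℝ E] {μ : Measure E}
  [μ.IsAddHaarMeasure]

/-- The integral of `det (∂_{v_b} gₐ)` vanishes when one of the functions `gₐ` has compact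
support. -/
theorem integral_covectorDet_fderiv_eq_zero {r : ℕ} (v : Fin r → E) (g : Fin r → E → ℝ)
    (hg : ∀ a, ContDiff ℝ ∞ (g a)) (s : Fin r) (hs : HasCompactSupport (g s)) :
    ∫ x, covectorDet v (fun a => fderiv ℝ (g a) x) ∂μ = 0 := by
  have hd : ∀ a w, ContDiff ℝ ∞ (fun x => fderiv ℝ (g a) x w) := fun a w =>
    ((hg a).fderiv_right (m := ∞) le_rfl).clm_apply contDiff_const
  have hP : ∀ (t : Finset (Fin r)) (σ : Equiv.Perm (Fin r)),
      ContDiff ℝ ∞ (fun x => ∏ a ∈ t, fderiv ℝ (g a) x (v (σ a))) := fun t σ =>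
    contDiff_prod fun a _ => hd a _
  have hcs : ∀ w, HasCompactSupport (fun x => fderiv ℝ (g s) x w) := fun w =>
    hs.fderiv_apply (𝕜 := ℝ) w
  -- The derivative is moved off the compactly supported factor `g s`. The product rule then
  -- differentiates one further factor `c` a second time.
  have key : ∀ σ : Equiv.Perm (Fin r),
      ∫ x, ∏ a, fderiv ℝ (g a) x (v (σ a)) ∂μ =
        ∑ c ∈ Finset.univ.erase s, ∫ x, -(g s x * ((∏ a ∈ (Finset.univ.erase s).erase c,
          fderiv ℝ (g a) x (v (σ a))) *
            fderiv ℝ (fun y => fderiv ℝ (g c) y (v (σ c))) x (v (σ s)))) ∂μ := by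
    intro σ
    have h1 : ∀ x, ∏ a, fderiv ℝ (g a) x (v (σ a)) = fderiv ℝ (g s) x (v (σ s)) *
        ∏ a ∈ Finset.univ.erase s, fderiv ℝ (g a) x (v (σ a)) := fun x =>
      (Finset.mul_prod_erase _ _ (Finset.mem_univ s)).symm
    have hderiv : ∀ x, fderiv ℝ (fun y => ∏ a ∈ Finset.univ.erase s,
        fderiv ℝ (g a) y (v (σ a))) x (v (σ s)) = ∑ c ∈ Finset.univ.erase s,
          (∏ a ∈ (Finset.univ.erase s).erase c, fderiv ℝ (g a) x (v (σ a))) *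
            fderiv ℝ (fun y => fderiv ℝ (g c) y (v (σ c))) x (v (σ s)) := by
      intro x
      rw [fderiv_finsetProd (fun c _ => ((hd c _).differentiable (by simp)).differentiableAt)]
      simp
    simp_rw [h1]
    have ibp := integral_mul_fderiv_eq_neg_fderiv_mul_of_integrable (μ := μ) (v := v (σ s))
      (f := g s) (g := fun y => ∏ a ∈ Finset.univ.erase s, fderiv ℝ (g a) y (v (σ a)))
      (((hd s _).continuous.mul (hP _ σ).continuous).integrable_of_hasCompactSupport
        (hcs _).mul_right)
      (((hg s).continuous.mul (((hP _ σ).continuous_fderiv (by simp)).clm_apply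
        continuous_const)).integrable_of_hasCompactSupport hs.mul_right)
      (((hg s).continuous.mul (hP _ σ).continuous).integrable_of_hasCompactSupport hs.mul_right)
      (fun x _ => ((hg s).differentiable (by simp)).differentiableAt)
      (fun x _ => ((hP _ σ).differentiable (by simp)).differentiableAt)
    rw [← neg_neg (∫ x, fderiv ℝ (g s) x (v (σ s)) * _ ∂μ), ← ibp, ← integral_neg,
      ← integral_finsetSum]
    · refine integral_congr_ae (.of_forall fun x => ?_)
      simp only [hderiv, Finset.mul_sum, Finset.sum_neg_distrib]
    · intro c _
      refine Continuous.integrable_of_hasCompactSupport ?_ ?_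
      · exact ((hg s).continuous.mul ((hP _ σ).continuous.mul
          (((hd c _).continuous_fderiv (by simp)).clm_apply continuous_const))).neg
      · exact HasCompactSupport.neg hs.mul_right
  simp_rw [covectorDet_apply]
  rw [integral_finsetSum]
  swap
  · intro σ _
    refine Integrable.const_mul (Continuous.integrable_of_hasCompactSupport
      (hP Finset.univ σ).continuous ?_) _
    have h1 : (fun x => ∏ a, fderiv ℝ (g a) x (v (σ a))) = fun x =>
        fderiv ℝ (g s) x (v (σ s)) * ∏ a ∈ Finset.univ.erase s, fderiv ℝ (g a) x (v (σ a)) := by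
      ext x
      exact (Finset.mul_prod_erase _ _ (Finset.mem_univ s)).symm
    rw [h1]
    exact (hcs _).mul_right
  simp_rw [integral_const_mul, key, Finset.mul_sum]
  -- For fixed `c` the two indices `s` and `c` enter only through a second derivative of `g c`. Its
  -- symmetry makes the term invariant under exchanging them, and the signed sum over `σ` cancels.
  rw [Finset.sum_comm]
  refine Finset.sum_eq_zero fun c hc => ?_
  have hcs' : c ≠ s := Finset.ne_of_mem_erase hc
  refine sum_sign_mul_eq_zero_of_swap hcs' _ fun σ => integral_congr_ae (.of_forall fun x => ?_)
  have hsym : fderiv ℝ (fun y => fderiv ℝ (g c) y (v (σ s))) x (v (σ c)) =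
      fderiv ℝ (fun y => fderiv ℝ (g c) y (v (σ c))) x (v (σ s)) := by
    have hdd : DifferentiableAt ℝ (fderiv ℝ (g c)) x :=
      (((hg c).fderiv_right (m := ∞) le_rfl).differentiable (by simp)).differentiableAt
    have h2 := (hg c).contDiffAt (x := x) |>.isSymmSndFDerivAt
      (by rw [minSmoothness_of_isRCLikeNormedField]; exact ENat.LEInfty.out)
    have h3 : ∀ w, fderiv ℝ (fun y => fderiv ℝ (g c) y w) x =
        (fderiv ℝ (fderiv ℝ (g c)) x).flip w := fun w => by
      rw [fderiv_clm_apply hdd (differentiableAt_const _)]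
      simp
    rw [h3, h3]
    exact h2 _ _
  have hprod : ∏ a ∈ (Finset.univ.erase s).erase c, fderiv ℝ (g a) x (v ((σ * Equiv.swap s c) a)) =
      ∏ a ∈ (Finset.univ.erase s).erase c, fderiv ℝ (g a) x (v (σ a)) := by
    refine Finset.prod_congr rfl fun a ha => ?_
    simp only [Finset.mem_erase, Finset.mem_univ, and_true] at ha
    simp [Equiv.swap_apply_of_ne_of_ne ha.2 ha.1]
  beta_reduce
  rw [hprod]
  simp only [Equiv.Perm.mul_apply, Equiv.swap_apply_left, Equiv.swap_apply_right, hsym]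

/-- Putting `ψ g_s` in row `s` gives a determinant of differentials with a compactly supported
entry, whose integral is zero; the Leibniz rule splits it into the two integrands. The cutoff `χ`,
equal to one near the support of `ψ`, only serves to make functions defined on `U` globally smooth.
-/
theorem integral_mul_covectorDet_fderiv {r : ℕ} (v : Fin r → E) {U : Set E} (hU : IsOpen U)
    {g : Fin r → E → ℝ} (hg : ∀ a, ContDiffOn ℝ ∞ (g a) U) {ψ : E → ℝ} (hψ : ContDiff ℝ ∞ ψ)
    (hψc : HasCompactSupport ψ) (hψU : tsupport ψ ⊆ U) (s : Fin r) :
    ∫ x, ψ x * covectorDet v (fun a => fderiv ℝ (g a) x) ∂μ =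
      -∫ x, g s x * covectorDet v
        (Function.update (fun a => fderiv ℝ (g a) x) s (fderiv ℝ ψ x)) ∂μ := by
  obtain ⟨χ, hχ, -, hχU, hχ1, -⟩ := exists_contDiff_cutoff hψc hU hψU
  have hχg : ∀ a, ContDiff ℝ ∞ (fun x => χ x * g a x) := fun a =>
    contDiff_mul_of_tsupport_subset hU hχ hχU (hg a)
  set G : Fin r → E → ℝ := Function.update (fun a x => χ x * g a x) s
    (fun x => ψ x * (χ x * g s x)) with hG
  have hψ0 : ∀ x ∉ tsupport ψ, ψ x = 0 ∧ fderiv ℝ ψ x = 0 := fun x hx =>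
    ⟨image_eq_zero_of_notMem_tsupport hx,
      by rw [(notMem_tsupport_iff_eventuallyEq.mp hx).fderiv_eq]; simp⟩
  have hGs : HasCompactSupport (G s) := by
    rw [hG, Function.update_self]; exact hψc.mul_right
  have hGd : ∀ a, ContDiff ℝ ∞ (G a) := fun a => by
    by_cases ha : a = s
    · subst ha; rw [hG, Function.update_self]; exact hψ.mul (hχg a)
    · rw [hG, Function.update_of_ne ha]; exact hχg a
  have hA := integral_covectorDet_fderiv_eq_zero (μ := μ) v G hGd s hGs
  have hχx : ∀ x ∈ tsupport ψ, χ =ᶠ[𝓝 x] fun _ => 1 := fun x hx =>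
    hχ1.filter_mono (nhds_le_nhdsSet hx)
  have hdx : ∀ x ∈ tsupport ψ, ∀ a, fderiv ℝ (fun x => χ x * g a x) x = fderiv ℝ (g a) x :=
    fun x hx a => Filter.EventuallyEq.fderiv_eq (by
      filter_upwards [hχx x hx] with y hy; simp [hy])
  have hpt : ∀ x, covectorDet v (fun a => fderiv ℝ (G a) x) =
      ψ x * covectorDet v (fun a => fderiv ℝ (g a) x) + g s x * covectorDet v
        (Function.update (fun a => fderiv ℝ (g a) x) s (fderiv ℝ ψ x)) := by
    intro x
    have hGx : (fun a => fderiv ℝ (G a) x) =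
        Function.update (fun a => fderiv ℝ (fun x => χ x * g a x) x) s
          (ψ x • fderiv ℝ (fun x => χ x * g s x) x + (χ x * g s x) • fderiv ℝ ψ x) := by
      ext1 a
      by_cases ha : a = s
      · subst ha
        rw [hG, Function.update_self, Function.update_self]
        exact fderiv_fun_mul (hψ.differentiable (by simp)).differentiableAt
          ((hχg a).differentiable (by simp)).differentiableAt
      · rw [hG, Function.update_of_ne ha, Function.update_of_ne ha]
    rw [hGx, ContinuousMultilinearMap.map_update_add, ContinuousMultilinearMap.map_update_smul,
      ContinuousMultilinearMap.map_update_smul, Function.update_eq_self]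
    by_cases hx : x ∈ tsupport ψ
    · simp only [hdx x hx, (hχx x hx).self_of_nhds, one_mul, smul_eq_mul]
    · obtain ⟨h1, h2⟩ := hψ0 x hx
      simp [h1, h2, covectorDet_update_zero]
  have hc : ∀ a x, x ∈ tsupport ψ → ContinuousAt (fun x => fderiv ℝ (g a) x) x := fun a x hx =>
    (((hg a).contDiffAt (hU.mem_nhds (hψU hx))).fderiv_right (m := ∞) le_rfl).continuousAt
  have hi1 : Integrable (fun x => ψ x * covectorDet v (fun a => fderiv ℝ (g a) x)) μ := by
    have : (fun x => ψ x * covectorDet v (fun a => fderiv ℝ (g a) x)) =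
        fun x => ψ x * covectorDet v (fun a => fderiv ℝ (fun x => χ x * g a x) x) := by
      ext x
      by_cases hx : x ∈ tsupport ψ
      · simp only [hdx x hx]
      · simp [(hψ0 x hx).1]
    rw [this]
    exact (hψ.continuous.mul ((covectorDet v).cont.comp (continuous_pi fun a =>
      (hχg a).continuous_fderiv (by simp)))).integrable_of_hasCompactSupport hψc.mul_right
  have hi0 : Integrable (fun x => covectorDet v (fun a => fderiv ℝ (G a) x)) μ := by
    refine Continuous.integrable_of_hasCompactSupport ((covectorDet v).cont.comp
      (continuous_pi fun a => (hGd a).continuous_fderiv (by simp))) ?_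
    refine HasCompactSupport.intro hψc fun x hx => ?_
    obtain ⟨h1, h2⟩ := hψ0 x hx
    simp [hpt, h1, h2, covectorDet_update_zero]
  rw [← add_eq_zero_iff_eq_neg, ← hA, ← integral_add hi1]
  · exact integral_congr_ae (.of_forall fun x => (hpt x).symm)
  · refine (hi0.sub hi1).congr (.of_forall fun x => ?_)
    simp [hpt]

end DetIntegration

/-! ### Weak convergence of the minors of Sobolev maps -/

section Minors

/-- If `x ≤ δ y` the first term dominates; otherwise `y ≤ x / δ` and the second does. This replaces
Young's inequality and, unlike the version with the exponent `p / (p - 1)`, includes `p = 1`. -/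
theorem mul_rpow_sub_one_le {p δ x y : ℝ} (hp : 1 ≤ p) (hδ : 0 < δ) (hx : 0 ≤ x) (hy : 0 < y) :
    x * y ^ (p - 1) ≤ δ * y ^ p + δ ^ (1 - p) * x ^ p := by
  have hyp : y ^ p = y * y ^ (p - 1) := by
    rw [← Real.rpow_one_add' hy.le (by linarith)]; congr 1; ring
  have hδx : 0 ≤ δ ^ (1 - p) * x ^ p := by positivity
  rcases le_total x (δ * y) with h | h
  · have : x * y ^ (p - 1) ≤ δ * y * y ^ (p - 1) := by gcongr
    rw [hyp]; linarith
  · have h1 : y ^ (p - 1) ≤ (x / δ) ^ (p - 1) := by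
      apply Real.rpow_le_rpow hy.le _ (by linarith)
      rw [le_div_iff₀ hδ]; linarith
    have hx0 : 0 < x := lt_of_lt_of_le (by positivity) h
    have h2 : x * (x / δ) ^ (p - 1) = δ ^ (1 - p) * x ^ p := by
      rw [Real.div_rpow hx hδ.le, show (1 - p) = -(p - 1) by ring, Real.rpow_neg hδ.le,
        show x ^ p = x * x ^ (p - 1) by
          rw [← Real.rpow_one_add' hx (by linarith)]; congr 1; ring]
      field_simp
    have : 0 ≤ δ * y ^ p := by positivity
    nlinarith [mul_le_mul_of_nonneg_left h1 hx]

theorem add_rpow_le_two_rpow_mul {p a b : ℝ} (hp : 1 ≤ p) (ha : 0 ≤ a) (hb : 0 ≤ b) :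
    (a + b) ^ p ≤ 2 ^ p * (a ^ p + b ^ p) := by
  have h := Real.rpow_sum_le_const_mul_sum_rpow_of_nonneg (Finset.univ : Finset (Fin 2))
    (f := ![a, b]) hp (by intro i _; fin_cases i <;> simpa)
  simp only [Fin.sum_univ_two, Matrix.cons_val_zero, Matrix.cons_val_one, Finset.card_univ,
    Fintype.card_fin, Nat.cast_ofNat] at h
  refine h.trans (mul_le_mul_of_nonneg_right ?_ (by positivity))
  exact Real.rpow_le_rpow_of_exponent_le (by norm_num) (by linarith)

theorem tendsto_of_forall_approx {a : ℕ → ℝ} {l : ℝ}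
    (h : ∀ ε > 0, ∃ (a' : ℕ → ℝ) (l' : ℝ), Tendsto a' atTop (𝓝 l') ∧
      (∀ᶠ n in atTop, |a n - a' n| ≤ ε) ∧ |l - l'| ≤ ε) : Tendsto a atTop (𝓝 l) := by
  rw [Metric.tendsto_atTop']
  intro ε hε
  obtain ⟨a', l', h1, h2, h3⟩ := h (ε / 4) (by positivity)
  have h4 := (Metric.tendsto_nhds.mp h1) (ε / 4) (by positivity)
  obtain ⟨N, hN⟩ := eventually_atTop.mp (h2.and h4)
  refine ⟨N, fun n hn => ?_⟩
  obtain ⟨h5, h6⟩ := hN n hn.le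
  rw [Real.dist_eq] at h6 ⊢
  rw [abs_le] at h5 h3
  rw [abs_lt] at h6 ⊢
  constructor <;> linarith [h5.1, h5.2, h3.1, h3.2, h6.1, h6.2]

variable {E F : Type*} [NormedAddCommGroup E] [NormedSpace ℝ E] [NormedAddCommGroup F]
  [NormedSpace ℝ F] [CompleteSpace F] [MeasurableSpace E] [BorelSpace E] [FiniteDimensional ℝ E]

/-- The smooth maps `f j` on `U` are locally bounded in `W^{1,p}` and converge in `L^p_loc` to the
map `g`, whose weak derivative is `G`. -/
structure WeakSobolevConvergence (μ : Measure E) (p : ℝ) (U : Set E) (f : ℕ → E → F) (g : E → F)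
    (G : E → E →L[ℝ] F) : Prop where
  contDiffOn : ∀ j, ContDiffOn ℝ ∞ (f j) U
  exists_bound : ∀ K ⊆ U, IsCompact K → ∃ B : ℝ, ∀ j, ∫ x in K, ‖fderiv ℝ (f j) x‖ ^ p ∂μ ≤ B
  tendsto : ∀ K ⊆ U, IsCompact K → Tendsto (fun j => ∫ x in K, ‖f j x - g x‖ ^ p ∂μ) atTop (𝓝 0)
  memLp : ∀ K ⊆ U, IsCompact K → MemLp g (ENNReal.ofReal p) (μ.restrict K)
  memLp_deriv : ∀ K ⊆ U, IsCompact K → MemLp G (ENNReal.ofReal p) (μ.restrict K)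
  weakDeriv : ∀ ψ : E → ℝ, ContDiff ℝ ∞ ψ → HasCompactSupport ψ → tsupport ψ ⊆ U → ∀ v : E,
    ∫ x, fderiv ℝ ψ x v • g x ∂μ = -∫ x, ψ x • G x v ∂μ

namespace WeakSobolevConvergence

variable {μ : Measure E} [μ.IsAddHaarMeasure] {p : ℝ} {U : Set E} {f : ℕ → E → F} {g : E → F}
  {G : E → E →L[ℝ] F}

theorem continuousOn_fderiv (h : WeakSobolevConvergence μ p U f g G) (hU : IsOpen U) (j : ℕ) :
    ContinuousOn (fderiv ℝ (f j)) U :=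
  (h.contDiffOn j).continuousOn_fderiv_of_isOpen hU (by simp)

theorem memLp_of_continuousOn {F' : Type*} [NormedAddCommGroup F'] {K : Set E} {a : E → F'}
    (hK : IsCompact K) (ha : ContinuousOn a K) (q : ENNReal) : MemLp a q (μ.restrict K) := by
  have : IsFiniteMeasure (μ.restrict K) := ⟨by simpa using hK.measure_lt_top⟩
  obtain ⟨C, hC⟩ := hK.exists_bound_of_continuousOn ha
  exact MemLp.of_bound (ha.aestronglyMeasurable hK.measurableSet) C
    ((ae_restrict_iff' hK.measurableSet).mpr (.of_forall hC))

theorem integrableOn_norm_rpow {F' : Type*} [NormedAddCommGroup F'] {K : Set E} {a : E → F'}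
    (hp : 1 ≤ p) (ha : MemLp a (ENNReal.ofReal p) (μ.restrict K)) :
    IntegrableOn (fun x => ‖a x‖ ^ p) K μ := by
  have := ha.integrable_norm_rpow (by simp; linarith) (by simp)
  rwa [ENNReal.toReal_ofReal (by linarith)] at this

theorem exists_forall_integral_sub_le (h : WeakSobolevConvergence μ p U f g G) (hp : 1 ≤ p)
    {K : Set E} (hKU : K ⊆ U) (hK : IsCompact K) {ε : ℝ} (hε : 0 < ε) :
    ∃ J, ∀ i ≥ J, ∀ j ≥ J, ∫ x in K, ‖f i x - f j x‖ ^ p ∂μ ≤ ε := by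
  have h2 : (0 : ℝ) < 2 ^ p := by positivity
  obtain ⟨J, hJ⟩ := eventually_atTop.mp ((h.tendsto K hKU hK).eventually
    (gt_mem_nhds (show (0 : ℝ) < ε / (2 ^ p * 2) by positivity)))
  refine ⟨J, fun i hi j hj => ?_⟩
  have hc : ∀ i, ContinuousOn (f i) K := fun i => (h.contDiffOn i).continuousOn.mono hKU
  have hm : ∀ i, IntegrableOn (fun x => ‖f i x - g x‖ ^ p) K μ := fun i =>
    integrableOn_norm_rpow hp ((memLp_of_continuousOn hK (hc i) _).sub (h.memLp K hKU hK))
  calc ∫ x in K, ‖f i x - f j x‖ ^ p ∂μ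
      ≤ ∫ x in K, 2 ^ p * (‖f i x - g x‖ ^ p + ‖f j x - g x‖ ^ p) ∂μ := by
        refine integral_mono (integrableOn_norm_rpow hp
          (memLp_of_continuousOn hK ((hc i).sub (hc j)) _)) (((hm i).add (hm j)).const_mul _) ?_
        intro x
        refine le_trans ?_ (add_rpow_le_two_rpow_mul hp (norm_nonneg _) (norm_nonneg _))
        refine Real.rpow_le_rpow (norm_nonneg _) ?_ (by linarith)
        rw [show f i x - f j x = (f i x - g x) - (f j x - g x) by abel]
        exact norm_sub_le _ _
    _ = 2 ^ p * (∫ x in K, ‖f i x - g x‖ ^ p ∂μ + ∫ x in K, ‖f j x - g x‖ ^ p ∂μ) := by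
        rw [integral_const_mul, integral_add (hm i) (hm j)]
    _ ≤ 2 ^ p * (ε / (2 ^ p * 2) + ε / (2 ^ p * 2)) := by
        gcongr
        · exact (hJ i hi).le
        · exact (hJ j hj).le
    _ = ε := by field_simp; norm_num

theorem integrable_of_continuousOn {F' : Type*} [NormedAddCommGroup F'] {K : Set E} {a : E → F'}
    (hK : IsCompact K) (ha : ContinuousOn a K) (h0 : ∀ x ∉ K, a x = 0) : Integrable a μ :=
  (integrableOn_iff_integrable_of_support_subset fun x hx => by_contra fun hxK => hx (h0 x hxK)).mp
    (ha.integrableOn_compact hK)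

theorem integral_norm_mul_rpow_le {F' : Type*} [NormedAddCommGroup F'] {K : Set E}
    {a : E → F'} {y : E → ℝ} {δ : ℝ} (hp : 1 ≤ p) (hδ : 0 < δ)
    (ha : IntegrableOn (fun x => ‖a x‖ ^ p) K μ) (hy : IntegrableOn (fun x => y x ^ p) K μ)
    (hy0 : ∀ x, 0 < y x) :
    ∫ x in K, ‖a x‖ * y x ^ (p - 1) ∂μ ≤
      δ * ∫ x in K, y x ^ p ∂μ + δ ^ (1 - p) * ∫ x in K, ‖a x‖ ^ p ∂μ := by
  rw [← integral_const_mul, ← integral_const_mul, ← integral_add (hy.const_mul _) (ha.const_mul _)]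
  refine integral_mono_of_nonneg (.of_forall fun x => ?_) ((hy.const_mul _).add (ha.const_mul _))
    (.of_forall fun x => ?_)
  · have := hy0 x
    simp only [Pi.zero_apply]
    positivity
  · exact mul_rpow_sub_one_le hp hδ (norm_nonneg _) (hy0 x)

theorem tendsto_integral_norm_of_rpow {F' : Type*} [NormedAddCommGroup F'] {K : Set E}
    (hK : IsCompact K) {a : ℕ → E → F'} (hp : 1 ≤ p)
    (ha : ∀ j, IntegrableOn (fun x => ‖a j x‖ ^ p) K μ)
    (h : Tendsto (fun j => ∫ x in K, ‖a j x‖ ^ p ∂μ) atTop (𝓝 0)) :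
    Tendsto (fun j => ∫ x in K, ‖a j x‖ ∂μ) atTop (𝓝 0) := by
  rw [Metric.tendsto_atTop']
  intro ε hε
  set V := μ.real K
  have hV : 0 ≤ V := measureReal_nonneg
  set δ := ε / (2 * (V + 1)) with hδd
  have hδ : 0 < δ := by positivity
  have hδp : 0 < δ ^ (1 - p) := by positivity
  obtain ⟨N, hN⟩ := eventually_atTop.mp (h.eventually (gt_mem_nhds
    (show (0 : ℝ) < ε / 2 / δ ^ (1 - p) by positivity)))
  refine ⟨N, fun j hj => ?_⟩
  -- With weight one the inequality bounds the `L^1` norm by `δ` times the volume plus a multiple of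
  -- the integral of the `p`-th power; `δ` makes the first part less than `ε / 2`.
  have h1 := integral_norm_mul_rpow_le (μ := μ) (K := K) (a := a j) (y := fun _ => 1) hp hδ (ha j)
    (by simpa using hK.measure_lt_top) (fun _ => one_pos)
  simp only [Real.one_rpow, mul_one, integral_const, smul_eq_mul, measureReal_restrict_apply_univ]
    at h1
  have h2 := hN j hj.le
  rw [lt_div_iff₀ hδp] at h2
  have h3 : δ * V < ε / 2 := by
    rw [hδd, div_mul_eq_mul_div, div_lt_div_iff₀ (by positivity) (by positivity)]
    nlinarith
  rw [Real.dist_eq, sub_zero, abs_of_nonneg (integral_nonneg fun _ => norm_nonneg _)]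
  change ∫ x in K, ‖a j x‖ ∂μ ≤ δ * V + _ at h1
  linarith

/-- The derivatives of the approximating maps, tested against a smooth function. -/
theorem tendsto_integral_mul_of_contDiff (h : WeakSobolevConvergence μ p U f g G) (hp : 1 ≤ p)
    (hU : IsOpen U) (ξ : F →L[ℝ] ℝ) (e : E) {ψ : E → ℝ} (hψ : ContDiff ℝ ∞ ψ)
    (hψc : HasCompactSupport ψ) (hψU : tsupport ψ ⊆ U) :
    Tendsto (fun j => ∫ x, ψ x * ξ (fderiv ℝ (f j) x e) ∂μ) atTop
      (𝓝 (∫ x, ψ x * ξ (G x e) ∂μ)) := by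
  set K := tsupport ψ with hKdef
  have hK : IsCompact K := hψc
  have : IsFiniteMeasure (μ.restrict K) := ⟨by simpa using hK.measure_lt_top⟩
  have hψ0 : ∀ x ∉ K, ψ x = 0 ∧ fderiv ℝ ψ x = 0 := fun x hx =>
    ⟨image_eq_zero_of_notMem_tsupport hx,
      by rw [(notMem_tsupport_iff_eventuallyEq.mp hx).fderiv_eq]; simp⟩
  have hdψ : Continuous fun x => fderiv ℝ ψ x e :=
    (hψ.continuous_fderiv (by simp)).clm_apply continuous_const
  have hp1 : (1 : ENNReal) ≤ ENNReal.ofReal p := by simpa using hp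
  have hgi : IntegrableOn g K μ := (h.memLp K hψU hK).integrable hp1
  have hGi : IntegrableOn G K μ := (h.memLp_deriv K hψU hK).integrable hp1
  obtain ⟨C, hC⟩ := hK.exists_bound_of_continuousOn hdψ.continuousOn
  obtain ⟨C', hC'⟩ := hK.exists_bound_of_continuousOn hψ.continuous.continuousOn
  have hlim : ∫ x, ψ x * ξ (G x e) ∂μ = -∫ x in K, fderiv ℝ ψ x e * ξ (g x) ∂μ := by
    have h1 := congrArg ξ (h.weakDeriv ψ hψ hψc hψU e)
    rw [map_neg, ← setIntegral_eq_integral_of_forall_compl_eq_zero (s := K)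
      (fun x hx => by simp [hψ0 x hx]), ← setIntegral_eq_integral_of_forall_compl_eq_zero (s := K)
      (f := fun x => ψ x • G x e) (fun x hx => by simp [hψ0 x hx]),
      ← ContinuousLinearMap.integral_comp_comm, ← ContinuousLinearMap.integral_comp_comm] at h1
    · simp only [map_smul, smul_eq_mul] at h1
      rw [h1, neg_neg, setIntegral_eq_integral_of_forall_compl_eq_zero]
      exact fun x hx => by simp [hψ0 x hx]
    · exact ((ContinuousLinearMap.apply ℝ F e).integrable_comp hGi).bdd_smul (C := C')
        hψ.continuous.aestronglyMeasurable ((ae_restrict_iff' hK.measurableSet).mpr (.of_forall hC'))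
    · exact hgi.bdd_smul (C := C) hdψ.aestronglyMeasurable
        ((ae_restrict_iff' hK.measurableSet).mpr (.of_forall hC))
  have hfd : ∀ j, ∀ x ∈ K, DifferentiableAt ℝ (f j) x := fun j x hx =>
    ((h.contDiffOn j).contDiffAt (hU.mem_nhds (hψU hx))).differentiableAt (by simp)
  have hseq : ∀ j, ∫ x, ψ x * ξ (fderiv ℝ (f j) x e) ∂μ =
      -∫ x in K, fderiv ℝ ψ x e * ξ (f j x) ∂μ := by
    intro j
    have hd : ∀ x ∈ K, HasFDerivAt (fun x => ξ (f j x)) (ξ.comp (fderiv ℝ (f j) x)) x :=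
      fun x hx => ξ.hasFDerivAt.comp x (hfd j x hx).hasFDerivAt
    have hc : ContinuousOn (f j) K := (h.contDiffOn j).continuousOn.mono hψU
    have hdc : ContinuousOn (fun x => fderiv ℝ (f j) x) K := (h.continuousOn_fderiv hU j).mono hψU
    have e1 : ∀ x, ψ x * ξ (fderiv ℝ (f j) x e) = ψ x * fderiv ℝ (fun x => ξ (f j x)) x e := by
      intro x
      by_cases hx : x ∈ K
      · rw [(hd x hx).fderiv]; rfl
      · simp [hψ0 x hx]
    have hi : Integrable (fun x => ψ x * fderiv ℝ (fun x => ξ (f j x)) x e) μ := by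
      simp_rw [← e1]
      exact integrable_of_continuousOn hK (hψ.continuous.continuousOn.mul
        (ξ.continuous.comp_continuousOn (hdc.clm_apply continuousOn_const)))
        (fun x hx => by simp [hψ0 x hx])
    rw [setIntegral_eq_integral_of_forall_compl_eq_zero (fun x hx => by simp [hψ0 x hx])]
    simp_rw [e1]
    exact integral_mul_fderiv_eq_neg_fderiv_mul_of_integrable
      (integrable_of_continuousOn hK (hdψ.continuousOn.mul (ξ.continuous.comp_continuousOn hc))
        (fun x hx => by simp [hψ0 x hx])) hi
      (integrable_of_continuousOn hK (hψ.continuous.continuousOn.mul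
        (ξ.continuous.comp_continuousOn hc)) (fun x hx => by simp [hψ0 x hx]))
      (fun x _ => (hψ.differentiable (by simp)).differentiableAt)
      (fun x hx => (hd x hx).differentiableAt)
  -- After integrating by parts on both sides no derivative of `f j` or of `g` is left, and
  -- convergence in `L^1` on the support of `ψ` is enough.
  simp_rw [hseq, hlim]
  refine Tendsto.neg ?_
  rw [tendsto_iff_norm_sub_tendsto_zero]
  have hfi : ∀ j, IntegrableOn (f j) K μ := fun j =>
    ((h.contDiffOn j).continuousOn.mono hψU).integrableOn_compact hK
  have hn := tendsto_integral_norm_of_rpow hK (a := fun j x => f j x - g x) hp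
    (fun j => integrableOn_norm_rpow hp ((memLp_of_continuousOn hK
      ((h.contDiffOn j).continuousOn.mono hψU) _).sub (h.memLp K hψU hK))) (h.tendsto K hψU hK)
  have hn2 := hn.const_mul (C * ‖ξ‖)
  rw [mul_zero] at hn2
  refine squeeze_zero (fun _ => norm_nonneg _) (fun j => ?_) hn2
  have hb : ∀ a : E → F, IntegrableOn a K μ →
      IntegrableOn (fun x => fderiv ℝ ψ x e * ξ (a x)) K μ := fun a ha =>
    (ξ.integrable_comp ha).bdd_mul (c := C) hdψ.aestronglyMeasurable
      ((ae_restrict_iff' hK.measurableSet).mpr (.of_forall hC))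
  rw [← integral_sub (hb _ (hfi j)) (hb _ hgi), ← integral_const_mul]
  refine norm_integral_le_of_norm_le (((hfi j).sub hgi).norm.const_mul _)
    ((ae_restrict_iff' hK.measurableSet).mpr (.of_forall fun x hx => ?_))
  rw [← mul_sub, ← map_sub, norm_mul, mul_assoc]
  exact mul_le_mul (hC x hx) (ξ.le_opNorm _) (norm_nonneg _) ((norm_nonneg _).trans (hC x hx))

theorem abs_integral_mul_le {K : Set E} {q : ℝ} (hpq : p.HolderConjugate q) {b : E → ℝ}
    {D : E → E →L[ℝ] F} (ξ : F →L[ℝ] ℝ) (e : E)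
    (hb : MemLp b (ENNReal.ofReal q) (μ.restrict K))
    (hD : MemLp D (ENNReal.ofReal p) (μ.restrict K)) :
    |∫ x in K, b x * ξ (D x e) ∂μ| ≤ ‖ξ‖ * ‖e‖ * ((∫ x in K, ‖b x‖ ^ q ∂μ) ^ (1 / q) *
      (∫ x in K, ‖D x‖ ^ p ∂μ) ^ (1 / p)) := by
  have h1 := integral_mul_le_Lp_mul_Lq_of_nonneg hpq.symm
    (.of_forall fun x => norm_nonneg (b x)) (.of_forall fun x => norm_nonneg (D x)) hb.norm hD.norm
  refine le_trans ?_ (mul_le_mul_of_nonneg_left h1 (by positivity))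
  rw [← integral_const_mul, ← Real.norm_eq_abs]
  have hi : Integrable (fun x => ‖b x‖ * ‖D x‖) (μ.restrict K) := by
    have := hpq.symm.ennrealOfReal
    exact hb.norm.integrable_mul hD.norm
  refine norm_integral_le_of_norm_le (hi.const_mul _) (.of_forall fun x => ?_)
  rw [norm_mul]
  calc ‖b x‖ * ‖ξ (D x e)‖ ≤ ‖b x‖ * (‖ξ‖ * (‖D x‖ * ‖e‖)) := by
        gcongr
        exact (ξ.le_opNorm _).trans (by gcongr; exact (D x).le_opNorm e)
    _ = _ := by ring

/-- For `p > 1` the conjugate exponent is finite, so `b` is an `L^q` limit of smooth compactly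
supported functions. By Hölder the error is uniform in `j`, because the derivatives are bounded in
`L^p` on the support of a cutoff. -/
theorem tendsto_integral_mul_of_memLp (h : WeakSobolevConvergence μ p U f g G) (hp : 1 < p)
    (hU : IsOpen U) (ξ : F →L[ℝ] ℝ) (e : E) {K : Set E} (hKU : K ⊆ U) (hK : IsCompact K) {b : E → ℝ}
    (hb : MemLp b (ENNReal.ofReal (p / (p - 1))) (μ.restrict K)) (hb0 : ∀ x ∉ K, b x = 0) :
    Tendsto (fun j => ∫ x, b x * ξ (fderiv ℝ (f j) x e) ∂μ) atTop
      (𝓝 (∫ x, b x * ξ (G x e) ∂μ)) := by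
  set q := p / (p - 1)
  have hpq : p.HolderConjugate q := Real.HolderConjugate.conjExponent hp
  have hq1 : 1 < q := hpq.symm.lt
  have hbm : MemLp b (ENNReal.ofReal q) μ := by
    rw [← memLp_indicator_iff_restrict hK.measurableSet] at hb
    rwa [indicator_eq_self.mpr] at hb
    exact fun x hx => by_contra fun hxK => hx (hb0 x hxK)
  obtain ⟨χ, hχ, hχc, hχU, hχ1, hχI⟩ := exists_contDiff_cutoff hK hU hKU
  set K' := tsupport χ
  have hK' : IsCompact K' := hχc
  obtain ⟨B, hB⟩ := h.exists_bound K' hχU hK'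
  -- One bound for the sequence and for the limit, so that `hest` applies to both.
  set B' := max B (∫ x in K', ‖G x‖ ^ p ∂μ)
  have hB'0 : 0 ≤ B' := le_max_of_le_right (integral_nonneg fun x => by positivity)
  refine tendsto_of_forall_approx fun ε hε => ?_
  set A := ‖ξ‖ * ‖e‖ * B' ^ (1 / p) with hA
  have hA0 : 0 ≤ A := by positivity
  set η := ε / (A + 1) with hη
  have hη0 : 0 < η := by positivity
  obtain ⟨H, hHc, hH, hHb⟩ := hbm.exist_eLpNorm_sub_le (by simp) (by simpa using hq1.le) hη0
  have hHs : ContDiff ℝ ∞ (fun x => χ x * H x) := hχ.mul hH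
  have hHsupp : tsupport (fun x => χ x * H x) ⊆ K' := tsupport_mul_subset_left
  -- Since `χ` is one where `b` can be nonzero, `b = χ b`, and cutting off the approximant does not
  -- enlarge the error.
  have hdiff : ∀ x, b x - χ x * H x = χ x * (b x - H x) := by
    intro x
    by_cases hx : x ∈ K
    · rw [hχ1.self_of_nhdsSet x hx]; ring
    · rw [hb0 x hx]; ring
  have hml : MemLp (fun x => b x - χ x * H x) (ENNReal.ofReal q) (μ.restrict K') := by
    exact (hbm.sub (hHs.continuous.memLp_of_hasCompactSupport (hχc.mul_right))).restrict _
  have hbound : (∫ x in K', ‖b x - χ x * H x‖ ^ q ∂μ) ^ (1 / q) ≤ η := by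
    have h1 : eLpNorm (fun x => b x - χ x * H x) (ENNReal.ofReal q) (μ.restrict K') ≤
        ENNReal.ofReal η := by
      refine (eLpNorm_mono_measure _ Measure.restrict_le_self).trans (le_trans ?_ hHb)
      refine eLpNorm_mono fun x => ?_
      rw [hdiff, norm_mul, Pi.sub_apply]
      refine mul_le_of_le_one_left (norm_nonneg _) ?_
      rw [Real.norm_eq_abs, abs_of_nonneg (hχI x).1]
      exact (hχI x).2
    rw [hml.eLpNorm_eq_integral_rpow_norm (by simp; linarith) (by simp),
      ENNReal.toReal_ofReal (by linarith), ENNReal.ofReal_le_ofReal_iff hη0.le] at h1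
    rwa [one_div]
  have hest : ∀ D : E → E →L[ℝ] F, MemLp D (ENNReal.ofReal p) (μ.restrict K') →
      ∫ x in K', ‖D x‖ ^ p ∂μ ≤ B' →
      |∫ x, b x * ξ (D x e) ∂μ - ∫ x, χ x * H x * ξ (D x e) ∂μ| ≤ ε := by
    intro D hD hDB
    have hx0 : ∀ x ∉ K', χ x = 0 := fun x hx => image_eq_zero_of_notMem_tsupport hx
    have hb0' : ∀ x ∉ K', b x = 0 := fun x hx => hb0 x fun hxK => by
      have := hχ1.self_of_nhdsSet x hxK
      rw [hx0 x hx] at this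
      exact zero_ne_one this
    have := hpq.symm.ennrealOfReal
    have hDe : MemLp (fun x => ξ (D x e)) (ENNReal.ofReal p) (μ.restrict K') :=
      (ξ.comp (ContinuousLinearMap.apply ℝ F e)).comp_memLp' hD
    have hi1 : Integrable (fun x => b x * ξ (D x e)) (μ.restrict K') :=
      (hbm.restrict K').integrable_mul hDe
    have hi2 : Integrable (fun x => χ x * H x * ξ (D x e)) (μ.restrict K') :=
      (memLp_of_continuousOn hK' hHs.continuous.continuousOn
        (ENNReal.ofReal q)).integrable_mul hDe
    rw [← setIntegral_eq_integral_of_forall_compl_eq_zero (s := K')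
      (fun x hx => by simp [hb0' x hx]), ← setIntegral_eq_integral_of_forall_compl_eq_zero (s := K')
      (f := fun x => χ x * H x * ξ (D x e)) (fun x hx => by simp [hx0 x hx]),
      ← integral_sub hi1 hi2]
    simp_rw [← sub_mul]
    refine (abs_integral_mul_le hpq ξ e hml hD).trans ?_
    calc ‖ξ‖ * ‖e‖ * ((∫ x in K', ‖b x - χ x * H x‖ ^ q ∂μ) ^ (1 / q) *
          (∫ x in K', ‖D x‖ ^ p ∂μ) ^ (1 / p)) ≤ ‖ξ‖ * ‖e‖ * (η * B' ^ (1 / p)) := by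
          gcongr
      _ = ε * (A / (A + 1)) := by rw [hη, hA]; ring
      _ ≤ ε := mul_le_of_le_one_right hε.le (by rw [div_le_one (by positivity)]; linarith)
  refine ⟨_, _, h.tendsto_integral_mul_of_contDiff hp.le hU ξ e hHs hχc.mul_right
    (hHsupp.trans hχU), .of_forall fun j => ?_, ?_⟩
  · exact hest _ (memLp_of_continuousOn hK' ((h.continuousOn_fderiv hU j).mono hχU) _)
      ((hB j).trans (le_max_left _ _))
  · exact hest _ (h.memLp_deriv K' hχU hK') (le_max_right _ _)

end WeakSobolevConvergence

end Minors

/-! ### Minors with an independent index in each row: the Cauchy property. -/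

section MinorsLimit

variable {E F : Type*} [NormedAddCommGroup E] [NormedSpace ℝ E] [NormedAddCommGroup F]
  [NormedSpace ℝ F] [CompleteSpace F] [MeasurableSpace E] [BorelSpace E] [FiniteDimensional ℝ E]

/-- With row `s` replaced by `η`, only `r - 1` rows contain a derivative, each at most a constant
times `y`. As `1 ≤ y` and `r ≤ p`, the power `y ^ (r - 1)` is at most `y ^ (p - 1)`, exactly what
can be paired with a function in `L^p`. -/
theorem abs_covectorDet_update_le {r : ℕ} {p y : ℝ} (hr : (r : ℝ) ≤ p) (hy : 1 ≤ y) (v : Fin r → E)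
    (ξ : Fin r → F →L[ℝ] ℝ) (A : Fin r → E →L[ℝ] F) (hA : ∀ a, ‖A a‖ ≤ y) (s : Fin r)
    (η : E →L[ℝ] ℝ) :
    |covectorDet v (Function.update (fun a => (ξ a).comp (A a)) s η)| ≤
      ‖covectorDet v‖ * ‖η‖ * (∏ a ∈ Finset.univ.erase s, ‖ξ a‖) * y ^ (p - 1) := by
  have h1 := (covectorDet v).le_opNorm (Function.update (fun a => (ξ a).comp (A a)) s η)
  rw [← Finset.mul_prod_erase _ _ (Finset.mem_univ s), Function.update_self] at h1
  refine h1.trans ?_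
  rw [mul_assoc, mul_assoc]
  refine mul_le_mul_of_nonneg_left (mul_le_mul_of_nonneg_left ?_ (norm_nonneg _)) (norm_nonneg _)
  calc ∏ a ∈ Finset.univ.erase s, ‖Function.update (fun a => (ξ a).comp (A a)) s η a‖
      ≤ ∏ a ∈ Finset.univ.erase s, ‖ξ a‖ * y := by
        refine Finset.prod_le_prod (fun _ _ => norm_nonneg _) fun a ha => ?_
        rw [Function.update_of_ne (Finset.ne_of_mem_erase ha)]
        exact (ContinuousLinearMap.opNorm_comp_le _ _).trans (by gcongr; exact hA a)
    _ = (∏ a ∈ Finset.univ.erase s, ‖ξ a‖) * y ^ (r - 1) := by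
        rw [Finset.prod_mul_distrib, Finset.prod_const, Finset.card_erase_of_mem (Finset.mem_univ s),
          Finset.card_univ, Fintype.card_fin]
    _ ≤ (∏ a ∈ Finset.univ.erase s, ‖ξ a‖) * y ^ (p - 1) := by
        refine mul_le_mul_of_nonneg_left ?_ (Finset.prod_nonneg fun _ _ => norm_nonneg _)
        rw [← Real.rpow_natCast]
        refine Real.rpow_le_rpow_of_exponent_le hy ?_
        rw [Nat.cast_sub (by have := s.pos; omega)]
        simpa using hr

namespace WeakSobolevConvergence

variable {μ : Measure E} [μ.IsAddHaarMeasure] {p : ℝ} {U : Set E} {f : ℕ → E → F} {g : E → F}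
  {G : E → E →L[ℝ] F}

theorem hasFDerivAt_comp (h : WeakSobolevConvergence μ p U f g G) (hU : IsOpen U) (ξ : F →L[ℝ] ℝ)
    (j : ℕ) {x : E} (hx : x ∈ U) :
    HasFDerivAt (fun x => ξ (f j x)) (ξ.comp (fderiv ℝ (f j) x)) x :=
  ξ.hasFDerivAt.comp x (((h.contDiffOn j).contDiffAt (hU.mem_nhds hx)).differentiableAt
    (by simp)).hasFDerivAt

/-- Integrating by parts in row `s` moves its derivative to `ψ`. The other rows are the same for
both families of indices, so the difference contains `f (j s) - f n` without derivatives. -/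
theorem integral_covectorDet_sub_update (h : WeakSobolevConvergence μ p U f g G) (hU : IsOpen U)
    {r : ℕ} (v : Fin r → E) (ξ : Fin r → F →L[ℝ] ℝ) {ψ : E → ℝ} (hψ : ContDiff ℝ ∞ ψ)
    (hψc : HasCompactSupport ψ) (hψU : tsupport ψ ⊆ U) (j : Fin r → ℕ) (s : Fin r) (n : ℕ) :
    ∫ x, ψ x * covectorDet v (fun a => (ξ a).comp (fderiv ℝ (f (j a)) x)) ∂μ -
      ∫ x, ψ x * covectorDet v
        (fun a => (ξ a).comp (fderiv ℝ (f (Function.update j s n a)) x)) ∂μ =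
      -∫ x in tsupport ψ, ξ s (f (j s) x - f n x) * covectorDet v (Function.update
        (fun a => (ξ a).comp (fderiv ℝ (f (j a)) x)) s (fderiv ℝ ψ x)) ∂μ := by
  set K := tsupport ψ
  have hK : IsCompact K := hψc
  have hψ0 : ∀ x ∉ K, ψ x = 0 ∧ fderiv ℝ ψ x = 0 := fun x hx =>
    ⟨image_eq_zero_of_notMem_tsupport hx,
      by rw [(notMem_tsupport_iff_eventuallyEq.mp hx).fderiv_eq]; simp⟩
  have key : ∀ i : Fin r → ℕ, ∫ x, ψ x * covectorDet v
      (fun a => (ξ a).comp (fderiv ℝ (f (i a)) x)) ∂μ = -∫ x in K, ξ s (f (i s) x) *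
        covectorDet v (Function.update (fun a => (ξ a).comp (fderiv ℝ (f (i a)) x)) s
          (fderiv ℝ ψ x)) ∂μ := by
    intro i
    have h1 := integral_mul_covectorDet_fderiv (μ := μ) v hU (g := fun a x => ξ a (f (i a) x))
      (fun a => (ξ a).contDiff.comp_contDiffOn (h.contDiffOn _)) hψ hψc hψU s
    have e1 : ∀ x ∈ K, (fun a => fderiv ℝ (fun x => ξ a (f (i a) x)) x) =
        fun a => (ξ a).comp (fderiv ℝ (f (i a)) x) := fun x hx =>
      funext fun a => (h.hasFDerivAt_comp hU (ξ a) (i a) (hψU hx)).fderiv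
    rw [setIntegral_eq_integral_of_forall_compl_eq_zero
      (fun x hx => by simp [hψ0 x hx, covectorDet_update_zero])]
    convert h1 using 1
    · refine integral_congr_ae (.of_forall fun x => ?_)
      by_cases hx : x ∈ K
      · simp only [e1 x hx]
      · simp [hψ0 x hx]
    · congr 1
      refine integral_congr_ae (.of_forall fun x => ?_)
      by_cases hx : x ∈ K
      · simp only [e1 x hx]
      · simp [hψ0 x hx, covectorDet_update_zero]
  have hi : ∀ m, Integrable (fun x => ξ s (f m x) * covectorDet v (Function.update
      (fun a => (ξ a).comp (fderiv ℝ (f (j a)) x)) s (fderiv ℝ ψ x))) (μ.restrict K) := by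
    intro m
    refine ContinuousOn.integrableOn_compact hK ?_
    refine ((ξ s).continuous.comp_continuousOn ((h.contDiffOn m).continuousOn.mono hψU)).mul
      ((covectorDet v).cont.comp_continuousOn (continuousOn_pi.mpr fun a => ?_))
    by_cases ha : a = s
    · subst ha
      simpa using (hψ.continuous_fderiv (by simp)).continuousOn
    · simpa [ha] using continuousOn_const.clm_comp ((h.continuousOn_fderiv hU (j a)).mono hψU)
  have hup : ∀ x, Function.update
      (fun a => (ξ a).comp (fderiv ℝ (f (Function.update j s n a)) x)) s (fderiv ℝ ψ x) =
      Function.update (fun a => (ξ a).comp (fderiv ℝ (f (j a)) x)) s (fderiv ℝ ψ x) := by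
    intro x
    ext1 a
    by_cases ha : a = s
    · subst ha; simp
    · simp [ha]
  rw [key, key]
  simp only [hup, Function.update_self]
  rw [sub_neg_eq_add, neg_add_eq_sub, ← neg_sub, ← integral_sub (hi _) (hi _)]
  simp_rw [map_sub, sub_mul]

theorem exists_integral_rpow_one_add_sum_le (h : WeakSobolevConvergence μ p U f g G) (hp : 1 ≤ p)
    (hU : IsOpen U) (r : ℕ) {K : Set E} (hKU : K ⊆ U) (hK : IsCompact K) :
    ∃ Y : ℝ, 0 ≤ Y ∧ ∀ j : Fin r → ℕ,
      ∫ x in K, (1 + ∑ a, ‖fderiv ℝ (f (j a)) x‖) ^ p ∂μ ≤ Y := by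
  obtain ⟨B, hB⟩ := h.exists_bound K hKU hK
  have hB0 : 0 ≤ B := (integral_nonneg fun x => by positivity).trans (hB 0)
  refine ⟨2 ^ p * (μ.real K + r ^ (p - 1) * ∑ a : Fin r, B), by positivity, fun j => ?_⟩
  have hi : ∀ a, IntegrableOn (fun x => ‖fderiv ℝ (f (j a)) x‖ ^ p) K μ := fun a =>
    integrableOn_norm_rpow hp (memLp_of_continuousOn hK ((h.continuousOn_fderiv hU _).mono hKU) _)
  have hi1 : IntegrableOn (fun _ : E => (1 : ℝ)) K μ := by simpa using hK.measure_lt_top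
  have hi2 : Integrable (fun x => (r : ℝ) ^ (p - 1) * ∑ a, ‖fderiv ℝ (f (j a)) x‖ ^ p)
      (μ.restrict K) := (integrable_finsetSum _ fun a _ => hi a).const_mul _
  calc ∫ x in K, (1 + ∑ a, ‖fderiv ℝ (f (j a)) x‖) ^ p ∂μ
      ≤ ∫ x in K, 2 ^ p * (1 + r ^ (p - 1) * ∑ a, ‖fderiv ℝ (f (j a)) x‖ ^ p) ∂μ := by
        refine integral_mono_of_nonneg (.of_forall fun x => by positivity)
          ((hi1.add hi2).const_mul _) (.of_forall fun x => ?_)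
        refine (add_rpow_le_two_rpow_mul hp zero_le_one (by positivity)).trans ?_
        rw [Real.one_rpow]
        refine mul_le_mul_of_nonneg_left (add_le_add le_rfl ?_) (by positivity)
        have := Real.rpow_sum_le_const_mul_sum_rpow_of_nonneg (Finset.univ : Finset (Fin r))
          (f := fun a => ‖fderiv ℝ (f (j a)) x‖) hp (fun _ _ => norm_nonneg _)
        simpa using this
    _ = 2 ^ p * (μ.real K + r ^ (p - 1) * ∑ a, ∫ x in K, ‖fderiv ℝ (f (j a)) x‖ ^ p ∂μ) := by
        rw [integral_const_mul, integral_add hi1 hi2, integral_const_mul,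
          integral_finsetSum _ fun a _ => hi a]
        simp
    _ ≤ _ := by
        gcongr
        exact hB _

/-- The change is at most a constant times the integral of `‖f (j s) - f n‖ * y ^ (p - 1)`, which
`mul_rpow_sub_one_le` splits into `δ` times a bounded quantity and a large multiple of the `L^p`
distance. The order is essential: first `δ`, then `η`, then `J`. -/
theorem exists_forall_abs_sub_update_le (h : WeakSobolevConvergence μ p U f g G) (hp : 1 ≤ p)
    (hU : IsOpen U) {r : ℕ} (hr : (r : ℝ) ≤ p) (v : Fin r → E) (ξ : Fin r → F →L[ℝ] ℝ) {ψ : E → ℝ}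
    (hψ : ContDiff ℝ ∞ ψ) (hψc : HasCompactSupport ψ) (hψU : tsupport ψ ⊆ U) {ε : ℝ} (hε : 0 < ε) :
    ∃ J, ∀ j : Fin r → ℕ, (∀ a, J ≤ j a) → ∀ s, ∀ n ≥ J,
      |∫ x, ψ x * covectorDet v (fun a => (ξ a).comp (fderiv ℝ (f (j a)) x)) ∂μ -
        ∫ x, ψ x * covectorDet v
          (fun a => (ξ a).comp (fderiv ℝ (f (Function.update j s n a)) x)) ∂μ| ≤ ε := by
  set K := tsupport ψ
  have hK : IsCompact K := hψc
  obtain ⟨C, hC⟩ := hK.exists_bound_of_continuousOn (hψ.continuous_fderiv (by simp)).continuousOn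
  obtain ⟨Y, hY0, hY⟩ := h.exists_integral_rpow_one_add_sum_le hp hU r hψU hK
  set C1 := ‖covectorDet v‖ * |C| * ∏ a, ‖ξ a‖ with hC1
  have hC10 : 0 ≤ C1 := by positivity
  -- Both `δ` and `η` are chosen so that their term is at most `ε / 2`; the added ones keep the
  -- denominators positive.
  set δ := ε / (2 * (C1 * Y + 1)) with hδd
  have hδ : 0 < δ := by positivity
  have hδp : 0 < δ ^ (1 - p) := by positivity
  set η := ε / (2 * (C1 * δ ^ (1 - p) + 1)) with hηd
  have hη : 0 < η := by positivity
  obtain ⟨J, hJ⟩ := h.exists_forall_integral_sub_le hp hψU hK hη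
  refine ⟨J, fun j hj s n hn => ?_⟩
  rw [h.integral_covectorDet_sub_update hU v ξ hψ hψc hψU, abs_neg]
  set y : E → ℝ := fun x => 1 + ∑ a, ‖fderiv ℝ (f (j a)) x‖ with hyd
  have hy1 : ∀ x, 1 ≤ y x := fun x => le_add_of_nonneg_right (by positivity)
  have hyc : ContinuousOn y K := continuousOn_const.add (continuousOn_finsetSum _ fun a _ =>
    ((h.continuousOn_fderiv hU (j a)).mono hψU).norm)
  have hfc : ContinuousOn (fun x => f (j s) x - f n x) K :=
    ((h.contDiffOn _).continuousOn.sub (h.contDiffOn _).continuousOn).mono hψU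
  have h1 := integral_norm_mul_rpow_le (μ := μ) (K := K) (a := fun x => f (j s) x - f n x) (y := y)
    hp hδ (integrableOn_norm_rpow hp (memLp_of_continuousOn hK hfc _))
    ((hyc.rpow_const fun x _ => .inl (by linarith [hy1 x])).integrableOn_compact hK)
    (fun x => by linarith [hy1 x])
  have hint : IntegrableOn (fun x => ‖f (j s) x - f n x‖ * y x ^ (p - 1)) K μ :=
    (hfc.norm.mul (hyc.rpow_const fun x _ => .inl (by linarith [hy1 x]))).integrableOn_compact hK
  calc |∫ x in K, ξ s (f (j s) x - f n x) * covectorDet v (Function.update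
        (fun a => (ξ a).comp (fderiv ℝ (f (j a)) x)) s (fderiv ℝ ψ x)) ∂μ|
      ≤ ∫ x in K, C1 * (‖f (j s) x - f n x‖ * y x ^ (p - 1)) ∂μ := by
        rw [← Real.norm_eq_abs]
        refine norm_integral_le_of_norm_le (hint.const_mul _)
          ((ae_restrict_iff' hK.measurableSet).mpr (.of_forall fun x hx => ?_))
        rw [norm_mul, hC1, ← Finset.mul_prod_erase _ _ (Finset.mem_univ s)]
        have h2 := abs_covectorDet_update_le hr (hy1 x) v ξ (fun a => fderiv ℝ (f (j a)) x)
          (fun a => (Finset.single_le_sum (f := fun a => ‖fderiv ℝ (f (j a)) x‖)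
            (fun _ _ => norm_nonneg _) (Finset.mem_univ a)).trans (by simp [hyd])) s (fderiv ℝ ψ x)
        have h3 : ‖fderiv ℝ ψ x‖ ≤ |C| := (hC x hx).trans (le_abs_self C)
        have hyp : 0 ≤ y x ^ (p - 1) := Real.rpow_nonneg (by linarith [hy1 x]) _
        have hP : 0 ≤ ∏ a ∈ Finset.univ.erase s, ‖ξ a‖ :=
          Finset.prod_nonneg fun _ _ => norm_nonneg _
        calc _ ≤ (‖ξ s‖ * ‖f (j s) x - f n x‖) * (‖covectorDet v‖ * |C| *
              (∏ a ∈ Finset.univ.erase s, ‖ξ a‖) * y x ^ (p - 1)) := by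
              refine mul_le_mul ((ξ s).le_opNorm _) (h2.trans ?_) (norm_nonneg _) (by positivity)
              gcongr
          _ = _ := by ring
    _ ≤ C1 * (δ * Y + δ ^ (1 - p) * η) := by
        rw [integral_const_mul]
        refine mul_le_mul_of_nonneg_left (h1.trans ?_) hC10
        gcongr
        · exact hY j
        · exact hJ _ (hj s) _ hn
    _ = ε / 2 * (C1 * Y / (C1 * Y + 1)) +
          ε / 2 * (C1 * δ ^ (1 - p) / (C1 * δ ^ (1 - p) + 1)) := by
        have e1 : C1 * (δ * Y) = ε / 2 * (C1 * Y / (C1 * Y + 1)) := by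
          rw [hδd]; field_simp
        have e2 : C1 * (δ ^ (1 - p) * η) =
            ε / 2 * (C1 * δ ^ (1 - p) / (C1 * δ ^ (1 - p) + 1)) := by
          rw [hηd]; field_simp
        rw [mul_add, e1, e2]
    _ ≤ ε / 2 * 1 + ε / 2 * 1 := by
        gcongr <;> exact (div_le_one (by positivity)).mpr (by linarith)
    _ = ε := by ring

/-- The indices are exchanged one row at a time; `S` records the rows already exchanged, and each of
the `r` exchanges costs at most `ε / (r + 1)`. Allowing independent indices is what later permits a
limit in a single row. -/
theorem exists_forall_abs_sub_le (h : WeakSobolevConvergence μ p U f g G) (hp : 1 ≤ p)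
    (hU : IsOpen U) {r : ℕ} (hr : (r : ℝ) ≤ p) (v : Fin r → E) (ξ : Fin r → F →L[ℝ] ℝ) {ψ : E → ℝ}
    (hψ : ContDiff ℝ ∞ ψ) (hψc : HasCompactSupport ψ) (hψU : tsupport ψ ⊆ U) {ε : ℝ} (hε : 0 < ε) :
    ∃ J, ∀ j j' : Fin r → ℕ, (∀ a, J ≤ j a) → (∀ a, J ≤ j' a) →
      |∫ x, ψ x * covectorDet v (fun a => (ξ a).comp (fderiv ℝ (f (j a)) x)) ∂μ -
        ∫ x, ψ x * covectorDet v (fun a => (ξ a).comp (fderiv ℝ (f (j' a)) x)) ∂μ| ≤ ε := by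
  obtain ⟨J, hJ⟩ := h.exists_forall_abs_sub_update_le hp hU hr v ξ hψ hψc hψU
    (show 0 < ε / (r + 1) by positivity)
  refine ⟨J, fun j j' hj hj' => ?_⟩
  set T : (Fin r → ℕ) → ℝ := fun j =>
    ∫ x, ψ x * covectorDet v (fun a => (ξ a).comp (fderiv ℝ (f (j a)) x)) ∂μ with hT
  have key : ∀ S : Finset (Fin r), |T j - T (S.piecewise j' j)| ≤ S.card * (ε / (r + 1)) := by
    intro S
    induction S using Finset.induction_on with
    | empty => simp
    | insert s S hs ih =>
      rw [Finset.piecewise_insert, Finset.card_insert_of_notMem hs]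
      have h1 := hJ (S.piecewise j' j) (fun a => by
        by_cases ha : a ∈ S <;> simp [ha, hj, hj']) s (j' s) (hj' s)
      calc _ ≤ |T j - T (S.piecewise j' j)| +
            |T (S.piecewise j' j) - T (Function.update (S.piecewise j' j) s (j' s))| :=
            abs_sub_le _ _ _
        _ ≤ S.card * (ε / (r + 1)) + ε / (r + 1) := add_le_add ih h1
        _ = _ := by push_cast; ring
  have h2 := key Finset.univ
  rw [Finset.piecewise_univ] at h2
  refine h2.trans ?_
  rw [Finset.card_univ, Fintype.card_fin, mul_div_assoc', div_le_iff₀ (by positivity)]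
  nlinarith

end WeakSobolevConvergence

end MinorsLimit

/-! ### Identification of the limit, one row at a time. -/

section MinorsLimitStep

variable {E F : Type*} [NormedAddCommGroup E] [NormedSpace ℝ E] [NormedAddCommGroup F]
  [NormedSpace ℝ F] [CompleteSpace F] [MeasurableSpace E] [BorelSpace E] [FiniteDimensional ℝ E]

theorem aestronglyMeasurable_covectorDet {r : ℕ} {μ : Measure E} (v : Fin r → E)
    {w : E → Fin r → E →L[ℝ] ℝ} (hw : ∀ a, AEStronglyMeasurable (fun x => w x a) μ) :
    AEStronglyMeasurable (fun x => covectorDet v (w x)) μ := by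
  simp_rw [covectorDet_apply]
  refine Finset.aestronglyMeasurable_fun_sum _ fun σ _ => aestronglyMeasurable_const.mul
    (Finset.aestronglyMeasurable_fun_prod _ fun a _ => ?_)
  exact (ContinuousLinearMap.apply ℝ ℝ (v (σ a))).continuous.comp_aestronglyMeasurable (hw a)

/-- Row `s` is expanded in the dual basis. The remaining factors do not depend on `η`, so a limit in
row `s` becomes a limit of finitely many scalar functions. -/
theorem covectorDet_update_eq_sum {r : ℕ} (v : Fin r → E) (w : Fin r → E →L[ℝ] ℝ) (s : Fin r)
    (η : E →L[ℝ] ℝ) :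
    covectorDet v (Function.update w s η) = ∑ k, η (Module.finBasis ℝ E k) * covectorDet v
      (Function.update w s (LinearMap.toContinuousLinearMap ((Module.finBasis ℝ E).coord k))) := by
  have hη : η = ∑ k, η (Module.finBasis ℝ E k) •
      LinearMap.toContinuousLinearMap ((Module.finBasis ℝ E).coord k) := by
    ext x
    conv_lhs => rw [← (Module.finBasis ℝ E).sum_repr x, map_sum]
    simp [mul_comm]
  have h2 := (covectorDet v).toMultilinearMap.map_update_sum Finset.univ s (fun k =>
    η (Module.finBasis ℝ E k) •
      LinearMap.toContinuousLinearMap ((Module.finBasis ℝ E).coord k)) w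
  rw [← hη] at h2
  refine h2.trans (Finset.sum_congr rfl fun k _ => ?_)
  exact (covectorDet v).map_update_smul w s _ _

namespace WeakSobolevConvergence

variable {μ : Measure E} [μ.IsAddHaarMeasure] {p : ℝ} {U : Set E} {f : ℕ → E → F} {g : E → F}
  {G : E → E →L[ℝ] F}

/-- The products of `b` with the derivatives are integrable and converge weakly. -/
def IsWeakTest (μ : Measure E) (f : ℕ → E → F) (G : E → E →L[ℝ] F) (b : E → ℝ) : Prop :=
  ∀ (ξ : F →L[ℝ] ℝ) (e : E), (∀ j, Integrable (fun x => b x * ξ (fderiv ℝ (f j) x e)) μ) ∧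
    Integrable (fun x => b x * ξ (G x e)) μ ∧
    Tendsto (fun j => ∫ x, b x * ξ (fderiv ℝ (f j) x e) ∂μ) atTop (𝓝 (∫ x, b x * ξ (G x e) ∂μ))

theorem isWeakTest_of_contDiff (h : WeakSobolevConvergence μ p U f g G) (hp : 1 ≤ p)
    (hU : IsOpen U) {b : E → ℝ} (hb : ContDiff ℝ ∞ b) (hbc : HasCompactSupport b)
    (hbU : tsupport b ⊆ U) : IsWeakTest μ f G b := by
  intro ξ e
  have hK : IsCompact (tsupport b) := hbc
  have hb0 : ∀ x ∉ tsupport b, b x = 0 := fun x hx => image_eq_zero_of_notMem_tsupport hx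
  refine ⟨fun j => ?_, ?_, h.tendsto_integral_mul_of_contDiff hp hU ξ e hb hbc hbU⟩
  · exact integrable_of_continuousOn hK (hb.continuous.continuousOn.mul
      (ξ.continuous.comp_continuousOn
        (((h.continuousOn_fderiv hU j).mono hbU).clm_apply continuousOn_const)))
      fun x hx => by simp [hb0 x hx]
  · have : IsFiniteMeasure (μ.restrict (tsupport b)) := ⟨by simpa using hK.measure_lt_top⟩
    have hG : IntegrableOn G (tsupport b) μ :=
      (h.memLp_deriv _ hbU hK).integrable (by simpa using hp)
    obtain ⟨C, hC⟩ := hK.exists_bound_of_continuousOn hb.continuous.continuousOn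
    refine (integrableOn_iff_integrable_of_support_subset (s := tsupport b)
      fun x hx => by_contra fun hxK => hx (by simp [hb0 x hxK])).mp ?_
    exact ((ξ.comp (ContinuousLinearMap.apply ℝ F e)).integrable_comp hG).bdd_mul (c := C)
      hb.continuous.aestronglyMeasurable ((ae_restrict_iff' hK.measurableSet).mpr (.of_forall hC))

theorem isWeakTest_of_memLp (h : WeakSobolevConvergence μ p U f g G) (hp : 1 < p)
    (hU : IsOpen U) {K : Set E} (hKU : K ⊆ U) (hK : IsCompact K) {b : E → ℝ}
    (hb : MemLp b (ENNReal.ofReal (p / (p - 1))) (μ.restrict K)) (hb0 : ∀ x ∉ K, b x = 0) :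
    IsWeakTest μ f G b := by
  intro ξ e
  have hpq : p.HolderConjugate (p / (p - 1)) := Real.HolderConjugate.conjExponent hp
  have := hpq.symm.ennrealOfReal
  have key : ∀ D : E → E →L[ℝ] F, MemLp D (ENNReal.ofReal p) (μ.restrict K) →
      Integrable (fun x => b x * ξ (D x e)) μ := fun D hD => by
    refine (integrableOn_iff_integrable_of_support_subset (s := K)
      fun x hx => by_contra fun hxK => hx (by simp [hb0 x hxK])).mp ?_
    exact hb.integrable_mul ((ξ.comp (ContinuousLinearMap.apply ℝ F e)).comp_memLp' hD)
  exact ⟨fun j => key _ (memLp_of_continuousOn hK ((h.continuousOn_fderiv hU j).mono hKU) _),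
    key _ (h.memLp_deriv K hKU hK), h.tendsto_integral_mul_of_memLp hp hU ξ e hKU hK hb hb0⟩

/-- The covectors for which the derivatives with index in `S` are the weak derivative `G`, and the
others are those of the maps `f (j a)`. -/
def mixedDeriv (f : ℕ → E → F) (G : E → E →L[ℝ] F) {r : ℕ} (S : Finset (Fin r)) (j : Fin r → ℕ)
    (x : E) : Fin r → E →L[ℝ] F :=
  S.piecewise (fun _ => G x) fun a => fderiv ℝ (f (j a)) x

/-- This function is a cofactor of row `s`. For empty `S` it is smooth and every `p ≥ 1` is
admissible. Otherwise `S` contains an index other than `s`, hence `2 ≤ r ≤ p`, and the cofactor,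
bounded by a multiple of `y ^ (p - 1)`, lies in the dual exponent. For `p = 1` only the first case
occurs. -/
theorem isWeakTest_mixed (h : WeakSobolevConvergence μ p U f g G) (hp : 1 ≤ p)
    (hU : IsOpen U) {r : ℕ} (hr : (r : ℝ) ≤ p) (v : Fin r → E) (ξ : Fin r → F →L[ℝ] ℝ) {ψ : E → ℝ}
    (hψ : ContDiff ℝ ∞ ψ) (hψc : HasCompactSupport ψ) (hψU : tsupport ψ ⊆ U)
    (S : Finset (Fin r)) {s : Fin r} (hs : s ∉ S) (j : Fin r → ℕ) (η : E →L[ℝ] ℝ) :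
    IsWeakTest μ f G fun x => ψ x * covectorDet v
      (Function.update (fun a => (ξ a).comp (mixedDeriv f G S j x a)) s η) := by
  set K := tsupport ψ
  have hK : IsCompact K := hψc
  have hψ0 : ∀ x ∉ K, ψ x = 0 := fun x hx => image_eq_zero_of_notMem_tsupport hx
  rcases S.eq_empty_or_nonempty with rfl | hS
  · refine h.isWeakTest_of_contDiff hp hU ?_ hψc.mul_right (tsupport_mul_subset_left.trans hψU)
    refine contDiff_mul_of_tsupport_subset hU hψ hψU ?_
    refine (covectorDet v).contDiff.comp_contDiffOn (contDiffOn_pi.mpr fun a => ?_)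
    by_cases ha : a = s
    · subst ha; simpa using contDiffOn_const
    · simpa [ha, mixedDeriv] using contDiffOn_const.clm_comp
        ((h.contDiffOn (j a)).fderiv_of_isOpen hU (m := ∞) le_rfl)
  · have hr2 : 2 ≤ r := by
      obtain ⟨t, ht⟩ := hS
      have : t ≠ s := fun hts => hs (hts ▸ ht)
      have := Finset.card_le_univ ({s, t} : Finset (Fin r))
      rw [Finset.card_pair (Ne.symm ‹t ≠ s›), Fintype.card_fin] at this
      exact this
    have hp1 : 1 < p := lt_of_lt_of_le (by exact_mod_cast hr2) hr
    refine h.isWeakTest_of_memLp hp1 hU hψU hK ?_ fun x hx => by simp [hψ0 x hx]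
    have hfin : IsFiniteMeasure (μ.restrict K) := ⟨by simpa using hK.measure_lt_top⟩
    have hGm := h.memLp_deriv K hψU hK
    have hfm : ∀ a, MemLp (fun x => fderiv ℝ (f (j a)) x) (ENNReal.ofReal p) (μ.restrict K) :=
      fun a => memLp_of_continuousOn hK ((h.continuousOn_fderiv hU _).mono hψU) _
    set y : E → ℝ := fun x => 1 + ‖G x‖ + ∑ a, ‖fderiv ℝ (f (j a)) x‖ with hyd
    have hy1 : ∀ x, 1 ≤ y x := fun x => by
      have : 0 ≤ ∑ a, ‖fderiv ℝ (f (j a)) x‖ := by positivity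
      have := norm_nonneg (G x)
      simp only [hyd]; linarith
    have hym : MemLp y (ENNReal.ofReal p) (μ.restrict K) :=
      ((memLp_const (1 : ℝ)).add hGm.norm).add (memLp_finsetSum _ fun a _ => (hfm a).norm)
    -- Raising a function of `L^p` to the power `p - 1` gives one of `L^(p / (p - 1))`.
    have hyq : MemLp (fun x => y x ^ (p - 1)) (ENNReal.ofReal (p / (p - 1))) (μ.restrict K) := by
      have h1 := hym.norm_rpow_div (ENNReal.ofReal (p - 1))
      rw [← ENNReal.ofReal_div_of_pos (by linarith), ENNReal.toReal_ofReal (by linarith)] at h1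
      refine h1.congr_norm ?_ (.of_forall fun x => ?_)
      · exact (Real.continuous_rpow_const (by linarith)).comp_aestronglyMeasurable hym.1
      · rw [Real.norm_of_nonneg (show 0 ≤ y x by linarith [hy1 x])]
    obtain ⟨C, hC⟩ := hK.exists_bound_of_continuousOn hψ.continuous.continuousOn
    refine MemLp.of_le_mul (c := |C| * (‖covectorDet v‖ * ‖η‖ * ∏ a ∈ Finset.univ.erase s, ‖ξ a‖))
      hyq ?_ ((ae_restrict_iff' hK.measurableSet).mpr (.of_forall fun x hx => ?_))
    · refine hψ.continuous.aestronglyMeasurable.mul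
        (aestronglyMeasurable_covectorDet v fun a => ?_)
      by_cases ha : a = s
      · subst ha; simpa using aestronglyMeasurable_const
      · simp only [Function.update_of_ne ha]
        refine (ContinuousLinearMap.compL ℝ E F ℝ (ξ a)).continuous.comp_aestronglyMeasurable ?_
        by_cases haS : a ∈ S
        · simpa [mixedDeriv, haS] using hGm.1
        · simpa [mixedDeriv, haS] using (hfm a).1
    · have h2 := abs_covectorDet_update_le hr (hy1 x) v ξ (mixedDeriv f G S j x) (fun a => by
        have h3 : 0 ≤ ∑ a, ‖fderiv ℝ (f (j a)) x‖ := by positivity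
        have h4 := norm_nonneg (G x)
        have h5 := Finset.single_le_sum (f := fun a => ‖fderiv ℝ (f (j a)) x‖)
            (fun _ _ => norm_nonneg _) (Finset.mem_univ a)
        by_cases haS : a ∈ S <;> simp only [mixedDeriv, haS, hyd, Finset.piecewise_eq_of_mem,
          Finset.piecewise_eq_of_notMem, not_false_eq_true] <;> linarith) s η
      have hyp : 0 ≤ y x ^ (p - 1) := Real.rpow_nonneg (by linarith [hy1 x]) _
      rw [norm_mul, Real.norm_of_nonneg hyp, mul_assoc]
      exact mul_le_mul ((hC x hx).trans (le_abs_self C)) h2 (norm_nonneg _) (abs_nonneg _)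

/-- Only row `s` depends on `n`. Its expansion in the dual basis has coefficients which are
admissible tests for weak convergence of the first derivatives. -/
theorem tendsto_integral_mixed_update (h : WeakSobolevConvergence μ p U f g G) (hp : 1 ≤ p)
    (hU : IsOpen U) {r : ℕ} (hr : (r : ℝ) ≤ p) (v : Fin r → E) (ξ : Fin r → F →L[ℝ] ℝ) {ψ : E → ℝ}
    (hψ : ContDiff ℝ ∞ ψ) (hψc : HasCompactSupport ψ) (hψU : tsupport ψ ⊆ U)
    (S : Finset (Fin r)) {s : Fin r} (hs : s ∉ S) (j : Fin r → ℕ) :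
    Tendsto (fun n => ∫ x, ψ x * covectorDet v
        (fun a => (ξ a).comp (mixedDeriv f G S (Function.update j s n) x a)) ∂μ) atTop
      (𝓝 (∫ x, ψ x * covectorDet v
        (fun a => (ξ a).comp (mixedDeriv f G (insert s S) j x a)) ∂μ)) := by
  have hw := fun k => h.isWeakTest_mixed hp hU hr v ξ hψ hψc hψU S hs j
    (LinearMap.toContinuousLinearMap ((Module.finBasis ℝ E).coord k))
  have key : ∀ (D : E →L[ℝ] F) (x : E), ψ x * covectorDet v
      (Function.update (fun a => (ξ a).comp (mixedDeriv f G S j x a)) s ((ξ s).comp D)) =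
      ∑ k, (ψ x * covectorDet v (Function.update (fun a => (ξ a).comp (mixedDeriv f G S j x a)) s
        (LinearMap.toContinuousLinearMap ((Module.finBasis ℝ E).coord k)))) *
          ξ s (D (Module.finBasis ℝ E k)) := by
    intro D x
    rw [covectorDet_update_eq_sum, Finset.mul_sum]
    refine Finset.sum_congr rfl fun k _ => ?_
    rw [ContinuousLinearMap.comp_apply]
    ring
  have e1 : ∀ n x, (fun a => (ξ a).comp (mixedDeriv f G S (Function.update j s n) x a)) =
      Function.update (fun a => (ξ a).comp (mixedDeriv f G S j x a)) s
        ((ξ s).comp (fderiv ℝ (f n) x)) := by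
    intro n x
    ext1 a
    by_cases ha : a = s
    · subst ha; simp [mixedDeriv, hs]
    · by_cases haS : a ∈ S <;> simp [mixedDeriv, haS, ha]
  have e2 : ∀ x, (fun a => (ξ a).comp (mixedDeriv f G (insert s S) j x a)) =
      Function.update (fun a => (ξ a).comp (mixedDeriv f G S j x a)) s ((ξ s).comp (G x)) := by
    intro x
    ext1 a
    by_cases ha : a = s
    · subst ha; simp [mixedDeriv]
    · by_cases haS : a ∈ S <;> simp [mixedDeriv, haS, ha]
  simp_rw [e1, e2, key]
  rw [integral_finsetSum _ fun k _ => (hw k _ _).2.1]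
  simp_rw [integral_finsetSum _ fun k _ => (hw k _ _).1 _]
  exact tendsto_finsetSum _ fun k _ => (hw k _ _).2.2

/-- The minors of order at most `p` of the derivatives converge weakly. -/
theorem tendsto_integral_covectorDet (h : WeakSobolevConvergence μ p U f g G) (hp : 1 ≤ p)
    (hU : IsOpen U) {r : ℕ} (hr : (r : ℝ) ≤ p) (v : Fin r → E) (ξ : Fin r → F →L[ℝ] ℝ) {ψ : E → ℝ}
    (hψ : ContDiff ℝ ∞ ψ) (hψc : HasCompactSupport ψ) (hψU : tsupport ψ ⊆ U) :
    Tendsto (fun n => ∫ x, ψ x * covectorDet v (fun a => (ξ a).comp (fderiv ℝ (f n) x)) ∂μ) atTop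
      (𝓝 (∫ x, ψ x * covectorDet v (fun a => (ξ a).comp (G x)) ∂μ)) := by
  rw [Metric.tendsto_atTop']
  intro ε hε
  obtain ⟨J, hJ⟩ := h.exists_forall_abs_sub_le hp hU hr v ξ hψ hψc hψU (half_pos hε)
  refine ⟨J, fun n hn => ?_⟩
  -- The Cauchy estimate is uniform over all indices beyond `J`, so it passes to the limit in one
  -- row after another while the rest stay frozen. For `S` the whole index set, every row is the
  -- weak derivative.
  have key : ∀ S : Finset (Fin r), ∀ j : Fin r → ℕ, (∀ a, J ≤ j a) →
      |∫ x, ψ x * covectorDet v (fun a => (ξ a).comp (mixedDeriv f G S j x a)) ∂μ -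
        ∫ x, ψ x * covectorDet v (fun a => (ξ a).comp (fderiv ℝ (f n) x)) ∂μ| ≤ ε / 2 := by
    intro S
    induction S using Finset.induction_on with
    | empty =>
      intro j hj
      simpa [mixedDeriv] using hJ j (fun _ => n) hj (fun _ => hn.le)
    | insert s S hs ih =>
      intro j hj
      refine le_of_tendsto ((h.tendsto_integral_mixed_update hp hU hr v ξ hψ hψc hψU S hs j).sub_const
        _).abs (eventually_atTop.mpr ⟨J, fun m hm => ih _ fun a => ?_⟩)
      by_cases ha : a = s
      · subst ha; simpa using hm
      · simpa [ha] using hj a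
  have h1 := key Finset.univ (fun _ => J) (fun _ => le_rfl)
  simp only [mixedDeriv, Finset.piecewise_univ] at h1
  rw [dist_comm, Real.dist_eq]
  linarith

end WeakSobolevConvergence

end MinorsLimitStep

/-! ### Minors multiplied by a coefficient that depends on the map. -/

section MinorsCoefficient

variable {E F : Type*} [NormedAddCommGroup E] [NormedSpace ℝ E] [NormedAddCommGroup F]
  [NormedSpace ℝ F] [CompleteSpace F] [MeasurableSpace E] [BorelSpace E] [FiniteDimensional ℝ E]

theorem abs_covectorDet_comp_le {r : ℕ} {p : ℝ} (hr : (r : ℝ) ≤ p) (v : Fin r → E)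
    (ξ : Fin r → F →L[ℝ] ℝ) (D : E →L[ℝ] F) :
    |covectorDet v (fun a => (ξ a).comp D)| ≤
      ‖covectorDet v‖ * (∏ a, ‖ξ a‖) * (1 + ‖D‖) ^ p := by
  refine ((covectorDet v).le_opNorm _).trans ?_
  rw [mul_assoc]
  refine mul_le_mul_of_nonneg_left ?_ (norm_nonneg _)
  calc ∏ a, ‖(ξ a).comp D‖ ≤ ∏ a, ‖ξ a‖ * (1 + ‖D‖) := by
        refine Finset.prod_le_prod (fun _ _ => norm_nonneg _) fun a _ => ?_
        exact (ContinuousLinearMap.opNorm_comp_le _ _).trans (by gcongr; linarith)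
    _ = (∏ a, ‖ξ a‖) * (1 + ‖D‖) ^ (r : ℝ) := by
        rw [Finset.prod_mul_distrib, Finset.prod_const, Finset.card_univ, Fintype.card_fin,
          Real.rpow_natCast]
    _ ≤ _ := by
        gcongr
        linarith [norm_nonneg D]

/-- Uniform continuity handles nearby points; at distance at least `η` the oscillation is absorbed
by `L = 2|C| / η ^ p`. In integrated form this turns `L^p` closeness of maps into closeness of
coefficients, with no passage to almost everywhere convergent subsequences. -/
theorem _root_.IsCompact.exists_abs_sub_le_add_rpow {S : Set F} (hS : IsCompact S) {a : F → ℝ}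
    (ha : Continuous a) {p : ℝ} (hp : 1 ≤ p) :
    ∃ A : ℝ, 0 ≤ A ∧ (∀ z ∈ S, ∀ w ∈ S, |a z - a w| ≤ A) ∧ ∀ δ > 0, ∃ L : ℝ, 0 ≤ L ∧
      ∀ z ∈ S, ∀ w ∈ S, |a z - a w| ≤ δ + L * ‖z - w‖ ^ p := by
  obtain ⟨C, hC⟩ := hS.exists_bound_of_continuousOn ha.continuousOn
  have hA : ∀ z ∈ S, ∀ w ∈ S, |a z - a w| ≤ 2 * |C| := fun z hz w hw => by
    have h1 := (hC z hz).trans (le_abs_self C)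
    have h2 := (hC w hw).trans (le_abs_self C)
    exact (abs_sub _ _).trans (by simp only [Real.norm_eq_abs] at h1 h2; linarith)
  refine ⟨2 * |C|, by positivity, hA, fun δ hδ => ?_⟩
  obtain ⟨η, hη, h⟩ := Metric.uniformContinuousOn_iff.mp
    (hS.uniformContinuousOn_of_continuous ha.continuousOn) δ hδ
  refine ⟨2 * |C| / η ^ p, by positivity, fun z hz w hw => ?_⟩
  rcases lt_or_ge (dist z w) η with hzw | hzw
  · have h1 := h z hz w hw hzw
    rw [Real.dist_eq] at h1
    have : 0 ≤ 2 * |C| / η ^ p * ‖z - w‖ ^ p := by positivity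
    linarith
  · rw [dist_eq_norm] at hzw
    have h1 : η ^ p ≤ ‖z - w‖ ^ p := Real.rpow_le_rpow hη.le hzw (by linarith)
    have h2 : 2 * |C| ≤ 2 * |C| / η ^ p * ‖z - w‖ ^ p := by
      rw [div_mul_eq_mul_div, le_div_iff₀ (by positivity)]
      gcongr
    linarith [hA z hz w hw]

namespace WeakSobolevConvergence

variable {μ : Measure E} [μ.IsAddHaarMeasure] {p : ℝ} {U : Set E} {f : ℕ → E → F} {g : E → F}
  {G : E → E →L[ℝ] F}

theorem integrableOn_excess {K : Set E} (hp : 1 ≤ p) {D : E → E →L[ℝ] F}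
    (hD : MemLp D (ENNReal.ofReal p) (μ.restrict K)) {t : ℝ} (ht : 0 ≤ t) :
    IntegrableOn (fun x => max (‖D x‖ - t) 0 ^ p) K μ := by
  refine (integrableOn_norm_rpow hp hD).mono' ?_ (.of_forall fun x => ?_)
  · have : Continuous fun s : ℝ => max (s - t) 0 ^ p :=
      (Real.continuous_rpow_const (by linarith)).comp (by fun_prop)
    exact this.comp_aestronglyMeasurable hD.1.norm
  · rw [Real.norm_of_nonneg (Real.rpow_nonneg (le_max_right _ _) _)]
    exact Real.rpow_le_rpow (le_max_right _ _)
      (max_le (by linarith) (norm_nonneg _)) (by linarith)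

theorem integral_excess_anti {K : Set E} (hp : 1 ≤ p) {D : E → E →L[ℝ] F}
    (hD : MemLp D (ENNReal.ofReal p) (μ.restrict K)) {t t' : ℝ} (ht : 0 ≤ t) (htt' : t ≤ t') :
    ∫ x in K, max (‖D x‖ - t') 0 ^ p ∂μ ≤ ∫ x in K, max (‖D x‖ - t) 0 ^ p ∂μ := by
  refine integral_mono (integrableOn_excess hp hD (ht.trans htt')) (integrableOn_excess hp hD ht)
    fun x => ?_
  refine Real.rpow_le_rpow (le_max_right _ _) (max_le_max ?_ le_rfl) (by linarith)
  linarith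

theorem exists_integral_excess_le {K : Set E} (hp : 1 ≤ p) {D : E → E →L[ℝ] F}
    (hD : MemLp D (ENNReal.ofReal p) (μ.restrict K)) {τ : ℝ} (hτ : 0 < τ) :
    ∃ t : ℝ, 0 ≤ t ∧ ∫ x in K, max (‖D x‖ - t) 0 ^ p ∂μ ≤ τ := by
  have h : Tendsto (fun n : ℕ => ∫ x in K, max (‖D x‖ - n) 0 ^ p ∂μ) atTop
      (𝓝 (∫ x in K, (0 : ℝ) ∂μ)) := by
    refine tendsto_integral_of_dominated_convergence (fun x => ‖D x‖ ^ p)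
      (fun n => (integrableOn_excess hp hD n.cast_nonneg).1) (integrableOn_norm_rpow hp hD)
      (fun n => .of_forall fun x => ?_) (.of_forall fun x => ?_)
    · rw [Real.norm_of_nonneg (Real.rpow_nonneg (le_max_right _ _) _)]
      exact Real.rpow_le_rpow (le_max_right _ _)
        (max_le (by linarith [(n.cast_nonneg : (0 : ℝ) ≤ n)]) (norm_nonneg _)) (by linarith)
    · obtain ⟨N, hN⟩ := exists_nat_ge ‖D x‖
      refine tendsto_const_nhds.congr' (eventually_atTop.mpr ⟨N, fun n hn => ?_⟩)
      have : (N : ℝ) ≤ n := by exact_mod_cast hn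
      beta_reduce
      rw [max_eq_right (by linarith), Real.zero_rpow (by linarith)]
  rw [integral_zero] at h
  obtain ⟨n, hn⟩ := (h.eventually (gt_mem_nhds hτ)).exists
  exact ⟨n, n.cast_nonneg, hn.le⟩

theorem integrableOn_one_add_rpow {K : Set E} (hK : IsCompact K) (hp : 1 ≤ p) {D : E → E →L[ℝ] F}
    (hD : MemLp D (ENNReal.ofReal p) (μ.restrict K)) :
    IntegrableOn (fun x => (1 + ‖D x‖) ^ p) K μ := by
  have : IsFiniteMeasure (μ.restrict K) := ⟨by simpa using hK.measure_lt_top⟩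
  have h1 : MemLp (fun x => 1 + ‖D x‖) (ENNReal.ofReal p) (μ.restrict K) :=
    (memLp_const (1 : ℝ)).add hD.norm
  refine (integrableOn_norm_rpow hp h1).congr (.of_forall fun x => ?_)
  simp only [Real.norm_of_nonneg (show 0 ≤ 1 + ‖D x‖ by positivity)]

/-- The derivative is split into a part of size at most `t` and its excess over `t`. The first part
is paired with the fine bound on `b`, the excess with the crude bound `A`. -/
theorem integral_abs_mul_one_add_rpow_le {K : Set E} (hK : IsCompact K) (hp : 1 ≤ p)
    {D : E → E →L[ℝ] F} (hD : MemLp D (ENNReal.ofReal p) (μ.restrict K)) {b e : E → ℝ}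
    (he : IntegrableOn e K μ) {A δ L t : ℝ} (ht : 0 ≤ t)
    (hbA : ∀ᵐ x ∂μ.restrict K, |b x| ≤ A)
    (hbe : ∀ᵐ x ∂μ.restrict K, |b x| ≤ δ + L * e x) :
    ∫ x in K, |b x| * (1 + ‖D x‖) ^ p ∂μ ≤ 2 ^ p * ((1 + t) ^ p * (δ * μ.real K +
      L * ∫ x in K, e x ∂μ) + A * ∫ x in K, max (‖D x‖ - t) 0 ^ p ∂μ) := by
  have hi0 : IntegrableOn (fun _ : E => δ) K μ := by simp [hK.measure_lt_top]
  have hi1 : IntegrableOn (fun x => (1 + t) ^ p * (δ + L * e x)) K μ :=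
    (hi0.add (he.const_mul L)).const_mul _
  have hi2 := (integrableOn_excess hp hD ht).const_mul A
  calc ∫ x in K, |b x| * (1 + ‖D x‖) ^ p ∂μ
      ≤ ∫ x in K, 2 ^ p * ((1 + t) ^ p * (δ + L * e x) + A * max (‖D x‖ - t) 0 ^ p) ∂μ := by
        refine integral_mono_of_nonneg (.of_forall fun x => by positivity)
          ((hi1.add hi2).const_mul _) ?_
        filter_upwards [hbA, hbe] with x h1 h2
        have h3 : (1 + ‖D x‖) ^ p ≤ 2 ^ p * ((1 + t) ^ p + max (‖D x‖ - t) 0 ^ p) := by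
          refine le_trans ?_ (add_rpow_le_two_rpow_mul hp (by positivity) (le_max_right _ _))
          refine Real.rpow_le_rpow (by positivity) ?_ (by linarith)
          linarith [le_max_left (‖D x‖ - t) 0]
        calc |b x| * (1 + ‖D x‖) ^ p
            ≤ |b x| * (2 ^ p * ((1 + t) ^ p + max (‖D x‖ - t) 0 ^ p)) := by gcongr
          _ = 2 ^ p * ((1 + t) ^ p * |b x| + |b x| * max (‖D x‖ - t) 0 ^ p) := by ring
          _ ≤ _ := by gcongr
    _ = _ := by
        rw [integral_const_mul, integral_add hi1 hi2, integral_const_mul, integral_const_mul,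
          integral_add hi0 (he.const_mul L), integral_const_mul]
        simp [mul_comm]

/-- The minors of the derivatives, with a coefficient depending on the map, converge weakly when the
derivatives are equi-integrable. -/
theorem tendsto_integral_coeff_covectorDet (h : WeakSobolevConvergence μ p U f g G) (hp : 1 ≤ p)
    (hU : IsOpen U) {r : ℕ} (hr : (r : ℝ) ≤ p) (v : Fin r → E) (ξ : Fin r → F →L[ℝ] ℝ)
    {S : Set F} (hS : IsCompact S) {a : F → ℝ} (ha : Continuous a) (hfS : ∀ j, ∀ x ∈ U, f j x ∈ S)
    (hgS : ∀ᵐ x ∂μ, x ∈ U → g x ∈ S) (haf : ∀ j, ContDiffOn ℝ ∞ (fun x => a (f j x)) U)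
    (heq : ∀ K ⊆ U, IsCompact K → ∀ ε > 0, ∃ t : ℝ, 0 ≤ t ∧ ∀ j,
      ∫ x in K, max (‖fderiv ℝ (f j) x‖ - t) 0 ^ p ∂μ ≤ ε)
    {ψ : E → ℝ} (hψ : ContDiff ℝ ∞ ψ) (hψc : HasCompactSupport ψ) (hψU : tsupport ψ ⊆ U) :
    Integrable (fun x => ψ x * a (g x) * covectorDet v (fun a => (ξ a).comp (G x))) μ ∧
    Tendsto (fun n => ∫ x, ψ x * a (f n x) *
        covectorDet v (fun a => (ξ a).comp (fderiv ℝ (f n) x)) ∂μ) atTop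
      (𝓝 (∫ x, ψ x * a (g x) * covectorDet v (fun a => (ξ a).comp (G x)) ∂μ)) := by
  set K := tsupport ψ
  have hK : IsCompact K := hψc
  have hψ0 : ∀ x ∉ K, ψ x = 0 := fun x hx => image_eq_zero_of_notMem_tsupport hx
  obtain ⟨C, hC⟩ := hK.exists_bound_of_continuousOn hψ.continuous.continuousOn
  obtain ⟨A, hA0, hA, hAδ⟩ := hS.exists_abs_sub_le_add_rpow ha hp
  obtain ⟨A', hA'⟩ := hS.exists_bound_of_continuousOn ha.continuousOn
  set C0 := |C| * (‖covectorDet v‖ * ∏ a, ‖ξ a‖) with hC0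
  have hC00 : 0 ≤ C0 := by positivity
  have hgm := h.memLp K hψU hK
  have hGm := h.memLp_deriv K hψU hK
  have hfm : ∀ j, MemLp (fderiv ℝ (f j)) (ENNReal.ofReal p) (μ.restrict K) := fun j =>
    memLp_of_continuousOn hK ((h.continuousOn_fderiv hU j).mono hψU) _
  have hfc : ∀ j, ContinuousOn (f j) K := fun j => (h.contDiffOn j).continuousOn.mono hψU
  have hgK : ∀ᵐ x ∂μ.restrict K, g x ∈ S := by
    rw [ae_restrict_iff' hK.measurableSet]
    filter_upwards [hgS] with x hx hxK using hx (hψU hxK)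
  have hfK : ∀ j, ∀ᵐ x ∂μ.restrict K, f j x ∈ S := fun j =>
    (ae_restrict_iff' hK.measurableSet).mpr (.of_forall fun x hx => hfS j x (hψU hx))
  have hbd : ∀ (b : E → ℝ) (D : E → E →L[ℝ] F) (x : E), x ∈ K →
      ‖ψ x * b x * covectorDet v (fun a => (ξ a).comp (D x))‖ ≤
        C0 * (|b x| * (1 + ‖D x‖) ^ p) := by
    intro b D x hx
    have h1 := abs_covectorDet_comp_le hr v ξ (D x)
    rw [norm_mul, norm_mul, Real.norm_eq_abs (covectorDet v _), Real.norm_eq_abs (b x)]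
    calc ‖ψ x‖ * |b x| * |covectorDet v (fun a => (ξ a).comp (D x))|
        ≤ |C| * |b x| * (‖covectorDet v‖ * (∏ a, ‖ξ a‖) * (1 + ‖D x‖) ^ p) := by
          gcongr
          exact (hC x hx).trans (le_abs_self C)
      _ = _ := by rw [hC0]; ring
  have hint : ∀ (b : E → ℝ) (D : E → E →L[ℝ] F) (B : ℝ),
      AEStronglyMeasurable b (μ.restrict K) → (∀ᵐ x ∂μ.restrict K, |b x| ≤ B) →
      MemLp D (ENNReal.ofReal p) (μ.restrict K) →
      Integrable (fun x => ψ x * b x * covectorDet v (fun a => (ξ a).comp (D x))) μ ∧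
      IntegrableOn (fun x => |b x| * (1 + ‖D x‖) ^ p) K μ := by
    intro b D B hb hbB hD
    have hi : IntegrableOn (fun x => |b x| * (1 + ‖D x‖) ^ p) K μ :=
      (integrableOn_one_add_rpow hK hp hD).bdd_mul (c := B) hb.norm (by simpa using hbB)
    refine ⟨?_, hi⟩
    refine (integrableOn_iff_integrable_of_support_subset (s := K)
      fun x hx => by_contra fun hxK => hx (by simp [hψ0 x hxK])).mp ?_
    refine (hi.const_mul C0).mono' ((hψ.continuous.aestronglyMeasurable.mul hb).mul
      (aestronglyMeasurable_covectorDet v fun a => ?_))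
      ((ae_restrict_iff' hK.measurableSet).mpr (.of_forall (hbd b D)))
    exact (ContinuousLinearMap.compL ℝ E F ℝ (ξ a)).continuous.comp_aestronglyMeasurable hD.1
  have hag : AEStronglyMeasurable (fun x => a (g x)) (μ.restrict K) :=
    ha.comp_aestronglyMeasurable hgm.1
  have hafm : ∀ j, AEStronglyMeasurable (fun x => a (f j x)) (μ.restrict K) := fun j =>
    ha.comp_aestronglyMeasurable ((hfc j).aestronglyMeasurable hK.measurableSet)
  have hagB : ∀ᵐ x ∂μ.restrict K, |a (g x)| ≤ A' := hgK.mono fun x hx => hA' _ hx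
  have hafB : ∀ j, ∀ᵐ x ∂μ.restrict K, |a (f j x)| ≤ A' := fun j =>
    (hfK j).mono fun x hx => hA' _ hx
  refine ⟨(hint _ G A' hag hagB hGm).1, tendsto_of_forall_approx fun ε hε => ?_⟩
  -- Order of choices: `τ` bounds the excess, this fixes the level `t`, then `δ` is adapted to `t`,
  -- then `L` comes from `δ`, and finally `η` is adapted to `t` and `L`.
  set τ := ε / (2 * (C0 * 2 ^ p * A + 1)) with hτd
  have hτ : 0 < τ := by positivity
  obtain ⟨t1, ht1, ht1'⟩ := heq K hψU hK τ hτ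
  obtain ⟨t2, ht2, ht2'⟩ := exists_integral_excess_le hp hGm hτ
  set t := max t1 t2
  have ht : 0 ≤ t := le_max_of_le_left ht1
  set δ := ε / (4 * (C0 * 2 ^ p * (1 + t) ^ p * μ.real K + 1)) with hδd
  have hV : 0 ≤ μ.real K := measureReal_nonneg
  have hδ : 0 < δ := by positivity
  obtain ⟨L, hL0, hL⟩ := hAδ δ hδ
  set η := ε / (4 * (C0 * 2 ^ p * (1 + t) ^ p * L + 1)) with hηd
  have hη : 0 < η := by positivity
  -- Cost of changing the map inside the coefficient, with the derivative fixed. It is used for `f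
  -- n` against `f J` with the derivative of `f n`, and for `g` against `f J` with `G`.
  have hest : ∀ (D : E → E →L[ℝ] F) (w z : E → F), MemLp D (ENNReal.ofReal p) (μ.restrict K) →
      ∫ x in K, max (‖D x‖ - t) 0 ^ p ∂μ ≤ τ → MemLp w (ENNReal.ofReal p) (μ.restrict K) →
      MemLp z (ENNReal.ofReal p) (μ.restrict K) → (∀ᵐ x ∂μ.restrict K, w x ∈ S) →
      (∀ᵐ x ∂μ.restrict K, z x ∈ S) → ∫ x in K, ‖w x - z x‖ ^ p ∂μ ≤ η →
      |∫ x, ψ x * a (w x) * covectorDet v (fun a => (ξ a).comp (D x)) ∂μ -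
        ∫ x, ψ x * a (z x) * covectorDet v (fun a => (ξ a).comp (D x)) ∂μ| ≤ ε := by
    intro D w z hD hDτ hw hz hwS hzS hwz
    have hbw := hint (fun x => a (w x)) D A' (ha.comp_aestronglyMeasurable hw.1)
      (hwS.mono fun x hx => hA' _ hx) hD
    have hbz := hint (fun x => a (z x)) D A' (ha.comp_aestronglyMeasurable hz.1)
      (hzS.mono fun x hx => hA' _ hx) hD
    have hdA : ∀ᵐ x ∂μ.restrict K, |a (w x) - a (z x)| ≤ A := by
      filter_upwards [hwS, hzS] with x h1 h2 using hA _ h1 _ h2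
    have hdL : ∀ᵐ x ∂μ.restrict K, |a (w x) - a (z x)| ≤ δ + L * ‖w x - z x‖ ^ p := by
      filter_upwards [hwS, hzS] with x h1 h2 using hL _ h1 _ h2
    have hbd' := hint (fun x => a (w x) - a (z x)) D A
      ((ha.comp_aestronglyMeasurable hw.1).sub (ha.comp_aestronglyMeasurable hz.1)) hdA hD
    rw [← integral_sub hbw.1 hbz.1]
    have e1 : ∀ x, ψ x * a (w x) * covectorDet v (fun a => (ξ a).comp (D x)) -
        ψ x * a (z x) * covectorDet v (fun a => (ξ a).comp (D x)) =
        ψ x * (a (w x) - a (z x)) * covectorDet v (fun a => (ξ a).comp (D x)) := fun x => by ring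
    simp_rw [e1]
    rw [← setIntegral_eq_integral_of_forall_compl_eq_zero (s := K)
      (fun x hx => by simp [hψ0 x hx]), ← Real.norm_eq_abs]
    refine (norm_integral_le_of_norm_le (hbd'.2.const_mul C0)
      ((ae_restrict_iff' hK.measurableSet).mpr (.of_forall (hbd _ D)))).trans ?_
    rw [integral_const_mul]
    refine (mul_le_mul_of_nonneg_left (integral_abs_mul_one_add_rpow_le hK hp hD
      (integrableOn_norm_rpow hp (hw.sub hz)) ht hdA hdL) hC00).trans ?_
    calc _ ≤ C0 * (2 ^ p * ((1 + t) ^ p * (δ * μ.real K + L * η) + A * τ)) := by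
          gcongr
          exact hwz
      _ = ε / 4 * (C0 * 2 ^ p * (1 + t) ^ p * μ.real K /
            (C0 * 2 ^ p * (1 + t) ^ p * μ.real K + 1)) +
          ε / 4 * (C0 * 2 ^ p * (1 + t) ^ p * L / (C0 * 2 ^ p * (1 + t) ^ p * L + 1)) +
          ε / 2 * (C0 * 2 ^ p * A / (C0 * 2 ^ p * A + 1)) := by
          have e2 : C0 * 2 ^ p * (1 + t) ^ p * μ.real K * δ = ε / 4 *
              (C0 * 2 ^ p * (1 + t) ^ p * μ.real K /
                (C0 * 2 ^ p * (1 + t) ^ p * μ.real K + 1)) := by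
            rw [hδd]; field_simp
          have e3 : C0 * 2 ^ p * (1 + t) ^ p * L * η = ε / 4 *
              (C0 * 2 ^ p * (1 + t) ^ p * L / (C0 * 2 ^ p * (1 + t) ^ p * L + 1)) := by
            rw [hηd]; field_simp
          have e4 : C0 * 2 ^ p * A * τ = ε / 2 * (C0 * 2 ^ p * A / (C0 * 2 ^ p * A + 1)) := by
            rw [hτd]; field_simp
          rw [← e2, ← e3, ← e4]; ring
      _ ≤ ε / 4 * 1 + ε / 4 * 1 + ε / 2 * 1 := by
          gcongr <;> exact (div_le_one (by positivity)).mpr (by linarith)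
      _ = ε := by ring
  obtain ⟨J1, hJ1⟩ := h.exists_forall_integral_sub_le hp hψU hK hη
  obtain ⟨J2, hJ2⟩ := eventually_atTop.mp
    ((h.tendsto K hψU hK).eventually (gt_mem_nhds hη))
  set J := max J1 J2
  have hfmem : ∀ j, MemLp (f j) (ENNReal.ofReal p) (μ.restrict K) := fun j =>
    memLp_of_continuousOn hK (hfc j) _
  -- Freezing the coefficient at `f J` makes `ψ * a (f J)` a smooth test function, so the
  -- convergence of the pure minors applies. This is the place where `a ∘ f J` has to be smooth
  -- although `a` is only continuous.
  refine ⟨fun n => ∫ x, ψ x * a (f J x) *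
    covectorDet v (fun a => (ξ a).comp (fderiv ℝ (f n) x)) ∂μ, _,
    h.tendsto_integral_covectorDet hp hU hr v ξ (ψ := fun x => ψ x * a (f J x))
      (contDiff_mul_of_tsupport_subset hU hψ hψU (haf J)) hψc.mul_right
      (tsupport_mul_subset_left.trans hψU), eventually_atTop.mpr ⟨J1, fun n hn => ?_⟩, ?_⟩
  · exact hest _ _ _ (hfm n) ((integral_excess_anti hp (hfm n) ht1 (le_max_left _ _)).trans
      (ht1' n)) (hfmem n) (hfmem J) (hfK n) (hfK J) (hJ1 n hn J (le_max_left _ _))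
  · refine hest _ _ _ hGm ((integral_excess_anti hp hGm ht2 (le_max_right _ _)).trans ht2')
      hgm (hfmem J) hgK (hfK J) ?_
    simp_rw [norm_sub_rev (g _)]
    exact (hJ2 J (le_max_right _ _)).le

end WeakSobolevConvergence

end MinorsCoefficient

/-! ### Stokes' theorem for the product of a closed form and an exact form -/

section ClosedForms

/-- All `n + 1` values of `i` contribute the same amount: absorbing the cycle into `σ` costs its
sign `(-1) ^ i`, which cancels the factor present. An alternating sum can thus be exchanged for one
of its terms under antisymmetrisation. -/
theorem sum_sign_mul_sum_cycleRange {X : Type*} [Fintype X] [DecidableEq X] {n : ℕ}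
    (ρ : Equiv.Perm (Fin (n + 1)) → Equiv.Perm X)
    (hρ : ∀ τ, Equiv.Perm.sign (ρ τ) = Equiv.Perm.sign τ) (Φ : Equiv.Perm X → ℝ) :
    ∑ σ, (Equiv.Perm.sign σ : ℝ) * ∑ i : Fin (n + 1), (-1) ^ (i : ℕ) *
      Φ (σ * ρ i.cycleRange.symm) = (n + 1) * ∑ σ, (Equiv.Perm.sign σ : ℝ) * Φ σ := by
  simp_rw [Finset.mul_sum]
  rw [Finset.sum_comm]
  have h : ∀ i : Fin (n + 1), ∑ σ : Equiv.Perm X, (Equiv.Perm.sign σ : ℝ) *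
      ((-1) ^ (i : ℕ) * Φ (σ * ρ i.cycleRange.symm)) =
      ∑ σ : Equiv.Perm X, (Equiv.Perm.sign σ : ℝ) * Φ σ := by
    intro i
    rw [← Equiv.sum_comp (Equiv.mulRight (ρ i.cycleRange.symm))
      (fun σ : Equiv.Perm X => (Equiv.Perm.sign σ : ℝ) * Φ σ)]
    refine Finset.sum_congr rfl fun σ _ => ?_
    rw [Equiv.coe_mulRight, Equiv.Perm.sign_mul, hρ, Equiv.Perm.sign_symm, Fin.sign_cycleRange]
    push_cast
    ring
  rw [Finset.sum_congr rfl fun i _ => h i]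
  simp [Finset.mul_sum]

/-- The bijection which moves the first index of the right block to the left block. -/
def moveFirst (l k : ℕ) : Fin (l + 1) ⊕ Fin k ≃ Fin l ⊕ Fin (k + 1) where
  toFun := Sum.elim (Fin.cases (Sum.inr 0) Sum.inl) (fun b => Sum.inr b.succ)
  invFun := Sum.elim (fun a => Sum.inl a.succ) (Fin.cases (Sum.inl 0) Sum.inr)
  left_inv := by
    rintro (a | b)
    · induction a using Fin.cases <;> simp
    · simp
  right_inv := by
    rintro (a | b)
    · simp
    · induction b using Fin.cases <;> simp

variable {E : Type*} [NormedAddCommGroup E] [NormedSpace ℝ E]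

/-- The inverse cycle sends `0` to `i` and lists the other indices in order, so every summand is a
permuted copy of the one with `i = 0`. -/
theorem extDeriv_apply_cycleRange {n : ℕ} {ζ : E → E [⋀^Fin n]→L[ℝ] ℝ} {x : E}
    (hζ : DifferentiableAt ℝ ζ x) (w : Fin (n + 1) → E) :
    extDeriv ζ x w = ∑ i : Fin (n + 1), (-1) ^ (i : ℕ) *
      fderiv ℝ (fun y => ζ y fun a => w (i.cycleRange.symm a.succ)) x
        (w (i.cycleRange.symm 0)) := by
  rw [extDeriv_apply hζ]
  refine Finset.sum_congr rfl fun i _ => ?_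
  rw [zsmul_eq_mul, Fin.cycleRange_symm_zero]
  congr 1
  · push_cast; rfl
  · simp_rw [Fin.cycleRange_symm_succ]
    rfl

theorem _root_.ContDiff.extDeriv {n : ℕ} {ζ : E → E [⋀^Fin n]→L[ℝ] ℝ} (hζ : ContDiff ℝ ∞ ζ) :
    ContDiff ℝ ∞ (_root_.extDeriv ζ) := by
  have h := (ContinuousAlternatingMap.alternatizeUncurryFinCLM ℝ E ℝ (n := n)).contDiff
    (n := ∞) |>.comp (hζ.fderiv_right (m := ∞) le_rfl)
  exact h

theorem extDeriv_eq_zero_of_notMem_tsupport {n : ℕ} {ζ : E → E [⋀^Fin n]→L[ℝ] ℝ} {x : E}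
    (hx : x ∉ tsupport ζ) : extDeriv ζ x = 0 := by
  have h : fderiv ℝ ζ x = 0 := by
    rw [(notMem_tsupport_iff_eventuallyEq.mp hx).fderiv_eq]; simp
  rw [extDeriv, h]
  exact (ContinuousAlternatingMap.alternatizeUncurryFinCLM ℝ E ℝ).map_zero

theorem _root_.ContDiffOn.alternating_apply {n : ℕ} {ζ : E → E [⋀^Fin n]→L[ℝ] ℝ} {U : Set E}
    (hζ : ContDiffOn ℝ ∞ ζ U) (w : Fin n → E) : ContDiffOn ℝ ∞ (fun y => ζ y w) U :=
  (ContinuousAlternatingMap.apply ℝ E ℝ w).contDiff.comp_contDiffOn hζ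

variable [MeasurableSpace E] [BorelSpace E] [FiniteDimensional ℝ E] {μ : Measure E}
  [μ.IsAddHaarMeasure]

/-- This is Stokes for `β ∧ dφ`. Under antisymmetrisation `dφ` reduces to `k + 1` times one
directional derivative, which is integrated by parts onto `β`; the antisymmetrised derivative of `β`
is then a multiple of `dβ = 0`. -/
theorem sum_sign_integral_mul_extDeriv_eq_zero {l k : ℕ} {U : Set E} (hU : IsOpen U)
    {β : E → E [⋀^Fin l]→L[ℝ] ℝ} (hβ : ContDiffOn ℝ ∞ β U) (hdβ : ∀ x ∈ U, extDeriv β x = 0)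
    {φ : E → E [⋀^Fin k]→L[ℝ] ℝ} (hφ : ContDiff ℝ ∞ φ) (hφc : HasCompactSupport φ)
    (hφU : tsupport φ ⊆ U) (e : Fin l ⊕ Fin (k + 1) → E) :
    ∑ σ : Equiv.Perm (Fin l ⊕ Fin (k + 1)), (Equiv.Perm.sign σ : ℝ) *
      ∫ x, β x (fun a => e (σ (Sum.inl a))) * extDeriv φ x (fun b => e (σ (Sum.inr b))) ∂μ = 0 := by
  set K := tsupport φ
  have hK : IsCompact K := hφc
  have hφ0 : ∀ x ∉ K, φ x = 0 := fun x hx => image_eq_zero_of_notMem_tsupport hx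
  set b : Equiv.Perm (Fin l ⊕ Fin (k + 1)) → E → ℝ := fun σ x =>
    β x fun a => e (σ (Sum.inl a)) with hb
  set c : Equiv.Perm (Fin l ⊕ Fin (k + 1)) → E → ℝ := fun σ x =>
    φ x fun a => e (σ (Sum.inr a.succ)) with hc
  have hbd : ∀ σ, ContDiffOn ℝ ∞ (b σ) U := fun σ => hβ.alternating_apply _
  have hcd : ∀ σ, ContDiff ℝ ∞ (c σ) := fun σ => by
    rw [← contDiffOn_univ]; exact (contDiffOn_univ.mpr hφ).alternating_apply _
  have hcs : ∀ σ, tsupport (c σ) ⊆ K := fun σ =>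
    closure_minimal (fun x hx => by_contra fun hxK => hx (by simp [hc, hφ0 x hxK]))
      (isClosed_tsupport _)
  have hc0 : ∀ σ, ∀ x ∉ K, c σ x = 0 ∧ fderiv ℝ (c σ) x = 0 := fun σ x hx => by
    have : x ∉ tsupport (c σ) := fun h => hx (hcs σ h)
    exact ⟨image_eq_zero_of_notMem_tsupport this,
      by rw [(notMem_tsupport_iff_eventuallyEq.mp this).fderiv_eq]; simp⟩
  have h1 : ∀ x, ∑ σ : Equiv.Perm (Fin l ⊕ Fin (k + 1)), (Equiv.Perm.sign σ : ℝ) *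
      (b σ x * extDeriv φ x (fun b => e (σ (Sum.inr b)))) =
      (k + 1) * ∑ σ : Equiv.Perm (Fin l ⊕ Fin (k + 1)), (Equiv.Perm.sign σ : ℝ) *
        (b σ x * fderiv ℝ (c σ) x (e (σ (Sum.inr 0)))) := by
    intro x
    rw [← sum_sign_mul_sum_cycleRange (fun τ => Equiv.Perm.sumCongr 1 τ) (fun τ => by simp)]
    refine Finset.sum_congr rfl fun σ _ => ?_
    rw [extDeriv_apply_cycleRange ((hφ.differentiable (by simp)).differentiableAt), Finset.mul_sum]
    congr 1
    refine Finset.sum_congr rfl fun i _ => ?_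
    simp only [hb, hc, Equiv.Perm.mul_apply, Equiv.Perm.sumCongr_apply, Sum.map_inl, Sum.map_inr,
      Equiv.Perm.one_apply]
    ring
  -- The direction of differentiation now has to be grouped with the arguments of `β`; `moveFirst`
  -- does this regrouping. After multiplication by `l + 1` the sum contains the full alternating
  -- expression for `dβ`.
  have h2 : ∀ x, ∑ σ : Equiv.Perm (Fin l ⊕ Fin (k + 1)), (Equiv.Perm.sign σ : ℝ) *
      (fderiv ℝ (b σ) x (e (σ (Sum.inr 0))) * c σ x) = 0 := by
    intro x
    by_cases hx : x ∈ K
    swap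
    · simp [hc0 _ x hx]
    have hl : ((l : ℝ) + 1) ≠ 0 := by positivity
    refine (mul_eq_zero.mp ?_).resolve_left hl
    rw [← sum_sign_mul_sum_cycleRange (fun τ => (moveFirst l k).permCongr
      (Equiv.Perm.sumCongr τ 1)) (fun τ => by simp)]
    refine Finset.sum_eq_zero fun σ _ => ?_
    have h3 := extDeriv_apply_cycleRange (((hβ.contDiffAt (hU.mem_nhds (hφU hx))).differentiableAt
      (by simp))) (fun a => e (σ (moveFirst l k (Sum.inl a))))
    rw [hdβ x (hφU hx)] at h3
    replace h3 := (show (0 : ℝ) = _ from h3)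
    refine mul_eq_zero_of_right _ ?_
    have h4 := congrArg (· * c σ x) h3.symm
    simp only [zero_mul, Finset.sum_mul] at h4
    refine Eq.trans (Finset.sum_congr rfl fun i _ => ?_) h4
    simp only [hb, hc, Equiv.Perm.mul_apply, Equiv.permCongr_apply, moveFirst, Equiv.coe_fn_mk,
      Equiv.coe_fn_symm_mk, Sum.elim_inl, Sum.elim_inr, Fin.cases_zero, Fin.cases_succ,
      Equiv.Perm.sumCongr_apply, Sum.map_inl, Sum.map_inr, Equiv.Perm.one_apply, mul_assoc]
  have hdc : Continuous fun x => extDeriv φ x := hφ.extDeriv.continuous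
  have hd0 : ∀ x ∉ K, extDeriv φ x = 0 := fun x hx =>
    extDeriv_eq_zero_of_notMem_tsupport hx
  have hbK : ∀ σ, ContinuousOn (b σ) K := fun σ => (hbd σ).continuousOn.mono hφU
  have hi1 : ∀ σ, Integrable (fun x => b σ x *
      extDeriv φ x (fun b => e (σ (Sum.inr b)))) μ := fun σ =>
    WeakSobolevConvergence.integrable_of_continuousOn hK ((hbK σ).mul
      ((ContinuousAlternatingMap.apply ℝ E ℝ _).continuous.comp hdc).continuousOn)
      fun x hx => by simp [hd0 x hx]
  have hi2 : ∀ σ, Integrable (fun x => b σ x * fderiv ℝ (c σ) x (e (σ (Sum.inr 0)))) μ := fun σ =>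
    WeakSobolevConvergence.integrable_of_continuousOn hK ((hbK σ).mul
      (((hcd σ).continuous_fderiv (by simp)).clm_apply continuous_const).continuousOn)
      fun x hx => by simp [hc0 σ x hx]
  have hi3 : ∀ σ, Integrable (fun x => fderiv ℝ (b σ) x (e (σ (Sum.inr 0))) * c σ x) μ := fun σ =>
    WeakSobolevConvergence.integrable_of_continuousOn hK
      (((((hbd σ).continuousOn_fderiv_of_isOpen hU (by simp)).mono hφU).clm_apply
        continuousOn_const).mul (hcd σ).continuous.continuousOn)
      fun x hx => by simp [hc0 σ x hx]
  have hi4 : ∀ σ, Integrable (fun x => b σ x * c σ x) μ := fun σ =>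
    WeakSobolevConvergence.integrable_of_continuousOn hK
      ((hbK σ).mul (hcd σ).continuous.continuousOn) fun x hx => by simp [hc0 σ x hx]
  have ibp : ∀ σ, ∫ x, b σ x * fderiv ℝ (c σ) x (e (σ (Sum.inr 0))) ∂μ =
      -∫ x, fderiv ℝ (b σ) x (e (σ (Sum.inr 0))) * c σ x ∂μ := fun σ =>
    integral_mul_fderiv_eq_neg_fderiv_mul_of_integrable (hi3 σ) (hi2 σ) (hi4 σ)
      (fun x hx => ((hbd σ).contDiffAt (hU.mem_nhds (hφU (hcs σ hx)))).differentiableAt (by simp))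
      (fun x _ => ((hcd σ).differentiable (by simp)).differentiableAt)
  calc ∑ σ : Equiv.Perm (Fin l ⊕ Fin (k + 1)), (Equiv.Perm.sign σ : ℝ) *
        ∫ x, b σ x * extDeriv φ x (fun b => e (σ (Sum.inr b))) ∂μ
      = ∫ x, (k + 1) * ∑ σ : Equiv.Perm (Fin l ⊕ Fin (k + 1)), (Equiv.Perm.sign σ : ℝ) *
        (b σ x * fderiv ℝ (c σ) x (e (σ (Sum.inr 0)))) ∂μ := by
        simp_rw [← h1]
        rw [integral_finsetSum _ fun σ _ => (hi1 σ).const_mul _]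
        simp_rw [integral_const_mul]
    _ = (k + 1) * -∫ x, ∑ σ : Equiv.Perm (Fin l ⊕ Fin (k + 1)), (Equiv.Perm.sign σ : ℝ) *
        (fderiv ℝ (b σ) x (e (σ (Sum.inr 0))) * c σ x) ∂μ := by
        rw [integral_const_mul, integral_finsetSum _ fun σ _ => (hi2 σ).const_mul _,
          integral_finsetSum _ fun σ _ => (hi3 σ).const_mul _, ← Finset.sum_neg_distrib]
        simp_rw [integral_const_mul, ibp, mul_neg]
    _ = 0 := by simp [h2]

end ClosedForms

/-! ### Exterior products as sums over permutations, and the limit in Stokes' identity. -/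

section WedgeExpansion

/-- Each shuffle represents `k! l!` permutations, which all give the same term because both factors
are alternating. -/
theorem factorial_mul_wedgeForm {V : Type*} [TopologicalSpace V] [AddCommGroup V] [Module ℝ V]
    {k l : ℕ} (α : V [⋀^Fin k]→L[ℝ] ℝ) (β : V [⋀^Fin l]→L[ℝ] ℝ) (v : Fin (k + l) → V) :
    (k.factorial * l.factorial : ℝ) * wedgeForm α β v =
      ∑ σ : Equiv.Perm (Fin k ⊕ Fin l), (Equiv.Perm.sign σ : ℝ) *
        (α (fun a => v (finSumFinEquiv (σ (Sum.inl a)))) *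
          β (fun b => v (finSumFinEquiv (σ (Sum.inr b))))) := by
  have h := MultilinearMap.domCoprod_alternization_eq α.toAlternatingMap β.toAlternatingMap
  have h2 := congrArg (fun L => (LinearMap.mul' ℝ ℝ) (L fun i => v (finSumFinEquiv i))) h
  simp only [MultilinearMap.alternatization_apply, AlternatingMap.smul_apply, Fintype.card_fin,
    map_sum, map_nsmul] at h2
  rw [nsmul_eq_mul] at h2
  push_cast at h2
  refine Eq.trans ?_ (h2.symm.trans ?_)
  · rfl
  · refine Finset.sum_congr rfl fun σ _ => ?_
    rw [map_zsmul_unit, Units.smul_def, zsmul_eq_mul]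
    simp

/-- The coefficients `A i` need not be alternating in `i`. Since `B` is, averaging over the
permutations of `v` turns each product of components into a determinant. -/
theorem factorial_mul_eq_sum_covectorDet {E : Type*} [NormedAddCommGroup E] [NormedSpace ℝ E]
    {l ν : ℕ} (B : E [⋀^Fin l]→L[ℝ] ℝ) (D : E →L[ℝ] EuclideanSpace ℝ (Fin ν))
    (A : (Fin l → Fin ν) → ℝ) (hB : ∀ v, B v = ∑ i, A i * ∏ b, D (v b) (i b)) (v : Fin l → E) :
    (l.factorial : ℝ) * B v = ∑ i, A i *
      covectorDet v (fun b => (EuclideanSpace.proj (𝕜 := ℝ) (i b)).comp D) := by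
  have h1 : (l.factorial : ℝ) * B v = ∑ τ : Equiv.Perm (Fin l),
      (Equiv.Perm.sign τ : ℝ) * B (v ∘ τ) := by
    have : ∀ τ : Equiv.Perm (Fin l), (Equiv.Perm.sign τ : ℝ) * B (v ∘ τ) = B v := by
      intro τ
      have h2 : B (v ∘ τ) = Equiv.Perm.sign τ • B v := B.toAlternatingMap.map_perm v τ
      rw [h2, Units.smul_def, zsmul_eq_mul, ← mul_assoc]
      norm_cast
      simp
    simp_rw [this]
    simp [Fintype.card_perm]
  simp_rw [h1, hB, covectorDet_apply, Finset.mul_sum]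
  rw [Finset.sum_comm]
  refine Finset.sum_congr rfl fun i _ => Finset.sum_congr rfl fun τ _ => ?_
  simp only [Function.comp_apply]
  rw [mul_left_comm]
  rfl

variable {E : Type*} [NormedAddCommGroup E] [NormedSpace ℝ E] [MeasurableSpace E] [BorelSpace E]
  [FiniteDimensional ℝ E] {μ : Measure E} [μ.IsAddHaarMeasure] {p : ℝ} {U : Set E} {ν : ℕ}
  {f : ℕ → E → EuclideanSpace ℝ (Fin ν)} {g : E → EuclideanSpace ℝ (Fin ν)}
  {G : E → E →L[ℝ] EuclideanSpace ℝ (Fin ν)}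

/-- Stokes holds for each smooth `β j`; expanding `β j` and `γ` into minors with the same
coefficient functions allows the limit. No derivative of `γ` is involved: it is only required to
satisfy the coefficient formula almost everywhere. -/
theorem WeakSobolevConvergence.sum_sign_integral_eq_zero (h : WeakSobolevConvergence μ p U f g G)
    (hp : 1 ≤ p) (hU : IsOpen U) {l k : ℕ} (hl : (l : ℝ) ≤ p)
    {S : Set (EuclideanSpace ℝ (Fin ν))} (hS : IsCompact S)
    {A : (Fin l → Fin ν) → EuclideanSpace ℝ (Fin ν) → ℝ} (hA : ∀ i, Continuous (A i))
    (hfS : ∀ j, ∀ x ∈ U, f j x ∈ S) (hgS : ∀ᵐ x ∂μ, x ∈ U → g x ∈ S)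
    (hAf : ∀ i j, ContDiffOn ℝ ∞ (fun x => A i (f j x)) U)
    (heq : ∀ K ⊆ U, IsCompact K → ∀ ε > 0, ∃ t : ℝ, 0 ≤ t ∧ ∀ j,
      ∫ x in K, max (‖fderiv ℝ (f j) x‖ - t) 0 ^ p ∂μ ≤ ε)
    {β : ℕ → E → E [⋀^Fin l]→L[ℝ] ℝ} (hβ : ∀ j, ContDiffOn ℝ ∞ (β j) U)
    (hdβ : ∀ j, ∀ x ∈ U, extDeriv (β j) x = 0)
    (hβA : ∀ j, ∀ x ∈ U, ∀ v, β j x v = ∑ i, A i (f j x) * ∏ b, fderiv ℝ (f j) x (v b) (i b))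
    {γ : E → E [⋀^Fin l]→L[ℝ] ℝ}
    (hγA : ∀ᵐ x ∂μ, x ∈ U → ∀ v, γ x v = ∑ i, A i (g x) * ∏ b, G x (v b) (i b))
    {φ : E → E [⋀^Fin k]→L[ℝ] ℝ} (hφ : ContDiff ℝ ∞ φ) (hφc : HasCompactSupport φ)
    (hφU : tsupport φ ⊆ U) (e : Fin l ⊕ Fin (k + 1) → E) :
    (∀ σ : Equiv.Perm (Fin l ⊕ Fin (k + 1)), Integrable (fun x =>
      γ x (fun a => e (σ (Sum.inl a))) * extDeriv φ x (fun b => e (σ (Sum.inr b)))) μ) ∧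
    ∑ σ : Equiv.Perm (Fin l ⊕ Fin (k + 1)), (Equiv.Perm.sign σ : ℝ) *
      ∫ x, γ x (fun a => e (σ (Sum.inl a))) *
        extDeriv φ x (fun b => e (σ (Sum.inr b))) ∂μ = 0 := by
  have hl0 : (l.factorial : ℝ) ≠ 0 := by positivity
  set ψ : Equiv.Perm (Fin l ⊕ Fin (k + 1)) → E → ℝ := fun σ x =>
    extDeriv φ x (fun b => e (σ (Sum.inr b))) with hψd
  have hψ : ∀ σ, ContDiff ℝ ∞ (ψ σ) := fun σ => by
    rw [← contDiffOn_univ]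
    exact (contDiffOn_univ.mpr hφ.extDeriv).alternating_apply _
  have hψ0 : ∀ σ, ∀ x ∉ tsupport φ, ψ σ x = 0 := fun σ x hx => by
    simp [hψd, extDeriv_eq_zero_of_notMem_tsupport hx]
  have hψc : ∀ σ, HasCompactSupport (ψ σ) := fun σ => HasCompactSupport.intro hφc (hψ0 σ)
  have hψs : ∀ σ, tsupport (ψ σ) ⊆ U := fun σ => (closure_minimal
    (fun x (hx : ψ σ x ≠ 0) => by_contra fun hxK => hx (hψ0 σ x hxK))
    (isClosed_tsupport φ)).trans hφU
  have key := fun (σ : Equiv.Perm (Fin l ⊕ Fin (k + 1))) (i : Fin l → Fin ν) =>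
    h.tendsto_integral_coeff_covectorDet hp hU hl (fun a => e (σ (Sum.inl a)))
      (fun b => EuclideanSpace.proj (𝕜 := ℝ) (i b)) hS (hA i) hfS hgS (hAf i) heq (hψ σ) (hψc σ)
      (hψs σ)
  have hγ : ∀ σ, (fun x => γ x (fun a => e (σ (Sum.inl a))) * ψ σ x) =ᵐ[μ] fun x =>
      (l.factorial : ℝ)⁻¹ * ∑ i, ψ σ x * A i (g x) * covectorDet (fun a => e (σ (Sum.inl a)))
        (fun b => (EuclideanSpace.proj (𝕜 := ℝ) (i b)).comp (G x)) := by
    intro σ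
    filter_upwards [hγA] with x hx
    by_cases hxU : x ∈ tsupport φ
    · rw [eq_inv_mul_iff_mul_eq₀ hl0, ← mul_assoc,
        factorial_mul_eq_sum_covectorDet _ (G x) _ (hx (hφU hxU)), Finset.sum_mul]
      exact Finset.sum_congr rfl fun i _ => by ring
    · simp [hψ0 σ x hxU]
  have hβ' : ∀ j σ x, β j x (fun a => e (σ (Sum.inl a))) * ψ σ x =
      (l.factorial : ℝ)⁻¹ * ∑ i, ψ σ x * A i (f j x) * covectorDet (fun a => e (σ (Sum.inl a)))
        (fun b => (EuclideanSpace.proj (𝕜 := ℝ) (i b)).comp (fderiv ℝ (f j) x)) := by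
    intro j σ x
    by_cases hxU : x ∈ tsupport φ
    · rw [eq_inv_mul_iff_mul_eq₀ hl0, ← mul_assoc,
        factorial_mul_eq_sum_covectorDet _ (fderiv ℝ (f j) x) _ (hβA j x (hφU hxU)),
        Finset.sum_mul]
      exact Finset.sum_congr rfl fun i _ => by ring
    · simp [hψ0 σ x hxU]
  have hfi : ∀ j σ i, Integrable (fun x => ψ σ x * A i (f j x) *
      covectorDet (fun a => e (σ (Sum.inl a)))
        (fun b => (EuclideanSpace.proj (𝕜 := ℝ) (i b)).comp (fderiv ℝ (f j) x))) μ := by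
    intro j σ i
    refine WeakSobolevConvergence.integrable_of_continuousOn hφc
      ((((hψ σ).continuous.continuousOn).mul ((hAf i j).continuousOn.mono hφU)).mul
        ((covectorDet _).cont.comp_continuousOn (continuousOn_pi.mpr fun b =>
          continuousOn_const.clm_comp ((h.continuousOn_fderiv hU j).mono hφU))))
      fun x hx => by simp [hψ0 σ x hx]
  refine ⟨fun σ => ((integrable_finsetSum _ fun i _ => (key σ i).1).const_mul _).congr
    (hγ σ).symm, ?_⟩
  have hlim : Tendsto (fun j => ∑ σ : Equiv.Perm (Fin l ⊕ Fin (k + 1)),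
      (Equiv.Perm.sign σ : ℝ) * ∫ x, β j x (fun a => e (σ (Sum.inl a))) * ψ σ x ∂μ) atTop
      (𝓝 (∑ σ : Equiv.Perm (Fin l ⊕ Fin (k + 1)), (Equiv.Perm.sign σ : ℝ) *
        ∫ x, γ x (fun a => e (σ (Sum.inl a))) * ψ σ x ∂μ)) := by
    refine tendsto_finsetSum _ fun σ _ => Tendsto.const_mul _ ?_
    rw [integral_congr_ae (hγ σ)]
    simp_rw [hβ', integral_const_mul]
    rw [integral_finsetSum _ fun i _ => (key σ i).1]
    simp_rw [integral_finsetSum _ fun i _ => hfi _ σ i]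
    exact (tendsto_finsetSum _ fun i _ => (key σ i).2).const_mul _
  refine tendsto_nhds_unique hlim ?_
  have hz : ∀ j, ∑ σ : Equiv.Perm (Fin l ⊕ Fin (k + 1)), (Equiv.Perm.sign σ : ℝ) *
      ∫ x, β j x (fun a => e (σ (Sum.inl a))) * ψ σ x ∂μ = 0 := fun j =>
    sum_sign_integral_mul_extDeriv_eq_zero hU (hβ j) (hdβ j) hφ hφc hφU e
  simp_rw [hz]
  exact tendsto_const_nhds

end WedgeExpansion

/-! ### Smooth families of alternating maps -/

section AlternatingFamilies

variable {V W : Type*} [NormedAddCommGroup V] [NormedSpace ℝ V] [NormedAddCommGroup W]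
  [NormedSpace ℝ W]

theorem alternating_apply_eq_sum_basis {d : Type*} [Fintype d] (b : Module.Basis d ℝ V) {k : ℕ}
    (a : V [⋀^Fin k]→L[ℝ] ℝ) (w : Fin k → V) :
    a w = ∑ i : Fin k → d, (∏ j, b.repr (w j) (i j)) * a (fun j => b (i j)) := by
  classical
  have h : a w = a.toMultilinearMap (fun j => ∑ i, b.repr (w j) i • b i) := by
    simp only [b.sum_repr]; rfl
  rw [h, MultilinearMap.map_sum]
  refine Finset.sum_congr rfl fun i _ => ?_
  rw [MultilinearMap.map_smul_univ]
  rfl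

/-- An alternating map is determined linearly by its values on tuples of basis vectors, and a linear
left inverse recovers it from these finitely many smooth functions. -/
theorem contDiffOn_alternating_of_apply [FiniteDimensional ℝ V] {k : ℕ} {U : Set W}
    {ζ : W → V [⋀^Fin k]→L[ℝ] ℝ} (h : ∀ v, ContDiffOn ℝ ∞ (fun x => ζ x v) U) :
    ContDiffOn ℝ ∞ ζ U := by
  let b := Module.finBasis ℝ V
  let Φ : (V [⋀^Fin k]→L[ℝ] ℝ) →ₗ[ℝ] ((Fin k → Fin (Module.finrank ℝ V)) → ℝ) :=
    { toFun := fun a i => a (fun j => b (i j))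
      map_add' := fun _ _ => rfl
      map_smul' := fun _ _ => rfl }
  have hΦ : LinearMap.ker Φ = ⊥ := by
    rw [LinearMap.ker_eq_bot]
    intro a a' haa
    ext v
    rw [alternating_apply_eq_sum_basis b, alternating_apply_eq_sum_basis b a']
    exact Finset.sum_congr rfl fun i _ => by rw [show a (fun j => b (i j)) = _ from congrFun haa i]; rfl
  obtain ⟨Ψ, hΨ⟩ := Φ.exists_leftInverse_of_injective hΦ
  have : ζ = fun x => LinearMap.toContinuousLinearMap Ψ (fun i => ζ x (fun j => b (i j))) := by
    funext x
    exact (LinearMap.congr_fun hΨ (ζ x)).symm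
  rw [this]
  exact (ContinuousLinearMap.contDiff _).comp_contDiffOn (contDiffOn_pi.mpr fun i => h _)

theorem ContDiffOn.alternating_apply_apply [FiniteDimensional ℝ V] {k : ℕ} {U : Set W}
    {ζ : W → V [⋀^Fin k]→L[ℝ] ℝ} (hζ : ContDiffOn ℝ ∞ ζ U) {w : Fin k → W → V}
    (hw : ∀ j, ContDiffOn ℝ ∞ (w j) U) : ContDiffOn ℝ ∞ (fun x => ζ x (fun j => w j x)) U := by
  let b := Module.finBasis ℝ V
  refine ContDiffOn.congr ?_ fun x _ => alternating_apply_eq_sum_basis b (ζ x) _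
  refine ContDiffOn.sum fun i _ => (contDiffOn_prod fun j _ => ?_).mul ?_
  · exact (LinearMap.toContinuousLinearMap (b.coord (i j))).contDiff.comp_contDiffOn (hw j)
  · exact (ContinuousAlternatingMap.apply ℝ V ℝ (fun j => b (i j))).contDiff.comp_contDiffOn hζ

theorem ContDiffOn.alternating_compContinuousLinearMap [FiniteDimensional ℝ V] {V' : Type*}
    [NormedAddCommGroup V'] [NormedSpace ℝ V'] [FiniteDimensional ℝ V'] {k : ℕ} {U : Set W}
    {ζ : W → V [⋀^Fin k]→L[ℝ] ℝ} (hζ : ContDiffOn ℝ ∞ ζ U) {A : W → V' →L[ℝ] V}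
    (hA : ContDiffOn ℝ ∞ A U) :
    ContDiffOn ℝ ∞ (fun x => (ζ x).compContinuousLinearMap (A x)) U :=
  contDiffOn_alternating_of_apply fun _ =>
    hζ.alternating_apply_apply fun _ => hA.clm_apply contDiffOn_const

end AlternatingFamilies

/-! ### Pull-backs of forms by maps defined on a Euclidean space -/

section FormPullback

variable {m n : ℕ} {N : Type*} [TopologicalSpace N] [ChartedSpace (EuclideanSpace ℝ (Fin n)) N]

/-- The pull-back of a form on `N` by a map from `ℝᵐ` to `N`. -/
def formPullback {k : ℕ} (W : EuclideanSpace ℝ (Fin m) → N) (α : DiffForm n N k)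
    (z : EuclideanSpace ℝ (Fin m)) : EuclideanSpace ℝ (Fin m) [⋀^Fin k]→L[ℝ] ℝ :=
  (α (W z)).compContinuousLinearMap (mfderiv (𝓡 m) (𝓡 n) W z)

/-- A form, read as a map into a fixed space of alternating maps, depends only on the base point. -/
theorem diffForm_apply_congr {k : ℕ} (α : DiffForm n N k) {q q' : N} (h : q = q')
    (w : Fin k → EuclideanSpace ℝ (Fin n)) :
    (show EuclideanSpace ℝ (Fin n) [⋀^Fin k]→L[ℝ] ℝ from α q) w =
      (show EuclideanSpace ℝ (Fin n) [⋀^Fin k]→L[ℝ] ℝ from α q') w := by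
  subst h; rfl

variable [IsManifold (𝓡 n) ∞ N] {c : OpenPartialHomeomorph N (EuclideanSpace ℝ (Fin n))}

theorem chart_mdifferentiableAt (hc : c ∈ atlas (EuclideanSpace ℝ (Fin n)) N) {q : N}
    (hq : q ∈ c.source) : MDifferentiableAt (𝓡 n) (𝓡 n) c q :=
  mdifferentiableAt_atlas hc hq

theorem chart_symm_mdifferentiableAt (hc : c ∈ atlas (EuclideanSpace ℝ (Fin n)) N)
    {y : EuclideanSpace ℝ (Fin n)} (hy : y ∈ c.target) :
    MDifferentiableAt (𝓡 n) (𝓡 n) c.symm y :=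
  mdifferentiableAt_atlas_symm hc hy

theorem chart_contMDiffOn (hc : c ∈ atlas (EuclideanSpace ℝ (Fin n)) N) :
    ContMDiffOn (𝓡 n) (𝓡 n) ∞ c c.source :=
  contMDiffOn_of_mem_maximalAtlas (IsManifold.subset_maximalAtlas hc)

theorem chart_symm_contMDiffOn (hc : c ∈ atlas (EuclideanSpace ℝ (Fin n)) N) :
    ContMDiffOn (𝓡 n) (𝓡 n) ∞ c.symm c.target :=
  contMDiffOn_symm_of_mem_maximalAtlas (IsManifold.subset_maximalAtlas hc)

theorem fderiv_chart_comp (hc : c ∈ atlas (EuclideanSpace ℝ (Fin n)) N)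
    {W : EuclideanSpace ℝ (Fin m) → N} {z : EuclideanSpace ℝ (Fin m)}
    (hW : MDifferentiableAt (𝓡 m) (𝓡 n) W z) (hz : W z ∈ c.source) :
    fderiv ℝ (c ∘ W) z = (mfderiv (𝓡 n) (𝓡 n) c (W z)).comp (mfderiv (𝓡 m) (𝓡 n) W z) := by
  rw [← mfderiv_comp z (chart_mdifferentiableAt hc hz) hW, mfderiv_eq_fderiv]

theorem chartSymmDeriv_fderiv_chart_comp (hc : c ∈ atlas (EuclideanSpace ℝ (Fin n)) N)
    {W : EuclideanSpace ℝ (Fin m) → N} {z : EuclideanSpace ℝ (Fin m)}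
    (hW : MDifferentiableAt (𝓡 m) (𝓡 n) W z) (hz : W z ∈ c.source)
    (v : EuclideanSpace ℝ (Fin m)) :
    (chartSymmDeriv c (c (W z)) (fderiv ℝ (c ∘ W) z v) : EuclideanSpace ℝ (Fin n)) =
      mfderiv (𝓡 m) (𝓡 n) W z v := by
  have h1 : W =ᶠ[𝓝 z] c.symm ∘ (c ∘ W) := by
    filter_upwards [hW.continuousAt.preimage_mem_nhds (c.open_source.mem_nhds hz)] with x hx
    exact (c.left_inv hx).symm
  have h2 := mfderiv_comp z (g := c.symm) (f := c ∘ W) (I := 𝓡 m) (I' := 𝓡 n) (I'' := 𝓡 n)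
    (chart_symm_mdifferentiableAt hc (c.map_source hz))
    ((chart_mdifferentiableAt hc hz).comp z hW)
  have h3 := h1.mfderiv_eq (I := 𝓡 m) (I' := 𝓡 n)
  rw [mfderiv_eq_fderiv] at h2
  have h4 := (h3.trans h2 : (mfderiv (𝓡 m) (𝓡 n) W z : EuclideanSpace ℝ (Fin m) →L[ℝ] EuclideanSpace ℝ (Fin n)) = _)
  exact (DFunLike.congr_fun h4 v).symm

/-- This reduces pull-backs to Euclidean forms pulled back by `c ∘ W`. The two sides live over the
points `W z` and `c.symm (c (W z))`, which are only propositionally equal; `diffForm_apply_congr`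
bridges the gap. -/
theorem formPullback_eq (hc : c ∈ atlas (EuclideanSpace ℝ (Fin n)) N) {k : ℕ} (α : DiffForm n N k)
    {W : EuclideanSpace ℝ (Fin m) → N} {z : EuclideanSpace ℝ (Fin m)}
    (hW : MDifferentiableAt (𝓡 m) (𝓡 n) W z) (hz : W z ∈ c.source) :
    formPullback W α z =
      (chartForm c α ((c ∘ W) z)).compContinuousLinearMap (fderiv ℝ (c ∘ W) z) := by
  ext v
  have h1 := fun i => chartSymmDeriv_fderiv_chart_comp hc hW hz (v i)
  have h2 := diffForm_apply_congr α (c.left_inv hz) (fun i => mfderiv (𝓡 m) (𝓡 n) W z (v i))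
  refine h2.symm.trans ?_
  exact (congrArg (show EuclideanSpace ℝ (Fin n) [⋀^Fin k]→L[ℝ] ℝ from α (c.symm (c (W z))))
    (funext h1)).symm

theorem contDiffOn_chart_comp (hc : c ∈ atlas (EuclideanSpace ℝ (Fin n)) N)
    {W : EuclideanSpace ℝ (Fin m) → N} {U : Set (EuclideanSpace ℝ (Fin m))}
    (hW : ContMDiffOn (𝓡 m) (𝓡 n) ∞ W U) :
    ContDiffOn ℝ ∞ (c ∘ W) (U ∩ W ⁻¹' c.source) :=
  contMDiffOn_iff_contDiffOn.mp ((chart_contMDiffOn hc).comp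
    (hW.mono inter_subset_left) fun _ hx => hx.2)

theorem contDiffOn_formPullback {k : ℕ} {α : DiffForm n N k} (hα : IsSmoothForm α)
    {W : EuclideanSpace ℝ (Fin m) → N} {U : Set (EuclideanSpace ℝ (Fin m))} (hU : IsOpen U)
    (hW : ContMDiffOn (𝓡 m) (𝓡 n) ∞ W U) : ContDiffOn ℝ ∞ (formPullback W α) U := by
  intro z hz
  let c := chartAt (EuclideanSpace ℝ (Fin n)) (W z)
  have hc : c ∈ atlas (EuclideanSpace ℝ (Fin n)) N := chart_mem_atlas _ _
  let U' := U ∩ W ⁻¹' c.source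
  have hU' : IsOpen U' := hW.continuousOn.isOpen_inter_preimage hU c.open_source
  have hz' : z ∈ U' := ⟨hz, mem_chart_source _ _⟩
  have h1 := contDiffOn_chart_comp hc hW
  have h2 : ContDiffOn ℝ ∞ (fun x => (chartForm c α ((c ∘ W) x)).compContinuousLinearMap
      (fderiv ℝ (c ∘ W) x)) U' :=
    ((hα c hc).comp h1 fun x hx => c.map_source hx.2).alternating_compContinuousLinearMap
      (h1.fderiv_of_isOpen hU' (by simp))
  refine ((h2.congr fun x hx => ?_).contDiffAt (hU'.mem_nhds hz')).contDiffWithinAt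
  exact formPullback_eq hc α ((hW.contMDiffAt (hU.mem_nhds hx.1)).mdifferentiableAt (by simp)) hx.2

/-- This is the naturality of `d` between Euclidean spaces, read in the preferred chart at `W z`.
That is the chart which defines `formDeriv` there, so independence of the chart is not needed. -/
theorem extDeriv_formPullback {k : ℕ} {α : DiffForm n N k} (hα : IsSmoothForm α)
    {W : EuclideanSpace ℝ (Fin m) → N} {U : Set (EuclideanSpace ℝ (Fin m))} (hU : IsOpen U)
    (hW : ContMDiffOn (𝓡 m) (𝓡 n) ∞ W U) {z : EuclideanSpace ℝ (Fin m)} (hz : z ∈ U) :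
    extDeriv (formPullback W α) z = formPullback W (formDeriv α) z := by
  let c := chartAt (EuclideanSpace ℝ (Fin n)) (W z)
  have hc : c ∈ atlas (EuclideanSpace ℝ (Fin n)) N := chart_mem_atlas _ _
  let U' := U ∩ W ⁻¹' c.source
  have hU' : IsOpen U' := hW.continuousOn.isOpen_inter_preimage hU c.open_source
  have hz' : z ∈ U' := ⟨hz, mem_chart_source _ _⟩
  have h1 := contDiffOn_chart_comp hc hW
  have hd : ∀ x ∈ U, MDifferentiableAt (𝓡 m) (𝓡 n) W x := fun x hx =>
    (hW.contMDiffAt (hU.mem_nhds hx)).mdifferentiableAt (by simp)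
  have h2 : formPullback W α =ᶠ[𝓝 z] fun x =>
      (chartForm c α ((c ∘ W) x)).compContinuousLinearMap (fderiv ℝ (c ∘ W) x) := by
    filter_upwards [hU'.mem_nhds hz'] with x hx
    exact formPullback_eq hc α (hd x hx.1) hx.2
  rw [extDeriv, h2.fderiv_eq]
  have h3 := extDeriv_pullback (f := c ∘ W) (x := z) (r := ∞)
    (((hα c hc).contDiffAt (c.open_target.mem_nhds (c.map_source hz'.2))).differentiableAt (by simp))
    (h1.contDiffAt (hU'.mem_nhds hz'))
    (by rw [minSmoothness_of_isRCLikeNormedField]; exact ENat.LEInfty.out)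
  rw [extDeriv] at h3
  rw [h3, fderiv_chart_comp hc (hd z hz) hz'.2]
  rfl

/-- Naturality applied to `W = c.symm` yields that `formDeriv` may be computed in any chart. -/
theorem chartForm_formDeriv (hc : c ∈ atlas (EuclideanSpace ℝ (Fin n)) N) {k : ℕ}
    {α : DiffForm n N k} (hα : IsSmoothForm α) {y : EuclideanSpace ℝ (Fin n)}
    (hy : y ∈ c.target) : chartForm c (formDeriv α) y = extDeriv (chartForm c α) y :=
  (extDeriv_formPullback hα c.open_target (chart_symm_contMDiffOn hc) hy).symm

end FormPullback

/-! ### Coefficients of a form on an isometrically embedded manifold -/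

section ChartDeriv

variable {n : ℕ} {N : Type*} [TopologicalSpace N] [ChartedSpace (EuclideanSpace ℝ (Fin n)) N]
  [IsManifold (𝓡 n) ∞ N] {c : OpenPartialHomeomorph N (EuclideanSpace ℝ (Fin n))}

theorem mfderiv_chart_comp_chartSymmDeriv (hc : c ∈ atlas (EuclideanSpace ℝ (Fin n)) N)
    {y : EuclideanSpace ℝ (Fin n)} (hy : y ∈ c.target) (v : EuclideanSpace ℝ (Fin n)) :
    (mfderiv (𝓡 n) (𝓡 n) c (c.symm y) (chartSymmDeriv c y v) : EuclideanSpace ℝ (Fin n)) = v := by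
  have h1 := fderiv_chart_comp hc (chart_symm_mdifferentiableAt hc hy) (c.map_target hy)
  have h2 : c ∘ c.symm =ᶠ[𝓝 y] id := by
    filter_upwards [c.open_target.mem_nhds hy] with x hx
    exact c.right_inv hx
  rw [h2.fderiv_eq, fderiv_id] at h1
  exact (DFunLike.congr_fun h1 v).symm

theorem chartSymmDeriv_comp_mfderiv_chart (hc : c ∈ atlas (EuclideanSpace ℝ (Fin n)) N)
    {y : EuclideanSpace ℝ (Fin n)} (hy : y ∈ c.target) (v : TangentSpace (𝓡 n) (c.symm y)) :
    chartSymmDeriv c y (mfderiv (𝓡 n) (𝓡 n) c (c.symm y) v) = v := by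
  let A : EuclideanSpace ℝ (Fin n) →ₗ[ℝ] EuclideanSpace ℝ (Fin n) :=
    (show EuclideanSpace ℝ (Fin n) →L[ℝ] EuclideanSpace ℝ (Fin n) from
      mfderiv (𝓡 n) (𝓡 n) c (c.symm y)).toLinearMap
  let B : EuclideanSpace ℝ (Fin n) →ₗ[ℝ] EuclideanSpace ℝ (Fin n) :=
    (show EuclideanSpace ℝ (Fin n) →L[ℝ] EuclideanSpace ℝ (Fin n) from
      chartSymmDeriv c y).toLinearMap
  have h : A ∘ₗ B = LinearMap.id := LinearMap.ext fun w => mfderiv_chart_comp_chartSymmDeriv hc hy w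
  -- In finite dimension a one-sided inverse of an endomorphism is two-sided.
  exact LinearMap.congr_fun (mul_eq_one_comm.mp (show A * B = 1 from h)) v

theorem chartSymmDeriv_injective (hc : c ∈ atlas (EuclideanSpace ℝ (Fin n)) N)
    {y : EuclideanSpace ℝ (Fin n)} (hy : y ∈ c.target) : Function.Injective (chartSymmDeriv c y) :=
  fun v w h => by
    rw [← mfderiv_chart_comp_chartSymmDeriv hc hy v, h, mfderiv_chart_comp_chartSymmDeriv hc hy w]

theorem chartSymmDeriv_surjective (hc : c ∈ atlas (EuclideanSpace ℝ (Fin n)) N)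
    {y : EuclideanSpace ℝ (Fin n)} (hy : y ∈ c.target) : Function.Surjective (chartSymmDeriv c y) :=
  fun v => ⟨_, chartSymmDeriv_comp_mfderiv_chart hc hy v⟩

theorem diffAt_comp_chartSymmDeriv (hc : c ∈ atlas (EuclideanSpace ℝ (Fin n)) N) {ν : ℕ}
    {f : N → EuclideanSpace ℝ (Fin ν)} (hf : MDifferentiable (𝓡 n) (𝓡 ν) f)
    {y : EuclideanSpace ℝ (Fin n)} (hy : y ∈ c.target) (v : EuclideanSpace ℝ (Fin n)) :
    diffAt f (c.symm y) (chartSymmDeriv c y v) = fderiv ℝ (f ∘ c.symm) y v := by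
  have h := mfderiv_comp y (hf (c.symm y)) (chart_symm_mdifferentiableAt hc hy)
  rw [mfderiv_eq_fderiv] at h
  exact (DFunLike.congr_fun h v).symm

end ChartDeriv

/-! ### Normal equations and their smooth dependence on the linear map. -/

section Gram

variable {E F : Type*} [NormedAddCommGroup E] [NormedSpace ℝ E] [FiniteDimensional ℝ E]
  [NormedAddCommGroup F] [InnerProductSpace ℝ F]

/-- The inner product of `F` as a real bilinear map. -/
def realInnerCLM (F : Type*) [NormedAddCommGroup F] [InnerProductSpace ℝ F] :
    F →L[ℝ] F →L[ℝ] ℝ :=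
  (isBoundedBilinearMap_inner (𝕜 := ℝ) (E := F)).toContinuousLinearMap

/-- The functional `v' ↦ ⟪w, L v'⟫`, as a function of `w`. -/
def innerComp (L : E →L[ℝ] F) : F →L[ℝ] E →L[ℝ] ℝ :=
  ((ContinuousLinearMap.compL ℝ E F ℝ).flip L).comp (realInnerCLM F)

/-- The normal equations: `r = (LᵀL)⁻¹Lᵀ w`. -/
def normalSolution (L : E →L[ℝ] F) : F →L[ℝ] E :=
  (((innerComp L).comp L).inverse).comp (innerComp L)

theorem exists_equiv_gram {L : E →L[ℝ] F} (hL : Function.Injective L) :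
    ∃ g : E ≃L[ℝ] (E →L[ℝ] ℝ), (g : E →L[ℝ] E →L[ℝ] ℝ) = (innerComp L).comp L := by
  have hinj : Function.Injective ((innerComp L).comp L).toLinearMap := by
    rw [← LinearMap.ker_eq_bot, LinearMap.ker_eq_bot']
    intro v hv
    have h := DFunLike.congr_fun hv v
    have h' : inner ℝ (L v) (L v) = (0 : ℝ) := h
    rw [inner_self_eq_zero] at h'
    exact hL (h'.trans (map_zero L).symm)
  have hfin : Module.finrank ℝ E = Module.finrank ℝ (E →L[ℝ] ℝ) := by
    rw [← (LinearMap.toContinuousLinearMap (𝕜 := ℝ) (E := E) (F' := ℝ)).finrank_eq]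
    exact Subspace.dual_finrank_eq.symm
  refine ⟨(LinearEquiv.ofInjectiveOfFinrankEq _ hinj hfin).toContinuousLinearEquiv, ?_⟩
  ext v w
  rfl

theorem eq_normalSolution {L : E →L[ℝ] F} (hL : Function.Injective L) {w : F} {r : E}
    (h : ∀ v, inner ℝ (L r) (L v) = (inner ℝ w (L v) : ℝ)) : r = normalSolution L w := by
  obtain ⟨g, hg⟩ := exists_equiv_gram hL
  rw [normalSolution, ← hg, ContinuousLinearMap.inverse_equiv]
  change r = g.symm (innerComp L w)
  rw [ContinuousLinearEquiv.eq_symm_apply]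
  ext v
  have : g r = (g : E →L[ℝ] E →L[ℝ] ℝ) r := rfl
  rw [this, hg]
  exact h v

/-- Injectivity of `L` makes the Gram map invertible, and inversion is smooth at invertible maps.
This formula is what shows that the adjoint of `dι` varies smoothly, although it is defined through
an inner product depending on the point. -/
theorem contDiffOn_normalSolution {W : Type*} [NormedAddCommGroup W] [NormedSpace ℝ W]
    {L : W → E →L[ℝ] F} {U : Set W} (hL : ContDiffOn ℝ ∞ L U)
    (hinj : ∀ x ∈ U, Function.Injective (L x)) :
    ContDiffOn ℝ ∞ (fun x => normalSolution (L x)) U := by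
  have h1 : ContDiffOn ℝ ∞ (fun x => innerComp (L x)) U := by
    have : ContDiffOn ℝ ∞ (fun x => (ContinuousLinearMap.compL ℝ E F ℝ).flip (L x)) U :=
      (ContinuousLinearMap.contDiff _).comp_contDiffOn hL
    exact this.clm_comp contDiffOn_const
  have : CompleteSpace E := FiniteDimensional.complete ℝ E
  refine ContDiffOn.clm_comp (fun x hx => ?_) h1
  obtain ⟨g, hg⟩ := exists_equiv_gram (hinj x hx)
  have h2 := contDiffAt_map_inverse (𝕜 := ℝ) (n := ∞) g
  rw [hg] at h2
  exact h2.comp_contDiffWithinAt x ((h1.clm_comp hL) x hx)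

end Gram

/-! ### Ambient coefficients: formulas, smoothness and extension. -/

section Coefficients

variable {n ν k : ℕ} {N : Type*} [TopologicalSpace N] [ChartedSpace (EuclideanSpace ℝ (Fin n)) N]
  [RiemannianBundle (fun y : N => TangentSpace (𝓡 n) y)] {ι : N → EuclideanSpace ℝ (Fin ν)}

/-- The coefficients of a form on `N ⊆ ℝ^ν` in the coordinates of `ℝ^ν`. -/
def embeddingCoeff (ι : N → EuclideanSpace ℝ (Fin ν)) (α : DiffForm n N k) (i : Fin k → Fin ν)
    (y : N) : ℝ :=
  α y (fun b => ContinuousLinearMap.adjoint (diffAt ι y) (EuclideanSpace.basisFun (Fin ν) ℝ (i b)))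

theorem IsIsometricEmbedding.adjoint_diffAt (hι : IsIsometricEmbedding (n := n) ι) (y : N)
    (w : TangentSpace (𝓡 n) y) :
    ContinuousLinearMap.adjoint (diffAt ι y) (diffAt ι y w) = w := by
  apply ext_inner_right ℝ
  intro v
  rw [ContinuousLinearMap.adjoint_inner_left, hι.inner_diffAt]

theorem IsIsometricEmbedding.mdifferentiable (hι : IsIsometricEmbedding (n := n) ι) :
    MDifferentiable (𝓡 n) (𝓡 ν) ι :=
  hι.contMDiff.mdifferentiable (by simp)

theorem apply_adjoint_eq_sum (α : DiffForm n N k) (y : N)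
    (w : Fin k → EuclideanSpace ℝ (Fin ν)) :
    α y (fun b => ContinuousLinearMap.adjoint (diffAt ι y) (w b)) =
      ∑ i, embeddingCoeff ι α i y * ∏ b, w b (i b) := by
  let a : EuclideanSpace ℝ (Fin ν) [⋀^Fin k]→L[ℝ] ℝ :=
    (α y).compContinuousLinearMap (ContinuousLinearMap.adjoint (diffAt ι y))
  have h := alternating_apply_eq_sum_basis (EuclideanSpace.basisFun (Fin ν) ℝ).toBasis a w
  refine h.trans (Finset.sum_congr rfl fun i _ => ?_)
  rw [mul_comm]
  simp [a, embeddingCoeff, Function.comp_def]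

theorem formPullback_eq_sum_embeddingCoeff (hι : IsIsometricEmbedding (n := n) ι) {m : ℕ}
    (α : DiffForm n N k) {W : EuclideanSpace ℝ (Fin m) → N} {z : EuclideanSpace ℝ (Fin m)}
    (hW : MDifferentiableAt (𝓡 m) (𝓡 n) W z) (v : Fin k → EuclideanSpace ℝ (Fin m)) :
    formPullback W α z v =
      ∑ i, embeddingCoeff ι α i (W z) * ∏ b, fderiv ℝ (fun x => ι (W x)) z (v b) (i b) := by
  rw [← apply_adjoint_eq_sum]
  have h := mfderiv_comp z (hι.mdifferentiable (W z)) hW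
  rw [mfderiv_eq_fderiv] at h
  have h' : ∀ b, ContinuousLinearMap.adjoint (diffAt ι (W z))
      (fderiv ℝ (fun x => ι (W x)) z (v b)) = mfderiv (𝓡 m) (𝓡 n) W z (v b) := fun b => by
    have : fderiv ℝ (fun x => ι (W x)) z (v b) =
        diffAt ι (W z) (mfderiv (𝓡 m) (𝓡 n) W z (v b)) := DFunLike.congr_fun h (v b)
    rw [this, hι.adjoint_diffAt]
  simp_rw [h']
  rfl

/-- The adjoint of `dι` is built into both sides, so tangency of `Du x` to `N` plays no role; only
`u x ∈ N` does. -/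
theorem sobolevPullback_eq_sum_embeddingCoeff (hι : IsIsometricEmbedding (n := n) ι) {m : ℕ}
    {M : Type*} [TopologicalSpace M] [ChartedSpace (EuclideanSpace ℝ (Fin m)) M]
    (α : DiffForm n N k) (u : M → EuclideanSpace ℝ (Fin ν))
    (Du : ∀ x : M, TangentSpace (𝓡 m) x →L[ℝ] EuclideanSpace ℝ (Fin ν)) {x : M} {y : N}
    (hy : ι y = u x) (v : Fin k → TangentSpace (𝓡 m) x) :
    sobolevPullback ι u Du α x v = ∑ i, embeddingCoeff ι α i y * ∏ b, Du x (v b) (i b) := by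
  have h : ∃ y, ι y = u x := ⟨y, hy⟩
  have hc : h.choose = y := hι.isEmbedding.injective (h.choose_spec.trans hy.symm)
  rw [← apply_adjoint_eq_sum, sobolevPullback, dif_pos h]
  subst hc
  rfl

variable [IsManifold (𝓡 n) ∞ N]

theorem IsIsometricEmbedding.fderiv_comp_chart_injective (hι : IsIsometricEmbedding (n := n) ι)
    {c : OpenPartialHomeomorph N (EuclideanSpace ℝ (Fin n))}
    (hc : c ∈ atlas (EuclideanSpace ℝ (Fin n)) N) {z : EuclideanSpace ℝ (Fin n)}
    (hz : z ∈ c.target) : Function.Injective (fderiv ℝ (ι ∘ c.symm) z) := by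
  intro v w h
  rw [← diffAt_comp_chartSymmDeriv hc hι.mdifferentiable hz,
    ← diffAt_comp_chartSymmDeriv hc hι.mdifferentiable hz] at h
  apply chartSymmDeriv_injective hc hz
  rw [← hι.adjoint_diffAt (c.symm z) (chartSymmDeriv c z v), h, hι.adjoint_diffAt]

/-- Because `ι` is isometric, the identity defining the adjoint becomes the normal equations for
`d(ι ∘ c⁻¹)`, in which the metric of `N` no longer occurs. -/
theorem IsIsometricEmbedding.adjoint_eq_normalSolution (hι : IsIsometricEmbedding (n := n) ι)
    {c : OpenPartialHomeomorph N (EuclideanSpace ℝ (Fin n))}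
    (hc : c ∈ atlas (EuclideanSpace ℝ (Fin n)) N) {z : EuclideanSpace ℝ (Fin n)}
    (hz : z ∈ c.target) (w : EuclideanSpace ℝ (Fin ν)) :
    ContinuousLinearMap.adjoint (diffAt ι (c.symm z)) w =
      chartSymmDeriv c z (normalSolution (fderiv ℝ (ι ∘ c.symm) z) w) := by
  set a := ContinuousLinearMap.adjoint (diffAt (m := n) ι (c.symm z)) w with ha
  obtain ⟨r, hr⟩ := chartSymmDeriv_surjective hc hz a
  rw [← hr]
  congr 1
  refine eq_normalSolution (hι.fderiv_comp_chart_injective hc hz) fun v => ?_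
  rw [← diffAt_comp_chartSymmDeriv hc hι.mdifferentiable hz,
    ← diffAt_comp_chartSymmDeriv hc hι.mdifferentiable hz, hr, hι.inner_diffAt, ha,
    ContinuousLinearMap.adjoint_inner_left]

theorem contMDiff_embeddingCoeff (hι : IsIsometricEmbedding (n := n) ι) {α : DiffForm n N k}
    (hα : IsSmoothForm α) (i : Fin k → Fin ν) :
    ContMDiff (𝓡 n) 𝓘(ℝ, ℝ) ∞ (embeddingCoeff ι α i) := by
  intro q
  let c := chartAt (EuclideanSpace ℝ (Fin n)) q
  have hc : c ∈ atlas (EuclideanSpace ℝ (Fin n)) N := chart_mem_atlas _ _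
  have hq : q ∈ c.source := mem_chart_source _ _
  let g : EuclideanSpace ℝ (Fin n) → ℝ := fun z => chartForm c α z
    (fun b => normalSolution (fderiv ℝ (ι ∘ c.symm) z) (EuclideanSpace.basisFun (Fin ν) ℝ (i b)))
  have h1 : ContDiffOn ℝ ∞ (ι ∘ c.symm) c.target :=
    contMDiffOn_iff_contDiffOn.mp (hι.contMDiff.comp_contMDiffOn (chart_symm_contMDiffOn hc))
  have h2 : ContDiffOn ℝ ∞ (fderiv ℝ (ι ∘ c.symm)) c.target :=
    h1.fderiv_of_isOpen c.open_target (by simp)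
  have h3 : ContDiffOn ℝ ∞ g c.target := (hα c hc).alternating_apply_apply fun b =>
    (contDiffOn_normalSolution h2 fun z hz => hι.fderiv_comp_chart_injective hc hz).clm_apply
      contDiffOn_const
  have h4 : ContMDiffOn (𝓡 n) 𝓘(ℝ, ℝ) ∞ (g ∘ c) c.source :=
    (contMDiffOn_iff_contDiffOn.mpr h3).comp (chart_contMDiffOn hc) c.mapsTo
  refine (h4.congr fun x hx => ?_).contMDiffAt (c.open_source.mem_nhds hq)
  have h5 : embeddingCoeff ι α i x = embeddingCoeff ι α i (c.symm (c x)) := by rw [c.left_inv hx]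
  rw [h5]
  change α (c.symm (c x)) _ = α (c.symm (c x)) _
  congr 1
  funext b
  exact hι.adjoint_eq_normalSolution hc (c.map_source hx) _

/-- Compactness makes `ι` a closed embedding, so Tietze's theorem applies. A continuous extension is
enough: smoothness is used only along maps with values in `N`, where the coefficient itself is
smooth. -/
theorem exists_continuous_extension_embeddingCoeff [CompactSpace N]
    (hι : IsIsometricEmbedding (n := n) ι) {α : DiffForm n N k} (hα : IsSmoothForm α)
    (i : Fin k → Fin ν) :
    ∃ a : EuclideanSpace ℝ (Fin ν) → ℝ, Continuous a ∧ ∀ y, a (ι y) = embeddingCoeff ι α i y := by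
  have hcl : IsClosedEmbedding ι :=
    ⟨hι.isEmbedding, (isCompact_range hι.contMDiff.continuous).isClosed⟩
  obtain ⟨g, hg⟩ := ContinuousMap.exists_extension hcl
    (⟨_, (contMDiff_embeddingCoeff hι hα i).continuous⟩ : C(N, ℝ))
  exact ⟨g, g.continuous, fun y => DFunLike.congr_fun hg y⟩

end Coefficients

/-! ### The volume density in charts -/

section Gram

variable {m : ℕ} {V : Type*} [NormedAddCommGroup V] [InnerProductSpace ℝ V]
  [Fact (Module.finrank ℝ V = m)]

/-- In an orthonormal basis the Gram matrix is `Bᵀ B`, with `B` the matrix of coordinates of `v`,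
and `det B` is the volume form up to sign. -/
theorem sqrt_det_gram_eq_abs_volumeForm (o : Orientation ℝ V (Fin m)) (v : Fin m → V) :
    √(Matrix.of fun i j : Fin m => (inner ℝ (v i) (v j) : ℝ)).det = |o.volumeForm v| := by
  have hfin : Module.finrank ℝ V = m := Fact.out
  -- Vanishing `finrank` does not imply finite dimension, so this case is separate; there the volume
  -- form is `1` or `-1` and the empty determinant is `1`.
  rcases Nat.eq_zero_or_pos m with hm | hm
  · subst hm
    refine o.eq_or_eq_neg_of_isEmpty.elim ?_ ?_ <;> rintro rfl <;> simp
  have : FiniteDimensional ℝ V := Module.finite_of_finrank_pos (hfin ▸ hm)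
  let b : OrthonormalBasis (Fin m) ℝ V := (stdOrthonormalBasis ℝ V).reindex (finCongr hfin)
  rw [o.volumeForm_robust' b, ← Real.sqrt_sq_eq_abs]
  congr 1
  rw [Module.Basis.det_apply, sq]
  nth_rw 1 [← Matrix.det_transpose (b.toBasis.toMatrix v)]
  rw [← Matrix.det_mul]
  congr 1
  ext i j
  simp only [Matrix.of_apply, Matrix.mul_apply, Matrix.transpose_apply, Module.Basis.toMatrix_apply,
    OrthonormalBasis.coe_toBasis_repr_apply]
  rw [← b.sum_inner_mul_inner (v i) (v j)]
  exact Finset.sum_congr rfl fun c _ => by rw [b.repr_apply_apply, b.repr_apply_apply, real_inner_comm]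

theorem AlternatingMap.map_linearMap_basis {V E : Type*} [AddCommGroup V] [Module ℝ V]
    [AddCommGroup E] [Module ℝ E] (b : Module.Basis (Fin m) ℝ E) (η : V [⋀^Fin m]→ₗ[ℝ] ℝ)
    (S : E →ₗ[ℝ] V) (D : E →ₗ[ℝ] E) :
    η (fun i => S (D (b i))) = LinearMap.det D * η (fun i => S (b i)) := by
  have h := (η.compLinearMap S).eq_smul_basis_det b
  have h1 := congrArg (fun f : E [⋀^Fin m]→ₗ[ℝ] ℝ => f (D ∘ b)) h
  simp only [AlternatingMap.smul_apply, Module.Basis.det_comp, Module.Basis.det_self, smul_eq_mul,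
    mul_one] at h1
  rw [mul_comm]
  exact h1

end Gram

/-! ### The volume density: change of charts, positivity and continuity. -/

section Density

variable {m : ℕ} {M : Type*} [TopologicalSpace M] [ChartedSpace (EuclideanSpace ℝ (Fin m)) M]
  [RiemannianBundle (fun x : M => TangentSpace (𝓡 m) x)]

theorem volumeDensity_eq_abs_volumeForm (e : OpenPartialHomeomorph M (EuclideanSpace ℝ (Fin m)))
    (y : EuclideanSpace ℝ (Fin m)) (o : Orientation ℝ (TangentSpace (𝓡 m) (e.symm y)) (Fin m)) :
    volumeDensity e y = |o.volumeForm (coordVector e y)| :=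
  sqrt_det_gram_eq_abs_volumeForm o _

/-- The volume of the parallelotope spanned by `w`, measured in the tangent space at `x`. -/
def tangentVolume (x : M) (w : Fin m → EuclideanSpace ℝ (Fin m)) : ℝ :=
  √(Matrix.of fun i j : Fin m =>
    (inner ℝ (show TangentSpace (𝓡 m) x from w i) (show TangentSpace (𝓡 m) x from w j) : ℝ)).det

theorem volumeDensity_eq_tangentVolume (e : OpenPartialHomeomorph M (EuclideanSpace ℝ (Fin m)))
    (y : EuclideanSpace ℝ (Fin m)) :
    volumeDensity e y = tangentVolume (e.symm y)
      (fun i => chartSymmDeriv e y (EuclideanSpace.basisFun (Fin m) ℝ i)) := rfl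

/-- Top-degree forms scale by the determinant. Any orientation of the tangent space serves, since
only the absolute value of its volume form appears. -/
theorem tangentVolume_comp (x : M)
    (S D : EuclideanSpace ℝ (Fin m) →L[ℝ] EuclideanSpace ℝ (Fin m)) :
    tangentVolume x (fun i => S (D (EuclideanSpace.basisFun (Fin m) ℝ i))) =
      |D.det| * tangentVolume x (fun i => S (EuclideanSpace.basisFun (Fin m) ℝ i)) := by
  let o : Orientation ℝ (TangentSpace (𝓡 m) x) (Fin m) :=
    Module.Basis.orientation (R := ℝ) (M := TangentSpace (𝓡 m) x)
      (EuclideanSpace.basisFun (Fin m) ℝ).toBasis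
  have h1 : ∀ w, tangentVolume x w = |o.volumeForm w| := fun w =>
    sqrt_det_gram_eq_abs_volumeForm o _
  rw [h1, h1, ← abs_mul]
  have h := AlternatingMap.map_linearMap_basis (EuclideanSpace.basisFun (Fin m) ℝ).toBasis
    o.volumeForm (show EuclideanSpace ℝ (Fin m) →ₗ[ℝ] TangentSpace (𝓡 m) x from S.toLinearMap)
    D.toLinearMap
  simp only [OrthonormalBasis.coe_toBasis] at h
  exact congrArg _ h

variable [IsManifold (𝓡 m) ∞ M] {e : OpenPartialHomeomorph M (EuclideanSpace ℝ (Fin m))}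

theorem linearIndependent_coordVector (he : e ∈ atlas (EuclideanSpace ℝ (Fin m)) M)
    {y : EuclideanSpace ℝ (Fin m)} (hy : y ∈ e.target) :
    LinearIndependent ℝ (coordVector e y) := by
  have := (EuclideanSpace.basisFun (Fin m) ℝ).toBasis.linearIndependent.map'
    (chartSymmDeriv e y).toLinearMap (LinearMap.ker_eq_bot.mpr (chartSymmDeriv_injective he hy))
  rw [OrthonormalBasis.coe_toBasis] at this
  exact this

theorem volumeDensity_pos (he : e ∈ atlas (EuclideanSpace ℝ (Fin m)) M)
    {y : EuclideanSpace ℝ (Fin m)} (hy : y ∈ e.target) : 0 < volumeDensity e y :=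
  Real.sqrt_pos.mpr
    (Matrix.posDef_gram_of_linearIndependent (linearIndependent_coordVector he hy)).det_pos

/-- By the chain rule the coordinate frame of `e'` is that of `e` composed with the derivative of
the transition map. `tangentVolume` takes vectors of the model space, so that propositionally equal
base points can be exchanged. -/
theorem volumeDensity_eq_abs_det_mul {e' : OpenPartialHomeomorph M (EuclideanSpace ℝ (Fin m))}
    (he : e ∈ atlas (EuclideanSpace ℝ (Fin m)) M) (he' : e' ∈ atlas (EuclideanSpace ℝ (Fin m)) M)
    {y : EuclideanSpace ℝ (Fin m)} (hy : y ∈ e'.target) (hye : e'.symm y ∈ e.source) :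
    volumeDensity e' y =
      |(fderiv ℝ (e ∘ e'.symm) y).det| * volumeDensity e (e (e'.symm y)) := by
  have h1 : ∀ x x' : M, x = x' → ∀ w, tangentVolume (m := m) x w = tangentVolume x' w := by
    rintro x _ rfl w; rfl
  have h2 := fun v => chartSymmDeriv_fderiv_chart_comp he (chart_symm_mdifferentiableAt he' hy) hye v
  have h3 : volumeDensity e (e (e'.symm y)) = tangentVolume (e'.symm y)
      (fun i => (show EuclideanSpace ℝ (Fin m) →L[ℝ] EuclideanSpace ℝ (Fin m) from
        chartSymmDeriv e (e (e'.symm y))) (EuclideanSpace.basisFun (Fin m) ℝ i)) :=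
    h1 _ _ (e.left_inv hye) _
  rw [h3, ← tangentVolume_comp, volumeDensity_eq_tangentVolume]
  exact congrArg (tangentVolume _) (funext fun i => (h2 _).symm)

variable [IsContMDiffRiemannianBundle (𝓡 m) ∞ (EuclideanSpace ℝ (Fin m))
      (fun x : M => TangentSpace (𝓡 m) x)]

theorem continuousOn_chartSymmDeriv_apply (he : e ∈ atlas (EuclideanSpace ℝ (Fin m)) M)
    (v : EuclideanSpace ℝ (Fin m)) :
    ContinuousOn (fun y => (⟨e.symm y, chartSymmDeriv e y v⟩ : TangentBundle (𝓡 m) M))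
      e.target := by
  have h1 := (chart_symm_contMDiffOn he).continuousOn_tangentMapWithin (by simp)
    e.open_target.uniqueMDiffOn
  have h2 : Continuous (fun y : EuclideanSpace ℝ (Fin m) =>
      (⟨y, v⟩ : TangentBundle (𝓡 m) (EuclideanSpace ℝ (Fin m)))) :=
    (tangentBundleModelSpaceHomeomorph (𝓡 m)).symm.continuous.comp
      (Continuous.prodMk_left (X := EuclideanSpace ℝ (Fin m)) v)
  refine (h1.comp h2.continuousOn fun y hy => hy).congr fun y hy => ?_
  simp only [Function.comp, tangentMapWithin, chartSymmDeriv]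
  rw [mfderivWithin_of_mem_nhds (e.open_target.mem_nhds hy)]
  rfl

theorem continuousOn_inner_chartSymmDeriv (he : e ∈ atlas (EuclideanSpace ℝ (Fin m)) M)
    (v w : EuclideanSpace ℝ (Fin m)) :
    ContinuousOn (fun y => (inner ℝ (chartSymmDeriv e y v) (chartSymmDeriv e y w) : ℝ))
      e.target := by
  obtain ⟨g, hg, h⟩ := IsContMDiffRiemannianBundle.exists_contMDiff (IB := 𝓡 m) (n := ∞)
    (F := EuclideanSpace ℝ (Fin m)) (E := fun x : M => TangentSpace (𝓡 m) x)
  have : IsContinuousRiemannianBundle (EuclideanSpace ℝ (Fin m))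
      (fun x : M => TangentSpace (𝓡 m) x) := ⟨g, hg.continuous, h⟩
  exact ContinuousOn.inner_bundle (F := EuclideanSpace ℝ (Fin m))
    (E := fun x : M => TangentSpace (𝓡 m) x) (b := e.symm)
    (continuousOn_chartSymmDeriv_apply he v) (continuousOn_chartSymmDeriv_apply he w)

theorem continuousOn_volumeDensity (he : e ∈ atlas (EuclideanSpace ℝ (Fin m)) M) :
    ContinuousOn (volumeDensity e) e.target := by
  refine Real.continuous_sqrt.comp_continuousOn ?_
  simp_rw [Matrix.det_apply]
  refine continuousOn_finsetSum _ fun σ _ => ContinuousOn.const_smul ?_ _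
  exact continuousOn_finsetProd _ fun i _ => continuousOn_inner_chartSymmDeriv he _ _

/-- The coordinate vectors have bounded length on `K` because the metric is continuous. The bound
compares operator norms in the chart with those on `M`. -/
theorem exists_norm_chartSymmDeriv_le (he : e ∈ atlas (EuclideanSpace ℝ (Fin m)) M)
    {K : Set (EuclideanSpace ℝ (Fin m))} (hK : IsCompact K) (hKe : K ⊆ e.target) :
    ∃ C : ℝ, 0 < C ∧ ∀ y ∈ K, ∀ v, ‖chartSymmDeriv e y v‖ ≤ C * ‖v‖ := by
  have h1 : ∀ i : Fin m, ∃ C : ℝ, ∀ y ∈ K, ‖coordVector e y i‖ ≤ C := fun i => by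
    have hc := (continuousOn_inner_chartSymmDeriv he (EuclideanSpace.basisFun (Fin m) ℝ i)
      (EuclideanSpace.basisFun (Fin m) ℝ i)).mono hKe
    obtain ⟨B, hB⟩ := hK.bddAbove_image (Real.continuous_sqrt.comp_continuousOn hc)
    refine ⟨B, fun y hy => ?_⟩
    have := hB ⟨y, hy, rfl⟩
    simp only [Function.comp] at this
    rwa [← norm_eq_sqrt_real_inner] at this
  choose C hC using h1
  refine ⟨∑ i, |C i| + 1, by positivity, fun y hy v => ?_⟩
  have h2 : chartSymmDeriv e y v = ∑ i, v i • coordVector e y i := by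
    conv_lhs => rw [← (EuclideanSpace.basisFun (Fin m) ℝ).sum_repr v, map_sum]
    refine Finset.sum_congr rfl fun i _ => ?_
    rw [map_smul, EuclideanSpace.basisFun_repr]
    rfl
  rw [h2]
  calc ‖∑ i, v i • coordVector e y i‖ ≤ ∑ i, ‖v i • coordVector e y i‖ := norm_sum_le _ _
    _ ≤ ∑ i, ‖v‖ * |C i| := Finset.sum_le_sum fun i _ => by
        rw [norm_smul]
        exact mul_le_mul (PiLp.norm_apply_le v i) ((hC i y hy).trans (le_abs_self _))
          (norm_nonneg _) (norm_nonneg _)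
    _ = (∑ i, |C i|) * ‖v‖ := by rw [← Finset.mul_sum, mul_comm]
    _ ≤ _ := by gcongr; linarith

end Density

/-! ### The Riemannian volume in charts -/

section MapSymm

variable {M E : Type*} [TopologicalSpace M] [MeasurableSpace M] [BorelSpace M]
  [TopologicalSpace E] [MeasurableSpace E] [BorelSpace E] {e : OpenPartialHomeomorph M E}
  {lam : Measure E}

theorem measurableEmbedding_symm_restrict (e : OpenPartialHomeomorph M E) :
    MeasurableEmbedding (e.target.domRestrict e.symm) :=
  e.symm.isOpenEmbedding_restrict.measurableEmbedding

theorem measurableSet_target_inter_preimage (e : OpenPartialHomeomorph M E) {s : Set M}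
    (hs : MeasurableSet s) : MeasurableSet (e.target ∩ e.symm ⁻¹' s) := by
  convert e.open_target.measurableSet.subtype_image
    ((measurableEmbedding_symm_restrict e).measurable hs) using 1
  ext y
  simp [and_comm]

theorem map_val_comap_val (hlam : lam.restrict e.target = lam) :
    (lam.comap ((↑) : e.target → E)).map ((↑) : e.target → E) = lam := by
  rw [map_comap_subtype_coe e.open_target.measurableSet, hlam]

/-- Outside its target `e.symm` is arbitrary, but the measure lives on the target, where `e.symm` is
a measurable embedding. Factoring through the subtype makes the integral formulas valid without
measurability assumptions on the integrand. -/
theorem map_chart_symm (hlam : lam.restrict e.target = lam) :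
    lam.map e.symm = (lam.comap ((↑) : e.target → E)).map (e.target.domRestrict e.symm) := by
  have h : AEMeasurable e.symm lam := by
    rw [← hlam]
    exact e.continuousOn_symm.aemeasurable e.open_target.measurableSet
  have h2 := AEMeasurable.map_map_of_aemeasurable (μ := lam.comap ((↑) : e.target → E))
    (g := e.symm) (f := ((↑) : e.target → E)) (by rwa [map_val_comap_val hlam])
    measurable_subtype_coe.aemeasurable
  rw [map_val_comap_val hlam] at h2
  exact h2

theorem lintegral_map_chart_symm (hlam : lam.restrict e.target = lam) (f : M → ENNReal) :
    ∫⁻ x, f x ∂(lam.map e.symm) = ∫⁻ y, f (e.symm y) ∂lam := by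
  rw [map_chart_symm hlam, (measurableEmbedding_symm_restrict e).lintegral_map]
  conv_rhs => rw [← map_val_comap_val hlam]
  rw [(MeasurableEmbedding.subtype_coe e.open_target.measurableSet).lintegral_map]
  rfl

theorem integral_map_chart_symm (hlam : lam.restrict e.target = lam) (f : M → ℝ) :
    ∫ x, f x ∂(lam.map e.symm) = ∫ y, f (e.symm y) ∂lam := by
  rw [map_chart_symm hlam, (measurableEmbedding_symm_restrict e).integral_map]
  conv_rhs => rw [← map_val_comap_val hlam]
  rw [(MeasurableEmbedding.subtype_coe e.open_target.measurableSet).integral_map]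
  rfl

theorem integrable_map_chart_symm_iff (hlam : lam.restrict e.target = lam) (f : M → ℝ) :
    Integrable f (lam.map e.symm) ↔ Integrable (fun y => f (e.symm y)) lam := by
  rw [map_chart_symm hlam, (measurableEmbedding_symm_restrict e).integrable_map_iff]
  conv_rhs => rw [← map_val_comap_val hlam]
  rw [(MeasurableEmbedding.subtype_coe e.open_target.measurableSet).integrable_map_iff]
  rfl

theorem ae_map_chart_symm_iff (hlam : lam.restrict e.target = lam) {q : M → Prop} :
    (∀ᵐ x ∂(lam.map e.symm), q x) ↔ ∀ᵐ y ∂lam, q (e.symm y) := by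
  rw [map_chart_symm hlam, (measurableEmbedding_symm_restrict e).ae_map_iff]
  conv_rhs => rw [← map_val_comap_val hlam]
  rw [(MeasurableEmbedding.subtype_coe e.open_target.measurableSet).ae_map_iff]
  rfl

end MapSymm

/-! ### Chart volumes, their comparison, and the restriction of the Riemannian volume. -/

section ChartVolume

variable {m : ℕ} {M : Type*} [TopologicalSpace M] [ChartedSpace (EuclideanSpace ℝ (Fin m)) M]
  [RiemannianBundle (fun x : M => TangentSpace (𝓡 m) x)] [IsManifold (𝓡 m) ∞ M]
  [IsContMDiffRiemannianBundle (𝓡 m) ∞ (EuclideanSpace ℝ (Fin m))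
      (fun x : M => TangentSpace (𝓡 m) x)] [MeasurableSpace M] [BorelSpace M]
  {e : OpenPartialHomeomorph M (EuclideanSpace ℝ (Fin m))}

theorem volumeDensity_nonneg (e : OpenPartialHomeomorph M (EuclideanSpace ℝ (Fin m)))
    (y : EuclideanSpace ℝ (Fin m)) : 0 ≤ volumeDensity e y :=
  Real.sqrt_nonneg _

theorem aemeasurable_volumeDensity (he : e ∈ atlas (EuclideanSpace ℝ (Fin m)) M) :
    AEMeasurable (fun y => ENNReal.ofReal (volumeDensity e y)) (volume.restrict e.target) :=
  ((continuousOn_volumeDensity he).aemeasurable e.open_target.measurableSet).ennreal_ofReal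

theorem restrict_withDensity_volumeDensity
    (e : OpenPartialHomeomorph M (EuclideanSpace ℝ (Fin m))) :
    ((volume.restrict e.target).withDensity fun y => ENNReal.ofReal (volumeDensity e y)).restrict
      e.target = (volume.restrict e.target).withDensity
        fun y => ENNReal.ofReal (volumeDensity e y) := by
  rw [restrict_withDensity e.open_target.measurableSet,
    Measure.restrict_restrict e.open_target.measurableSet, inter_self]

theorem lintegral_chartVolume (he : e ∈ atlas (EuclideanSpace ℝ (Fin m)) M) (f : M → ENNReal) :
    ∫⁻ x, f x ∂(chartVolume e) =
      ∫⁻ y in e.target, ENNReal.ofReal (volumeDensity e y) * f (e.symm y) := by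
  rw [chartVolume, lintegral_map_chart_symm (restrict_withDensity_volumeDensity e),
    lintegral_withDensity_eq_lintegral_mul_non_measurable₀ _ (aemeasurable_volumeDensity he)
      (ae_of_all _ fun _ => ENNReal.ofReal_lt_top)]
  rfl

theorem integral_chartVolume (he : e ∈ atlas (EuclideanSpace ℝ (Fin m)) M) (f : M → ℝ) :
    ∫ x, f x ∂(chartVolume e) = ∫ y in e.target, volumeDensity e y * f (e.symm y) := by
  rw [chartVolume, integral_map_chart_symm (restrict_withDensity_volumeDensity e),
    integral_withDensity_eq_integral_toReal_smul₀ (aemeasurable_volumeDensity he)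
      (ae_of_all _ fun _ => ENNReal.ofReal_lt_top)]
  refine integral_congr_ae (ae_of_all _ fun y => ?_)
  beta_reduce
  rw [ENNReal.toReal_ofReal (volumeDensity_nonneg e y), smul_eq_mul]

theorem integrable_chartVolume_iff (he : e ∈ atlas (EuclideanSpace ℝ (Fin m)) M) (f : M → ℝ) :
    Integrable f (chartVolume e) ↔
      IntegrableOn (fun y => volumeDensity e y * f (e.symm y)) e.target := by
  rw [chartVolume, integrable_map_chart_symm_iff (restrict_withDensity_volumeDensity e),
    integrable_withDensity_iff_integrable_smul₀' (aemeasurable_volumeDensity he)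
      (ae_of_all _ fun _ => ENNReal.ofReal_lt_top), IntegrableOn]
  refine iff_of_eq (congrArg (fun g => Integrable g _) (funext fun y => ?_))
  rw [ENNReal.toReal_ofReal (volumeDensity_nonneg e y), smul_eq_mul]

/-- The density is positive on the target, so null sets are those of Lebesgue measure. -/
theorem ae_chartVolume_iff (he : e ∈ atlas (EuclideanSpace ℝ (Fin m)) M) {q : M → Prop} :
    (∀ᵐ x ∂(chartVolume e), q x) ↔ ∀ᵐ y, y ∈ e.target → q (e.symm y) := by
  rw [chartVolume, ae_map_chart_symm_iff (restrict_withDensity_volumeDensity e),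
    ae_withDensity_iff' (aemeasurable_volumeDensity he),
    ae_restrict_iff' e.open_target.measurableSet]
  refine eventually_congr (ae_of_all _ fun y => forall_congr' fun hy => ?_)
  exact ⟨fun h => h (by simpa using volumeDensity_pos he hy), fun h _ => h⟩

theorem chartVolume_apply (he : e ∈ atlas (EuclideanSpace ℝ (Fin m)) M) {s : Set M}
    (hs : MeasurableSet s) :
    chartVolume e s = ∫⁻ y in e.target ∩ e.symm ⁻¹' s, ENNReal.ofReal (volumeDensity e y) := by
  have hm := measurableSet_target_inter_preimage e hs
  rw [← lintegral_indicator_one hs, lintegral_chartVolume he, ← lintegral_indicator hm,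
    ← lintegral_indicator e.open_target.measurableSet]
  congr 1
  funext y
  by_cases h1 : y ∈ e.target <;> by_cases h2 : e.symm y ∈ s <;> simp [h1, h2]

theorem chartVolume_compl_source (he : e ∈ atlas (EuclideanSpace ℝ (Fin m)) M) :
    chartVolume e e.sourceᶜ = 0 := by
  rw [chartVolume_apply he e.open_source.measurableSet.compl]
  have : e.target ∩ e.symm ⁻¹' e.sourceᶜ = ∅ := by
    ext y
    simp only [mem_inter_iff, mem_preimage, mem_compl_iff, mem_empty_iff_false, iff_false, not_and,
      not_not]
    exact fun hy => e.map_target hy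
  rw [this, Measure.restrict_empty, lintegral_zero_measure]

/-- This is the change of variables for the transition map. Only an inequality results, since `s`
may leave the domain of `e'`. -/
theorem chartVolume_le_of_subset {e' : OpenPartialHomeomorph M (EuclideanSpace ℝ (Fin m))}
    (he : e ∈ atlas (EuclideanSpace ℝ (Fin m)) M) (he' : e' ∈ atlas (EuclideanSpace ℝ (Fin m)) M)
    {s : Set M} (hs : MeasurableSet s) (hse : s ⊆ e.source) :
    chartVolume e' s ≤ chartVolume e s := by
  rw [chartVolume_apply he hs, chartVolume_apply he' hs]
  set A := e'.target ∩ e'.symm ⁻¹' s with hA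
  have hd : ∀ y ∈ A, HasFDerivWithinAt (e ∘ e'.symm) (fderiv ℝ (e ∘ e'.symm) y) A y := by
    intro y hy
    have h1 := contDiffOn_chart_comp he (chart_symm_contMDiffOn he')
    have h2 : IsOpen (e'.target ∩ e'.symm ⁻¹' e.source) :=
      e'.isOpen_inter_preimage_symm e.open_source
    exact ((h1.contDiffAt (h2.mem_nhds ⟨hy.1, hse hy.2⟩)).differentiableAt
      (by simp)).hasFDerivAt.hasFDerivWithinAt
  have hinj : InjOn (e ∘ e'.symm) A := fun y hy z hz h =>
    e'.symm.injOn hy.1 hz.1 (e.injOn (hse hy.2) (hse hz.2) h)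
  have h3 : ∫⁻ y in A, ENNReal.ofReal (volumeDensity e' y) =
      ∫⁻ y in A, ENNReal.ofReal |(fderiv ℝ (e ∘ e'.symm) y).det| *
        ENNReal.ofReal (volumeDensity e ((e ∘ e'.symm) y)) := by
    refine setLIntegral_congr_fun (measurableSet_target_inter_preimage e' hs) fun y hy => ?_
    beta_reduce
    rw [← ENNReal.ofReal_mul (abs_nonneg _), volumeDensity_eq_abs_det_mul he he' hy.1 (hse hy.2)]
    rfl
  rw [h3, ← lintegral_image_eq_lintegral_abs_det_fderiv_mul volume (measurableSet_target_inter_preimage e' hs) hd hinj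
    (fun z => ENNReal.ofReal (volumeDensity e z))]
  refine lintegral_mono_set ?_
  rintro _ ⟨y, hy, rfl⟩
  exact ⟨e.map_source (hse hy.2), by
    change e.symm (e (e'.symm y)) ∈ s
    rw [e.left_inv (hse hy.2)]; exact hy.2⟩

theorem chartVolume_le_riemannianVolume (he : e ∈ atlas (EuclideanSpace ℝ (Fin m)) M) :
    chartVolume e ≤ riemannianVolume m M :=
  le_iSup₂_of_le e he le_rfl

theorem restrict_riemannianVolume (he : e ∈ atlas (EuclideanSpace ℝ (Fin m)) M) :
    (riemannianVolume m M).restrict e.source = chartVolume e := by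
  have hS := e.open_source.measurableSet
  apply le_antisymm
  -- Inside `e.source` every chart volume is at most that of `e`, and outside it is at most the
  -- supremum itself; so this sum dominates every member of the family.
  · have h1 : riemannianVolume m M ≤
        chartVolume e + (riemannianVolume m M).restrict e.sourceᶜ := by
      refine iSup₂_le fun e' he' => Measure.le_iff.mpr fun s hs => ?_
      rw [← measure_inter_add_sdiff s hS, Measure.add_apply, Measure.restrict_apply hs]
      exact add_le_add ((chartVolume_le_of_subset he he' (hs.inter hS) inter_subset_right).trans
        (measure_mono inter_subset_left)) (chartVolume_le_riemannianVolume he' _)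
    refine (Measure.restrict_mono_measure h1 _).trans ?_
    rw [Measure.restrict_add, Measure.restrict_restrict hS, inter_compl_self,
      Measure.restrict_empty, add_zero]
    exact Measure.restrict_le_self
  · have h2 : chartVolume e = (chartVolume e).restrict e.source :=
      (Measure.restrict_eq_self_of_ae_mem
        (mem_ae_iff.mpr (chartVolume_compl_source he))).symm
    rw [h2]
    exact Measure.restrict_mono_measure (chartVolume_le_riemannianVolume he) _

end ChartVolume

/-! ### Sobolev maps on a manifold, seen in a chart -/

section Auxiliary

/-- Integrability need not be known: otherwise the Bochner integral is zero by convention and the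
bound is trivial. -/
theorem integral_le_of_lintegral_ofReal_le {X : Type*} [MeasurableSpace X] {μ : Measure X}
    {g : X → ℝ} (hg : ∀ x, 0 ≤ g x) {ε : ℝ} (hε : 0 ≤ ε)
    (h : ∫⁻ x, ENNReal.ofReal (g x) ∂μ ≤ ENNReal.ofReal ε) : ∫ x, g x ∂μ ≤ ε := by
  by_cases hi : Integrable g μ
  · rw [← ofReal_integral_eq_lintegral_ofReal hi (.of_forall hg)] at h
    exact (ENNReal.ofReal_le_ofReal_iff hε).mp h
  · rwa [integral_undef hi]

variable {E F : Type*} [NormedAddCommGroup E] [NormedSpace ℝ E] [NormedAddCommGroup F]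
  [NormedSpace ℝ F] [MeasurableSpace E] [BorelSpace E] [FiniteDimensional ℝ E] {μ : Measure E}

theorem _root_.MeasureTheory.LocallyIntegrableOn.integrable_smul_of_tsupport_subset {U : Set E} {f : E → F}
    (hf : LocallyIntegrableOn f U μ) {ψ : E → ℝ} (hψ : Continuous ψ) (hψc : HasCompactSupport ψ)
    (hψU : tsupport ψ ⊆ U) : Integrable (fun x => ψ x • f x) μ := by
  have h1 := hf.integrableOn_compact_subset hψU hψc
  refine (integrableOn_iff_integrable_of_support_subset (s := tsupport ψ) fun x hx => ?_).mp
    (h1.continuousOn_smul hψ.continuousOn hψc)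
  by_contra h
  exact hx (by simp [image_eq_zero_of_notMem_tsupport h])

theorem _root_.MeasureTheory.LocallyIntegrableOn.clm_apply_const {U : Set E} {G : E → E →L[ℝ] F}
    (hG : LocallyIntegrableOn G U μ) (v : E) : LocallyIntegrableOn (fun x => G x v) U μ :=
  fun x hx => by
    obtain ⟨s, hs, h⟩ := hG x hx
    exact ⟨s, hs, (ContinuousLinearMap.apply ℝ F v).integrable_comp h⟩

theorem ae_eq_of_forall_integral_smul_apply_eq [CompleteSpace F] {U : Set E} (hU : IsOpen U)
    {G G' : E → E →L[ℝ] F} (hG : LocallyIntegrableOn G U μ) (hG' : LocallyIntegrableOn G' U μ)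
    (h : ∀ ψ : E → ℝ, ContDiff ℝ ∞ ψ → HasCompactSupport ψ → tsupport ψ ⊆ U → ∀ v,
      ∫ x, ψ x • G x v ∂μ = ∫ x, ψ x • G' x v ∂μ) : ∀ᵐ x ∂μ, x ∈ U → G x = G' x := by
  have h1 : ∀ᵐ x ∂μ, x ∈ U → (G - G') x = 0 := by
    refine hU.ae_eq_zero_of_integral_contDiff_smul_eq_zero (hG.sub hG') fun ψ hψ hψc hψU => ?_
    have hi := LocallyIntegrableOn.integrable_smul_of_tsupport_subset (hG.sub hG')
      hψ.continuous hψc hψU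
    ext v
    rw [ContinuousLinearMap.integral_apply hi]
    have h2 : (fun x => (ψ x • (G - G') x) v) = fun x => ψ x • G x v - ψ x • G' x v := by
      funext x
      simp [smul_sub]
    rw [h2, integral_sub, h ψ hψ hψc hψU v, sub_self]
    · rfl
    · exact (hG.clm_apply_const v).integrable_smul_of_tsupport_subset hψ.continuous hψc hψU
    · exact (hG'.clm_apply_const v).integrable_smul_of_tsupport_subset hψ.continuous hψc hψU
  filter_upwards [h1] with x hx hxU
  exact sub_eq_zero.mp (hx hxU)

end Auxiliary

/-! ### Weak derivatives and measures in a chart. -/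

section SobolevChart

variable {m : ℕ} {M : Type*} [TopologicalSpace M] [ChartedSpace (EuclideanSpace ℝ (Fin m)) M]
  {e : OpenPartialHomeomorph M (EuclideanSpace ℝ (Fin m))}

theorem HasWeakDeriv.integral_fderiv_smul {ν : ℕ} {u : M → EuclideanSpace ℝ (Fin ν)}
    {Du : ∀ x : M, TangentSpace (𝓡 m) x →L[ℝ] EuclideanSpace ℝ (Fin ν)} (hDu : HasWeakDeriv u Du)
    (he : e ∈ atlas (EuclideanSpace ℝ (Fin m)) M) {ψ : EuclideanSpace ℝ (Fin m) → ℝ}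
    (hψ : ContDiff ℝ ∞ ψ) (hψc : HasCompactSupport ψ) (hψe : tsupport ψ ⊆ e.target)
    (v : EuclideanSpace ℝ (Fin m)) :
    ∫ y, fderiv ℝ ψ y v • u (e.symm y) =
      -∫ y, ψ y • (Du (e.symm y)).comp (chartSymmDeriv e y) v := by
  have h := (hDu e he).2.2 ψ hψ hψc hψe v
  rw [setIntegral_eq_integral_of_forall_compl_eq_zero,
    setIntegral_eq_integral_of_forall_compl_eq_zero] at h
  · exact h
  · intro y hy
    rw [image_eq_zero_of_notMem_tsupport fun h => hy (hψe h), zero_smul]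
  · intro y hy
    have : y ∉ tsupport ψ := fun h => hy (hψe h)
    rw [(notMem_tsupport_iff_eventuallyEq.mp this).fderiv_eq]
    simp

/-- The weak derivative given in the theorem may differ from the one with finite energy provided by
membership in the Sobolev space; this uniqueness transfers the `L^p` bound. -/
theorem HasWeakDeriv.ae_eq {ν : ℕ} {u : M → EuclideanSpace ℝ (Fin ν)}
    {Du Du' : ∀ x : M, TangentSpace (𝓡 m) x →L[ℝ] EuclideanSpace ℝ (Fin ν)}
    (hDu : HasWeakDeriv u Du) (hDu' : HasWeakDeriv u Du')
    (he : e ∈ atlas (EuclideanSpace ℝ (Fin m)) M) :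
    ∀ᵐ y, y ∈ e.target →
      (Du (e.symm y)).comp (chartSymmDeriv e y) = (Du' (e.symm y)).comp (chartSymmDeriv e y) := by
  refine ae_eq_of_forall_integral_smul_apply_eq e.open_target (hDu e he).2.1 (hDu' e he).2.1
    fun ψ hψ hψc hψe v => ?_
  rw [← neg_inj, ← hDu.integral_fderiv_smul he hψ hψc hψe,
    ← hDu'.integral_fderiv_smul he hψ hψc hψe]

variable [RiemannianBundle (fun x : M => TangentSpace (𝓡 m) x)]

theorem norm_comp_chartSymmDeriv_le {F : Type*} [NormedAddCommGroup F] [NormedSpace ℝ F]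
    {y : EuclideanSpace ℝ (Fin m)} {C : ℝ} (hC0 : 0 ≤ C)
    (hC : ∀ v, ‖chartSymmDeriv e y v‖ ≤ C * ‖v‖)
    (D : TangentSpace (𝓡 m) (e.symm y) →L[ℝ] F) :
    ‖D.comp (chartSymmDeriv e y)‖ ≤ C * ‖D‖ := by
  refine ContinuousLinearMap.opNorm_le_bound _ (by positivity) fun v => ?_
  calc ‖D (chartSymmDeriv e y v)‖ ≤ ‖D‖ * ‖chartSymmDeriv e y v‖ := D.le_opNorm _
    _ ≤ ‖D‖ * (C * ‖v‖) := by gcongr; exact hC v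
    _ = C * ‖D‖ * ‖v‖ := by ring

variable [IsManifold (𝓡 m) ∞ M]
  [IsContMDiffRiemannianBundle (𝓡 m) ∞ (EuclideanSpace ℝ (Fin m))
      (fun x : M => TangentSpace (𝓡 m) x)] [MeasurableSpace M] [BorelSpace M]

/-- On a compact subset of the target the density has a positive minimum, whose inverse is the
constant. It does not depend on `f`, hence estimates remain uniform along sequences. -/
theorem exists_setLIntegral_le (he : e ∈ atlas (EuclideanSpace ℝ (Fin m)) M)
    {K : Set (EuclideanSpace ℝ (Fin m))} (hK : IsCompact K) (hKe : K ⊆ e.target) :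
    ∃ c : ENNReal, c ≠ ⊤ ∧ ∀ f : M → ENNReal,
      ∫⁻ y in K, f (e.symm y) ≤ c * ∫⁻ x, f x ∂(riemannianVolume m M) := by
  rcases K.eq_empty_or_nonempty with rfl | hne
  · exact ⟨0, by simp, by simp⟩
  obtain ⟨y₀, hy₀, hmin⟩ := hK.exists_isMinOn hne ((continuousOn_volumeDensity he).mono hKe)
  have hδ := volumeDensity_pos he (hKe hy₀)
  set δ := ENNReal.ofReal (volumeDensity e y₀) with hδd
  have hδ0 : δ ≠ 0 := by simpa [hδd] using hδ
  have hδt : δ ≠ ⊤ := ENNReal.ofReal_ne_top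
  refine ⟨δ⁻¹, ENNReal.inv_ne_top.mpr hδ0, fun f => ?_⟩
  calc ∫⁻ y in K, f (e.symm y)
      ≤ ∫⁻ y in K, δ⁻¹ * (ENNReal.ofReal (volumeDensity e y) * f (e.symm y)) := by
        refine setLIntegral_mono' hK.measurableSet fun y hy => ?_
        rw [← mul_assoc]
        refine le_mul_of_one_le_left' ?_
        rw [← ENNReal.inv_mul_cancel hδ0 hδt]
        gcongr
        exact ENNReal.ofReal_le_ofReal (hmin hy)
    _ = δ⁻¹ * ∫⁻ y in K, ENNReal.ofReal (volumeDensity e y) * f (e.symm y) :=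
        lintegral_const_mul' _ _ (ENNReal.inv_ne_top.mpr hδ0)
    _ ≤ δ⁻¹ * ∫⁻ x, f x ∂(riemannianVolume m M) := by
        gcongr
        refine (lintegral_mono_set hKe).trans ?_
        rw [← lintegral_chartVolume he]
        exact lintegral_mono' (chartVolume_le_riemannianVolume he) le_rfl

theorem ae_chart_of_ae_riemannianVolume (he : e ∈ atlas (EuclideanSpace ℝ (Fin m)) M)
    {q : M → Prop} (h : ∀ᵐ x ∂(riemannianVolume m M), q x) :
    ∀ᵐ y, y ∈ e.target → q (e.symm y) :=
  (ae_chartVolume_iff he).mp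
    (ae_mono (chartVolume_le_riemannianVolume he) h)

end SobolevChart

/-! ### Transfer of convergence and equi-integrability to a chart. -/

section SobolevChartConvergence

variable {m n ν : ℕ} {M : Type*} [TopologicalSpace M] [ChartedSpace (EuclideanSpace ℝ (Fin m)) M]
  {e : OpenPartialHomeomorph M (EuclideanSpace ℝ (Fin m))}
  [RiemannianBundle (fun x : M => TangentSpace (𝓡 m) x)] [IsManifold (𝓡 m) ∞ M]
  [IsContMDiffRiemannianBundle (𝓡 m) ∞ (EuclideanSpace ℝ (Fin m))
      (fun x : M => TangentSpace (𝓡 m) x)] [MeasurableSpace M] [BorelSpace M] {p : ℝ}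

theorem fderiv_comp_chart_symm (he : e ∈ atlas (EuclideanSpace ℝ (Fin m)) M)
    {f : M → EuclideanSpace ℝ (Fin ν)} (hf : MDifferentiable (𝓡 m) (𝓡 ν) f)
    {y : EuclideanSpace ℝ (Fin m)} (hy : y ∈ e.target) :
    fderiv ℝ (fun z => f (e.symm z)) y = (diffAt f (e.symm y)).comp (chartSymmDeriv e y) :=
  ContinuousLinearMap.ext fun v => (diffAt_comp_chartSymmDeriv he hf hy v).symm

/-- Norms in the chart are at most `C` times those on `M`, so the excess over `C * t` in the chart
is at most `C` times the excess over `t` on `M`. -/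
theorem exists_lintegral_excess_le (hp : 1 ≤ p) (he : e ∈ atlas (EuclideanSpace ℝ (Fin m)) M)
    {f : ℕ → M → EuclideanSpace ℝ (Fin ν)} (hf : ∀ j, MDifferentiable (𝓡 m) (𝓡 ν) (f j))
    (hequi : Tendsto (fun t : ℝ => ⨆ j, ∫⁻ x, ENNReal.ofReal (‖diffAt (m := m) (f j) x‖ - t) ^ p
      ∂(riemannianVolume m M)) atTop (𝓝 0))
    {K : Set (EuclideanSpace ℝ (Fin m))} (hK : IsCompact K) (hKe : K ⊆ e.target) {ε : ℝ}
    (hε : 0 < ε) :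
    ∃ t, 0 ≤ t ∧ ∀ j, ∫⁻ y in K,
      ENNReal.ofReal (max (‖fderiv ℝ (fun z => f j (e.symm z)) y‖ - t) 0 ^ p) ≤
        ENNReal.ofReal ε := by
  obtain ⟨C, hC0, hC⟩ := exists_norm_chartSymmDeriv_le he hK hKe
  obtain ⟨c, hc, hcf⟩ := exists_setLIntegral_le he hK hKe
  have hCp : ENNReal.ofReal C ^ p ≠ ⊤ := ENNReal.rpow_ne_top_of_nonneg (by linarith) (by simp)
  have h1 := ENNReal.Tendsto.const_mul (a := ENNReal.ofReal C ^ p * c) hequi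
    (Or.inr (ENNReal.mul_ne_top hCp hc))
  rw [mul_zero] at h1
  obtain ⟨t, ht0, ht⟩ := ((eventually_ge_atTop (0 : ℝ)).and
    (h1.eventually (ge_mem_nhds (show (0 : ENNReal) < ENNReal.ofReal ε by simpa using hε)))).exists
  refine ⟨C * t, by positivity, fun j => ?_⟩
  calc ∫⁻ y in K, ENNReal.ofReal (max (‖fderiv ℝ (fun z => f j (e.symm z)) y‖ - C * t) 0 ^ p)
      ≤ ∫⁻ y in K, ENNReal.ofReal C ^ p *
          ENNReal.ofReal (‖diffAt (m := m) (f j) (e.symm y)‖ - t) ^ p := by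
        refine setLIntegral_mono' hK.measurableSet fun y hy => ?_
        rw [← ENNReal.ofReal_rpow_of_nonneg (le_max_right _ _) (by linarith),
          ← ENNReal.mul_rpow_of_nonneg _ _ (by linarith), ← ENNReal.ofReal_mul hC0.le]
        refine ENNReal.rpow_le_rpow ?_ (by linarith)
        rw [ENNReal.ofReal_max, ENNReal.ofReal_zero, max_eq_left zero_le]
        refine ENNReal.ofReal_le_ofReal ?_
        rw [fderiv_comp_chart_symm he (hf j) (hKe hy), mul_sub]
        gcongr
        exact norm_comp_chartSymmDeriv_le hC0.le (hC y hy) _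
    _ = ENNReal.ofReal C ^ p * ∫⁻ y in K,
          ENNReal.ofReal (‖diffAt (m := m) (f j) (e.symm y)‖ - t) ^ p :=
        lintegral_const_mul' _ _ hCp
    _ ≤ ENNReal.ofReal C ^ p * (c * ⨆ j, ∫⁻ x,
          ENNReal.ofReal (‖diffAt (m := m) (f j) x‖ - t) ^ p ∂(riemannianVolume m M)) := by
        gcongr
        refine (hcf fun x => ENNReal.ofReal (‖diffAt (m := m) (f j) x‖ - t) ^ p).trans ?_
        gcongr
        exact le_iSup (fun j => ∫⁻ x,
          ENNReal.ofReal (‖diffAt (m := m) (f j) x‖ - t) ^ p ∂(riemannianVolume m M)) j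
    _ ≤ ENNReal.ofReal ε := by rw [← mul_assoc]; exact ht

/-- A norm is at most its excess over `t` plus `t`, and `K` has finite measure; uniform control of
the excess at one level therefore already bounds the energies. -/
theorem exists_integral_norm_fderiv_rpow_le (hp : 1 ≤ p)
    {f : ℕ → EuclideanSpace ℝ (Fin m) → EuclideanSpace ℝ (Fin ν)}
    {K : Set (EuclideanSpace ℝ (Fin m))} (hK : IsCompact K)
    (h : ∃ t, 0 ≤ t ∧ ∀ j, ∫⁻ y in K, ENNReal.ofReal (max (‖fderiv ℝ (f j) y‖ - t) 0 ^ p) ≤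
      ENNReal.ofReal 1) :
    ∃ B : ℝ, ∀ j, ∫ y in K, ‖fderiv ℝ (f j) y‖ ^ p ≤ B := by
  obtain ⟨t, ht0, ht⟩ := h
  set B : ENNReal := ENNReal.ofReal (2 ^ p) * ENNReal.ofReal 1 +
    ENNReal.ofReal (2 ^ p * t ^ p) * volume K with hB
  have hBt : B ≠ ⊤ := by
    rw [hB]
    exact ENNReal.add_ne_top.mpr ⟨ENNReal.mul_ne_top (by simp) (by simp),
      ENNReal.mul_ne_top (by simp) hK.measure_lt_top.ne⟩
  refine ⟨B.toReal, fun j => ?_⟩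
  refine integral_le_of_lintegral_ofReal_le (fun y => by positivity) ENNReal.toReal_nonneg ?_
  rw [ENNReal.ofReal_toReal hBt]
  calc ∫⁻ y in K, ENNReal.ofReal (‖fderiv ℝ (f j) y‖ ^ p)
      ≤ ∫⁻ y in K, (ENNReal.ofReal (2 ^ p) *
          ENNReal.ofReal (max (‖fderiv ℝ (f j) y‖ - t) 0 ^ p) +
          ENNReal.ofReal (2 ^ p * t ^ p)) := by
        refine lintegral_mono fun y => ?_
        rw [← ENNReal.ofReal_mul (by positivity), ← ENNReal.ofReal_add (by positivity)
          (by positivity), ← mul_add]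
        refine ENNReal.ofReal_le_ofReal (le_trans ?_ (add_rpow_le_two_rpow_mul hp
          (le_max_right _ _) ht0))
        refine Real.rpow_le_rpow (norm_nonneg _) ?_ (by linarith)
        linarith [le_max_left (‖fderiv ℝ (f j) y‖ - t) 0]
    _ = ENNReal.ofReal (2 ^ p) *
          (∫⁻ y in K, ENNReal.ofReal (max (‖fderiv ℝ (f j) y‖ - t) 0 ^ p)) +
          ENNReal.ofReal (2 ^ p * t ^ p) * volume K := by
        rw [lintegral_add_right _ measurable_const, lintegral_const_mul' _ _ (by simp),
          setLIntegral_const]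
    _ ≤ B := by
        rw [hB]
        gcongr
        exact ht j

theorem memLp_comp_chart_symm (hp : 1 ≤ p) (he : e ∈ atlas (EuclideanSpace ℝ (Fin m)) M)
    {K : Set (EuclideanSpace ℝ (Fin m))} (hK : IsCompact K) (hKe : K ⊆ e.target)
    {F : Type*} [NormedAddCommGroup F] {g : EuclideanSpace ℝ (Fin m) → F}
    (hg : LocallyIntegrableOn g e.target volume) {h : M → ENNReal}
    (hh : ∫⁻ x, h x ^ p ∂(riemannianVolume m M) < ⊤) {C : ENNReal} (hC : C ≠ ⊤)
    (hgh : ∀ᵐ y, y ∈ K → ‖g y‖ₑ ≤ C * h (e.symm y)) :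
    MemLp g (ENNReal.ofReal p) (volume.restrict K) := by
  obtain ⟨c, hc, hcf⟩ := exists_setLIntegral_le he hK hKe
  refine ⟨(hg.integrableOn_compact_subset hKe hK).aestronglyMeasurable, ?_⟩
  rw [eLpNorm_lt_top_iff_lintegral_rpow_enorm_lt_top (by simp; linarith) (by simp),
    ENNReal.toReal_ofReal (by linarith)]
  have hCp : C ^ p ≠ ⊤ := ENNReal.rpow_ne_top_of_nonneg (by linarith) hC
  calc ∫⁻ y in K, ‖g y‖ₑ ^ p ≤ ∫⁻ y in K, C ^ p * h (e.symm y) ^ p := by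
        refine lintegral_mono_ae ((ae_restrict_iff' hK.measurableSet).mpr ?_)
        filter_upwards [hgh] with y hy hyK
        rw [← ENNReal.mul_rpow_of_nonneg _ _ (by linarith)]
        exact ENNReal.rpow_le_rpow (hy hyK) (by linarith)
    _ = C ^ p * ∫⁻ y in K, h (e.symm y) ^ p := lintegral_const_mul' _ _ hCp
    _ ≤ C ^ p * (c * ∫⁻ x, h x ^ p ∂(riemannianVolume m M)) := by
        gcongr
        exact hcf fun x => h x ^ p
    _ < ⊤ := ENNReal.mul_lt_top hCp.lt_top (ENNReal.mul_lt_top hc.lt_top hh)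

theorem tendsto_integral_norm_sub_rpow_chart (hp : 1 ≤ p)
    (he : e ∈ atlas (EuclideanSpace ℝ (Fin m)) M)
    {f : ℕ → M → EuclideanSpace ℝ (Fin ν)} {u : M → EuclideanSpace ℝ (Fin ν)}
    (h : Tendsto (fun j => ∫⁻ x, ‖f j x - u x‖ₑ ^ p ∂(riemannianVolume m M)) atTop (𝓝 0))
    {K : Set (EuclideanSpace ℝ (Fin m))} (hK : IsCompact K) (hKe : K ⊆ e.target) :
    Tendsto (fun j => ∫ y in K, ‖f j (e.symm y) - u (e.symm y)‖ ^ p) atTop (𝓝 0) := by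
  obtain ⟨c, hc, hcf⟩ := exists_setLIntegral_le he hK hKe
  have h1 := ENNReal.Tendsto.const_mul (a := c) h (Or.inr hc)
  rw [mul_zero] at h1
  refine Metric.tendsto_nhds.mpr fun ε hε => ?_
  filter_upwards [h1.eventually (ge_mem_nhds
    (show (0 : ENNReal) < ENNReal.ofReal (ε / 2) by simpa using hε))] with j hj
  have h2 : ∫ y in K, ‖f j (e.symm y) - u (e.symm y)‖ ^ p ≤ ε / 2 := by
    refine integral_le_of_lintegral_ofReal_le (fun y => by positivity) (by positivity) ?_
    refine le_trans (le_of_eq ?_) ((hcf fun x => ‖f j x - u x‖ₑ ^ p).trans hj)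
    refine lintegral_congr fun y => ?_
    rw [← ENNReal.ofReal_rpow_of_nonneg (norm_nonneg _) (by linarith), ofReal_norm]
  have h3 : 0 ≤ ∫ y in K, ‖f j (e.symm y) - u (e.symm y)‖ ^ p :=
    integral_nonneg fun y => by positivity
  rw [Real.dist_eq, sub_zero, abs_of_nonneg h3]
  linarith

theorem weakSobolevConvergence_chart (hp : 1 ≤ p) (he : e ∈ atlas (EuclideanSpace ℝ (Fin m)) M)
    {N : Type*} {ι : N → EuclideanSpace ℝ (Fin ν)} {u : M → EuclideanSpace ℝ (Fin ν)}
    (hu : u ∈ sobolevMaps m p ι) {f : ℕ → M → EuclideanSpace ℝ (Fin ν)}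
    (hf : ∀ j, ContMDiff (𝓡 m) (𝓡 ν) ∞ (f j))
    (hfu : Tendsto (fun j => ∫⁻ x, ‖f j x - u x‖ₑ ^ p ∂(riemannianVolume m M)) atTop (𝓝 0))
    (hequi : Tendsto (fun t : ℝ => ⨆ j, ∫⁻ x, ENNReal.ofReal (‖diffAt (m := m) (f j) x‖ - t) ^ p
      ∂(riemannianVolume m M)) atTop (𝓝 0))
    {Du : ∀ x : M, TangentSpace (𝓡 m) x →L[ℝ] EuclideanSpace ℝ (Fin ν)}
    (hDu : HasWeakDeriv u Du) :
    WeakSobolevConvergence volume p e.target (fun j y => f j (e.symm y)) (fun y => u (e.symm y))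
      (fun y => (Du (e.symm y)).comp (chartSymmDeriv e y)) := by
  obtain ⟨hup, ⟨Du', hDu', hfin⟩, -⟩ := hu
  refine ⟨fun j => ?_, fun K hKe hK => ?_, fun K hKe hK => ?_, fun K hKe hK => ?_,
    fun K hKe hK => ?_, fun ψ hψ hψc hψe v => hDu.integral_fderiv_smul he hψ hψc hψe v⟩
  · exact contMDiffOn_iff_contDiffOn.mp ((hf j).comp_contMDiffOn (chart_symm_contMDiffOn he))
  · exact exists_integral_norm_fderiv_rpow_le hp hK (exists_lintegral_excess_le hp he
      (fun j => (hf j).mdifferentiable (by simp)) hequi hK hKe one_pos)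
  · exact tendsto_integral_norm_sub_rpow_chart hp he hfu hK hKe
  · refine memLp_comp_chart_symm hp he hK hKe (hDu e he).1 (h := fun x => ‖u x‖ₑ) (C := 1) ?_
      (by simp) (.of_forall fun y _ => by simp)
    have := hup.2
    rwa [eLpNorm_lt_top_iff_lintegral_rpow_enorm_lt_top (by simp; linarith) (by simp),
      ENNReal.toReal_ofReal (by linarith)] at this
  · obtain ⟨C, hC0, hC⟩ := exists_norm_chartSymmDeriv_le he hK hKe
    refine memLp_comp_chart_symm hp he hK hKe (hDu e he).2.1 hfin (C := ENNReal.ofReal C)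
      (by simp) ?_
    filter_upwards [hDu.ae_eq hDu' he] with y hy hyK
    rw [hy (hKe hyK), ← ofReal_norm, ← ofReal_norm, ← ENNReal.ofReal_mul hC0.le]
    exact ENNReal.ofReal_le_ofReal (norm_comp_chartSymmDeriv_le hC0.le (hC y hyK) _)

end SobolevChartConvergence

/-! ### The limit theorem in a chart -/

section ChartLimit

variable {m n ν k l : ℕ} {M : Type*} [TopologicalSpace M]
  [ChartedSpace (EuclideanSpace ℝ (Fin m)) M]
  {e : OpenPartialHomeomorph M (EuclideanSpace ℝ (Fin m))}
  [RiemannianBundle (fun x : M => TangentSpace (𝓡 m) x)] [IsManifold (𝓡 m) ∞ M]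
  [IsContMDiffRiemannianBundle (𝓡 m) ∞ (EuclideanSpace ℝ (Fin m))
      (fun x : M => TangentSpace (𝓡 m) x)] [MeasurableSpace M] [BorelSpace M] {p : ℝ}
  {N : Type*} [TopologicalSpace N] [CompactSpace N]
  [ChartedSpace (EuclideanSpace ℝ (Fin n)) N] [IsManifold (𝓡 n) ∞ N]
  [RiemannianBundle (fun y : N => TangentSpace (𝓡 n) y)]

/-- The Euclidean limit theorem is applied to `ι ∘ U j ∘ e⁻¹`. Closedness of the approximating forms
comes from naturality of `d`, and the coefficients are Tietze extensions, evaluated only at points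
of `N`. -/
theorem sum_sign_integral_chartForm_sobolevPullback (hp : 1 ≤ p) (hl : (l : ℝ) ≤ p)
    (he : e ∈ atlas (EuclideanSpace ℝ (Fin m)) M)
    {ι : N → EuclideanSpace ℝ (Fin ν)} (hι : IsIsometricEmbedding (n := n) ι)
    {u : M → EuclideanSpace ℝ (Fin ν)} (hu : u ∈ equiIntegrableClosure m n p ι)
    {Du : ∀ x : M, TangentSpace (𝓡 m) x →L[ℝ] EuclideanSpace ℝ (Fin ν)} (hDu : HasWeakDeriv u Du)
    {α : DiffForm n N l} (hα : IsSmoothForm α) (hdα : IsClosedForm α)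
    {φ : EuclideanSpace ℝ (Fin m) → EuclideanSpace ℝ (Fin m) [⋀^Fin k]→L[ℝ] ℝ}
    (hφ : ContDiff ℝ ∞ φ) (hφc : HasCompactSupport φ) (hφe : tsupport φ ⊆ e.target)
    (w : Fin l ⊕ Fin (k + 1) → EuclideanSpace ℝ (Fin m)) :
    (∀ σ : Equiv.Perm (Fin l ⊕ Fin (k + 1)), Integrable fun y =>
      chartForm e (sobolevPullback ι u Du α) y (fun a => w (σ (Sum.inl a))) *
        extDeriv φ y (fun b => w (σ (Sum.inr b)))) ∧
    ∑ σ : Equiv.Perm (Fin l ⊕ Fin (k + 1)), (Equiv.Perm.sign σ : ℝ) *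
      ∫ y, chartForm e (sobolevPullback ι u Du α) y (fun a => w (σ (Sum.inl a))) *
        extDeriv φ y (fun b => w (σ (Sum.inr b))) = 0 := by
  obtain ⟨huW, U, hU, hconv, hequi⟩ := hu
  have hιc : Continuous ι := hι.contMDiff.continuous
  choose A hA hAι using fun i : Fin l → Fin ν =>
    exists_continuous_extension_embeddingCoeff hι hα i
  have hιU : ∀ j, ContMDiff (𝓡 m) (𝓡 ν) ∞ (fun x => ι (U j x)) := fun j =>
    hι.contMDiff.comp (hU j)
  have hW : ∀ j, ContMDiffOn (𝓡 m) (𝓡 n) ∞ (fun y => U j (e.symm y)) e.target := fun j =>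
    (hU j).comp_contMDiffOn (chart_symm_contMDiffOn he)
  have hconvW := weakSobolevConvergence_chart hp he huW hιU hconv hequi hDu
  refine hconvW.sum_sign_integral_eq_zero hp e.open_target hl (isCompact_range hιc) hA
    (β := fun j => formPullback (fun y => U j (e.symm y)) α)
    (fun j y _ => mem_range_self _) (ae_chart_of_ae_riemannianVolume he huW.2.2)
    (fun i j => ?_) (fun K hKe hK ε hε => ?_)
    (fun j => contDiffOn_formPullback hα e.open_target (hW j)) (fun j y hy => ?_)
    (fun j y hy v => ?_) ?_ hφ hφc hφe w
  · simp_rw [hAι]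
    exact contMDiffOn_iff_contDiffOn.mp
      ((contMDiff_embeddingCoeff hι hα i).comp_contMDiffOn (hW j))
  · obtain ⟨t, ht0, ht⟩ := exists_lintegral_excess_le hp he
      (fun j => (hιU j).mdifferentiable (by simp)) hequi hK hKe hε
    exact ⟨t, ht0, fun j => integral_le_of_lintegral_ofReal_le (fun y => by positivity) hε.le
      (ht j)⟩
  · rw [extDeriv_formPullback hα e.open_target (hW j) hy, formPullback, hdα]
    ext v
    rfl
  · rw [formPullback_eq_sum_embeddingCoeff hι α
      (((hW j).contMDiffAt (e.open_target.mem_nhds hy)).mdifferentiableAt (by simp))]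
    simp_rw [hAι]
  · filter_upwards [ae_chart_of_ae_riemannianVolume he huW.2.2] with y hy hye v
    obtain ⟨q, hq⟩ := hy hye
    rw [← hq]
    simp_rw [hAι]
    exact sobolevPullback_eq_sum_embeddingCoeff hι α u Du hq fun b => chartSymmDeriv e y (v b)

end ChartLimit

/-! ### Orientations in charts -/

section OrientationChart

variable {m k l : ℕ} {M : Type*} [TopologicalSpace M]
  [ChartedSpace (EuclideanSpace ℝ (Fin m)) M]
  {e : OpenPartialHomeomorph M (EuclideanSpace ℝ (Fin m))}
  [RiemannianBundle (fun x : M => TangentSpace (𝓡 m) x)]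

theorem volumeForm_ne_zero_of_linearIndependent {V : Type*} [NormedAddCommGroup V]
    [InnerProductSpace ℝ V] [Fact (Module.finrank ℝ V = m)] (o : Orientation ℝ V (Fin m))
    {v : Fin m → V} (hv : LinearIndependent ℝ v) : o.volumeForm v ≠ 0 := by
  rw [← abs_pos, ← sqrt_det_gram_eq_abs_volumeForm o v]
  exact Real.sqrt_pos.mpr (Matrix.posDef_gram_of_linearIndependent hv).det_pos

/-- Forms of top degree are multiples of one determinant, so the ratio found on a single basis is
valid for every tuple. -/
theorem topFormRatio_mul_volumeForm {x : M} (o : Orientation ℝ (TangentSpace (𝓡 m) x) (Fin m))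
    (η : TangentSpace (𝓡 m) x [⋀^Fin m]→ₗ[ℝ] ℝ) (w : Fin m → TangentSpace (𝓡 m) x) :
    topFormRatio o η * o.volumeForm w = η w := by
  let b : Module.Basis (Fin m) ℝ (TangentSpace (𝓡 m) x) :=
    (EuclideanSpace.basisFun (Fin m) ℝ).toBasis
  have h0 : o.volumeForm b ≠ 0 := volumeForm_ne_zero_of_linearIndependent o b.linearIndependent
  have hb : topFormRatio o η = η b / o.volumeForm b := by
    have : (b : Fin m → TangentSpace (𝓡 m) x) = fun i => EuclideanSpace.basisFun (Fin m) ℝ i :=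
      OrthonormalBasis.coe_toBasis _
    rw [this]
    rfl
  have h1 := congrArg (fun f : TangentSpace (𝓡 m) x [⋀^Fin m]→ₗ[ℝ] ℝ => f w)
    (η.eq_smul_basis_det b)
  have h2 := congrArg (fun f : TangentSpace (𝓡 m) x [⋀^Fin m]→ₗ[ℝ] ℝ => f w)
    (o.volumeForm.eq_smul_basis_det b)
  simp only [AlternatingMap.smul_apply, smul_eq_mul] at h1 h2
  rw [hb, h1, h2]
  field_simp

/-- The sign of the coordinates of the chart `e` with respect to the orientation `o`. -/
def chartSign (o : ∀ x : M, Orientation ℝ (TangentSpace (𝓡 m) x) (Fin m))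
    (e : OpenPartialHomeomorph M (EuclideanSpace ℝ (Fin m))) (y : EuclideanSpace ℝ (Fin m)) : ℝ :=
  SignType.sign ((o (e.symm y)).volumeForm (coordVector e y))

/-- The density is the absolute value of the volume form on the coordinate frame. It cancels the
denominator of the ratio, and of the metric and orientation only a sign remains. -/
theorem volumeDensity_mul_topFormRatio
    (o : ∀ x : M, Orientation ℝ (TangentSpace (𝓡 m) x) (Fin m)) (y : EuclideanSpace ℝ (Fin m))
    (η : TangentSpace (𝓡 m) (e.symm y) [⋀^Fin m]→ₗ[ℝ] ℝ) :
    volumeDensity e y * topFormRatio (o (e.symm y)) η = chartSign o e y * η (coordVector e y) := by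
  rw [← topFormRatio_mul_volumeForm (o (e.symm y)) η,
    volumeDensity_eq_abs_volumeForm e y (o (e.symm y)), chartSign, ← sign_mul_self]
  ring

end OrientationChart

/-! ### Smoothness and support of the signed chart expression. -/

section SignedForm

variable {m k : ℕ} {M : Type*} [TopologicalSpace M]
  [ChartedSpace (EuclideanSpace ℝ (Fin m)) M]
  {e : OpenPartialHomeomorph M (EuclideanSpace ℝ (Fin m))}
  [RiemannianBundle (fun x : M => TangentSpace (𝓡 m) x)] [IsManifold (𝓡 m) ∞ M]

theorem chartForm_eq_zero_of_notMem {φ : DiffForm m M k} {y : EuclideanSpace ℝ (Fin m)}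
    (hy : e.symm y ∉ formSupport φ) : chartForm e φ y = 0 := by
  have : φ (e.symm y) = 0 := by_contra fun h => hy (subset_closure h)
  rw [chartForm, this]
  ext v
  rfl

/-- The expression in the chart `e` of a form supported in the domain of `e`, multiplied with the
sign of the chart. -/
def signedChartForm (o : ∀ x : M, Orientation ℝ (TangentSpace (𝓡 m) x) (Fin m))
    (e : OpenPartialHomeomorph M (EuclideanSpace ℝ (Fin m))) (φ : DiffForm m M k) :
    EuclideanSpace ℝ (Fin m) → EuclideanSpace ℝ (Fin m) [⋀^Fin k]→L[ℝ] ℝ :=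
  (e '' formSupport φ).indicator fun y => chartSign o e y • chartForm e φ y

variable {o : ∀ x : M, Orientation ℝ (TangentSpace (𝓡 m) x) (Fin m)} {φ : DiffForm m M k}

theorem isCompact_image_formSupport (hφc : IsCompact (formSupport φ))
    (hφe : formSupport φ ⊆ e.source) : IsCompact (e '' formSupport φ) :=
  hφc.image_of_continuousOn (e.continuousOn.mono hφe)

theorem symm_mem_formSupport_iff (hφe : formSupport φ ⊆ e.source) {y : EuclideanSpace ℝ (Fin m)}
    (hy : y ∈ e.target) : e.symm y ∈ formSupport φ ↔ y ∈ e '' formSupport φ := by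
  constructor
  · exact fun h => ⟨_, h, e.right_inv hy⟩
  · rintro ⟨x, hx, rfl⟩
    rwa [e.left_inv (hφe hx)]

theorem image_formSupport_subset (hφe : formSupport φ ⊆ e.source) :
    e '' formSupport φ ⊆ e.target := by
  rintro _ ⟨x, hx, rfl⟩
  exact e.map_source (hφe hx)

theorem signedChartForm_eventuallyEq_zero (hφc : IsCompact (formSupport φ))
    (hφe : formSupport φ ⊆ e.source) {y : EuclideanSpace ℝ (Fin m)}
    (hy : y ∉ e '' formSupport φ) : signedChartForm o e φ =ᶠ[𝓝 y] 0 := by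
  filter_upwards [(isCompact_image_formSupport hφc hφe).isClosed.isOpen_compl.mem_nhds hy] with z hz
  exact indicator_of_notMem hz _

/-- Along the support the volume form on the coordinate frame is continuous and nonzero, so its sign
is locally constant there. Off the support the form vanishes and the sign is irrelevant. Hence the
sign can be frozen near each point, whatever `o` does away from the support. -/
theorem signedChartForm_eventuallyEq (he : e ∈ atlas (EuclideanSpace ℝ (Fin m)) M)
    (hφc : IsCompact (formSupport φ)) (hφe : formSupport φ ⊆ e.source) (ho : IsOrientationOn o (formSupport φ))
    {y : EuclideanSpace ℝ (Fin m)} (hy : y ∈ e.target) :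
    signedChartForm o e φ =ᶠ[𝓝 y] chartSign o e y • chartForm e φ := by
  have h0 : ∀ z ∈ e.target, z ∉ e '' formSupport φ → chartForm e φ z = 0 := fun z hz hzK =>
    chartForm_eq_zero_of_notMem fun h => hzK ((symm_mem_formSupport_iff hφe hz).mp h)
  by_cases hyK : y ∈ e '' formSupport φ
  · have hmem : y ∈ e.target ∩ e.symm ⁻¹' formSupport φ :=
      ⟨hy, (symm_mem_formSupport_iff hφe hy).mpr hyK⟩
    have hne := volumeForm_ne_zero_of_linearIndependent (o (e.symm y))
      (linearIndependent_coordVector he hy)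
    have h1 := ContinuousAt.comp_continuousWithinAt
      (f := fun z => (o (e.symm z)).volumeForm (coordVector e z))
      (continuousAt_sign_of_ne_zero hne) (ho e he y hmem)
    have h2 := h1.eventually_mem (IsOpen.mem_nhds (isOpen_discrete
      {SignType.sign ((o (e.symm y)).volumeForm (coordVector e y))}) rfl)
    filter_upwards [eventually_nhdsWithin_iff.mp h2, e.open_target.mem_nhds hy] with z hz hzT
    by_cases hzK : z ∈ e '' formSupport φ
    · have h3 : chartSign o e z = chartSign o e y :=
        congrArg (fun s : SignType => (s : ℝ)) (hz ⟨hzT, (symm_mem_formSupport_iff hφe hzT).mpr hzK⟩)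
      rw [signedChartForm, indicator_of_mem hzK, Pi.smul_apply, h3]
    · rw [signedChartForm, indicator_of_notMem hzK, Pi.smul_apply, h0 z hzT hzK, smul_zero]
  · filter_upwards [signedChartForm_eventuallyEq_zero (o := o) hφc hφe hyK,
      (isCompact_image_formSupport hφc hφe).isClosed.isOpen_compl.mem_nhds hyK,
      e.open_target.mem_nhds hy] with z hz hzK hzT
    rw [hz, Pi.smul_apply, h0 z hzT hzK, smul_zero]
    rfl

theorem contDiff_signedChartForm (he : e ∈ atlas (EuclideanSpace ℝ (Fin m)) M)
    (hφ : IsSmoothForm φ) (hφc : IsCompact (formSupport φ)) (hφe : formSupport φ ⊆ e.source)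
    (ho : IsOrientationOn o (formSupport φ)) : ContDiff ℝ ∞ (signedChartForm o e φ) := by
  rw [contDiff_iff_contDiffAt]
  intro y
  by_cases hy : y ∈ e '' formSupport φ
  · have hye := image_formSupport_subset hφe hy
    have h : ContDiffAt ℝ ∞ (fun z => chartSign o e y • chartForm e φ z) y :=
      ((hφ e he).contDiffAt (e.open_target.mem_nhds hye)).const_smul _
    exact h.congr_of_eventuallyEq (signedChartForm_eventuallyEq he hφc hφe ho hye)
  · exact contDiffAt_const.congr_of_eventuallyEq (signedChartForm_eventuallyEq_zero hφc hφe hy)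

theorem tsupport_signedChartForm_subset (hφc : IsCompact (formSupport φ))
    (hφe : formSupport φ ⊆ e.source) : tsupport (signedChartForm o e φ) ⊆ e '' formSupport φ :=
  closure_minimal support_indicator_subset (isCompact_image_formSupport hφc hφe).isClosed

theorem hasCompactSupport_signedChartForm (hφc : IsCompact (formSupport φ))
    (hφe : formSupport φ ⊆ e.source) : HasCompactSupport (signedChartForm o e φ) :=
  (isCompact_image_formSupport hφc hφe).of_isClosed_subset (isClosed_tsupport _)
    (tsupport_signedChartForm_subset hφc hφe)

theorem extDeriv_signedChartForm (he : e ∈ atlas (EuclideanSpace ℝ (Fin m)) M)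
    (hφc : IsCompact (formSupport φ)) (hφe : formSupport φ ⊆ e.source) (ho : IsOrientationOn o (formSupport φ))
    {y : EuclideanSpace ℝ (Fin m)} (hy : y ∈ e.target) :
    extDeriv (signedChartForm o e φ) y = chartSign o e y • extDeriv (chartForm e φ) y := by
  rw [← extDeriv_smul, extDeriv, extDeriv, (signedChartForm_eventuallyEq he hφc hφe ho hy).fderiv_eq]

end SignedForm

/-! ### The integral of forms supported in a chart -/

section LocalIntegral

variable {m n ν k l : ℕ} {M : Type*} [TopologicalSpace M]
  [ChartedSpace (EuclideanSpace ℝ (Fin m)) M]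
  {e : OpenPartialHomeomorph M (EuclideanSpace ℝ (Fin m))}
  [RiemannianBundle (fun x : M => TangentSpace (𝓡 m) x)] [IsManifold (𝓡 m) ∞ M]
  {o : ∀ x : M, Orientation ℝ (TangentSpace (𝓡 m) x) (Fin m)} {φ : DiffForm m M k}

theorem formDeriv_eq_zero_of_notMem {x : M} (hx : x ∉ formSupport φ) : formDeriv φ x = 0 := by
  let c := chartAt (EuclideanSpace ℝ (Fin m)) x
  have hxc : c x ∈ c.target := mem_chart_target _ _
  have hx' : c.symm (c x) ∈ (formSupport φ)ᶜ := by
    rw [c.left_inv (mem_chart_source _ _)]; exact hx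
  have h : chartForm c φ =ᶠ[𝓝 (c x)] 0 := by
    filter_upwards [(c.continuousAt_symm hxc).preimage_mem_nhds
      (isClosed_closure.isOpen_compl.mem_nhds hx')] with z hz
    exact chartForm_eq_zero_of_notMem hz
  have h2 : extDeriv (chartForm c φ) (c x) = 0 := by
    rw [extDeriv, h.fderiv_eq]
    simp only [fderiv_zero, Pi.zero_apply]
    exact (ContinuousAlternatingMap.alternatizeUncurryFinCLM ℝ _ ℝ).map_zero
  rw [formDeriv, h2]
  ext v
  rfl

theorem alternatingMap_sum_apply {V J : Type*} [AddCommGroup V] [Module ℝ V] {I : Type*}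
    (s : Finset I) (a : I → V [⋀^J]→ₗ[ℝ] ℝ) (v : J → V) : (∑ i ∈ s, a i) v = ∑ i ∈ s, a i v :=
  map_sum ({ toFun := fun f => f v, map_zero' := rfl, map_add' := fun _ _ => rfl } :
    (V [⋀^J]→ₗ[ℝ] ℝ) →+ ℝ) a s

theorem wedgeForm_sum {V : Type*} [TopologicalSpace V] [AddCommGroup V] [Module ℝ V]
    [IsTopologicalAddGroup V] [ContinuousSMul ℝ V] {I : Type*} (s : Finset I)
    (a : V [⋀^Fin l]→L[ℝ] ℝ) (b : I → V [⋀^Fin k]→L[ℝ] ℝ) :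
    wedgeForm a (∑ i ∈ s, b i) = ∑ i ∈ s, wedgeForm a (b i) := by
  ext v
  have hfac : (l.factorial * k.factorial : ℝ) ≠ 0 := by positivity
  apply mul_left_cancel₀ hfac
  rw [alternatingMap_sum_apply, Finset.mul_sum]
  simp_rw [factorial_mul_wedgeForm]
  rw [Finset.sum_comm]
  refine Finset.sum_congr rfl fun σ _ => ?_
  rw [ContinuousAlternatingMap.sum_apply, Finset.mul_sum, Finset.mul_sum]

theorem topFormRatio_wedgeForm_sum (hk : l + k = m) {x : M} {I : Type*} (s : Finset I)
    (a : TangentSpace (𝓡 m) x [⋀^Fin l]→L[ℝ] ℝ) (b : I → TangentSpace (𝓡 m) x [⋀^Fin k]→L[ℝ] ℝ) :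
    topFormRatio (o x) ((wedgeForm a (∑ i ∈ s, b i)).domDomCongr (finCongr hk)) =
      ∑ i ∈ s, topFormRatio (o x) ((wedgeForm a (b i)).domDomCongr (finCongr hk)) := by
  rw [wedgeForm_sum]
  exact (congrArg (· / _) (alternatingMap_sum_apply s (fun i => wedgeForm a (b i)) _)).trans
    (Finset.sum_div _ _ _)

/-- The expression in coordinates of the exterior product with the derivative of a form. -/
theorem factorial_mul_volumeDensity_mul_topFormRatio (hk : l + (k + 1) = m)
    (he : e ∈ atlas (EuclideanSpace ℝ (Fin m)) M) (hφ : IsSmoothForm φ)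
    (hφc : IsCompact (formSupport φ)) (hφe : formSupport φ ⊆ e.source)
    (ho : IsOrientationOn o (formSupport φ)) (γ : DiffForm m M l) {y : EuclideanSpace ℝ (Fin m)}
    (hy : y ∈ e.target) :
    (l.factorial * (k + 1).factorial : ℝ) * (volumeDensity e y * topFormRatio (o (e.symm y))
      ((wedgeForm (γ (e.symm y)) (formDeriv φ (e.symm y))).domDomCongr (finCongr hk))) =
    ∑ σ : Equiv.Perm (Fin l ⊕ Fin (k + 1)), (Equiv.Perm.sign σ : ℝ) *
      (chartForm e γ y (fun a => EuclideanSpace.basisFun (Fin m) ℝ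
          (finCongr hk (finSumFinEquiv (σ (Sum.inl a))))) *
        extDeriv (signedChartForm o e φ) y (fun b => EuclideanSpace.basisFun (Fin m) ℝ
          (finCongr hk (finSumFinEquiv (σ (Sum.inr b)))))) := by
  rw [volumeDensity_mul_topFormRatio, AlternatingMap.domDomCongr_apply, mul_left_comm]
  have h := factorial_mul_wedgeForm (γ (e.symm y)) (formDeriv φ (e.symm y))
    (fun i => coordVector e y (finCongr hk i))
  refine (congrArg (chartSign o e y * ·) h).trans ?_
  rw [Finset.mul_sum]
  refine Finset.sum_congr rfl fun σ _ => ?_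
  rw [extDeriv_signedChartForm he hφc hφe ho hy, ← chartForm_formDeriv he hφ hy,
    ContinuousAlternatingMap.smul_apply, smul_eq_mul]
  change _ * (_ * (chartForm e γ y _ * chartForm e (formDeriv φ) y _)) = _
  ring

variable [IsContMDiffRiemannianBundle (𝓡 m) ∞ (EuclideanSpace ℝ (Fin m))
      (fun x : M => TangentSpace (𝓡 m) x)] [MeasurableSpace M] [BorelSpace M] {p : ℝ}
  {N : Type*} [TopologicalSpace N] [CompactSpace N]
  [ChartedSpace (EuclideanSpace ℝ (Fin n)) N] [IsManifold (𝓡 n) ∞ N]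
  [RiemannianBundle (fun y : N => TangentSpace (𝓡 n) y)]

/-- The integrand lives in one chart domain, where the Riemannian volume is explicit. Density and
ratio combine into the sign, which `signedChartForm` absorbs into `φ`; what is left is the Euclidean
identity on the standard frame. -/
theorem integral_wedgeForm_eq_zero_of_support_subset (hp : 1 ≤ p) (hl : (l : ℝ) ≤ p)
    (hk : l + (k + 1) = m) (he : e ∈ atlas (EuclideanSpace ℝ (Fin m)) M)
    {ι : N → EuclideanSpace ℝ (Fin ν)} (hι : IsIsometricEmbedding (n := n) ι)
    {u : M → EuclideanSpace ℝ (Fin ν)} (hu : u ∈ equiIntegrableClosure m n p ι)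
    {Du : ∀ x : M, TangentSpace (𝓡 m) x →L[ℝ] EuclideanSpace ℝ (Fin ν)} (hDu : HasWeakDeriv u Du)
    {α : DiffForm n N l} (hα : IsSmoothForm α) (hdα : IsClosedForm α) (hφ : IsSmoothForm φ)
    (hφc : IsCompact (formSupport φ)) (hφe : formSupport φ ⊆ e.source)
    (ho : IsOrientationOn o (formSupport φ)) :
    Integrable (fun x => topFormRatio (o x)
        ((wedgeForm (sobolevPullback ι u Du α x) (formDeriv φ x)).domDomCongr (finCongr hk)))
      (riemannianVolume m M) ∧
    ∫ x, topFormRatio (o x)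
        ((wedgeForm (sobolevPullback ι u Du α x) (formDeriv φ x)).domDomCongr (finCongr hk))
      ∂(riemannianVolume m M) = 0 := by
  set R : M → ℝ := fun x => topFormRatio (o x)
    ((wedgeForm (sobolevPullback ι u Du α x) (formDeriv φ x)).domDomCongr (finCongr hk)) with hR
  have hR0 : ∀ x ∉ e.source, R x = 0 := fun x hx => by
    have h0 := formDeriv_eq_zero_of_notMem fun h => hx (hφe h)
    -- Additivity over the empty sum expresses that the ratio of the product with the zero form is
    -- zero.
    have h := topFormRatio_wedgeForm_sum (o := o) hk (∅ : Finset ℕ) (sobolevPullback ι u Du α x)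
      fun _ => 0
    rw [Finset.sum_empty, Finset.sum_empty] at h
    rw [hR]
    beta_reduce
    rw [h0, h]
  set B : Equiv.Perm (Fin l ⊕ Fin (k + 1)) → EuclideanSpace ℝ (Fin m) → ℝ := fun σ y =>
    chartForm e (sobolevPullback ι u Du α) y (fun a => EuclideanSpace.basisFun (Fin m) ℝ
          (finCongr hk (finSumFinEquiv (σ (Sum.inl a))))) *
        extDeriv (signedChartForm o e φ) y (fun b => EuclideanSpace.basisFun (Fin m) ℝ
          (finCongr hk (finSumFinEquiv (σ (Sum.inr b))))) with hB
  obtain ⟨hint, hsum⟩ := sum_sign_integral_chartForm_sobolevPullback hp hl he hι hu hDu hα hdα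
    (contDiff_signedChartForm he hφ hφc hφe ho) (hasCompactSupport_signedChartForm hφc hφe)
    ((tsupport_signedChartForm_subset hφc hφe).trans (image_formSupport_subset hφe))
    (fun i => EuclideanSpace.basisFun (Fin m) ℝ (finCongr hk (finSumFinEquiv i)))
  have hfac : (l.factorial * (k + 1).factorial : ℝ) ≠ 0 := by positivity
  have hRB : ∀ y ∈ e.target, volumeDensity e y * R (e.symm y) =
      (l.factorial * (k + 1).factorial : ℝ)⁻¹ *
        ∑ σ : Equiv.Perm (Fin l ⊕ Fin (k + 1)), (Equiv.Perm.sign σ : ℝ) * B σ y := fun y hy => by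
    rw [← factorial_mul_volumeDensity_mul_topFormRatio hk he hφ hφc hφe ho _ hy,
      inv_mul_cancel_left₀ hfac]
  have hB0 : ∀ σ, ∀ y ∉ e.target, B σ y = 0 := fun σ y hy => by
    have : y ∉ tsupport (signedChartForm o e φ) := fun h =>
      hy (image_formSupport_subset hφe (tsupport_signedChartForm_subset hφc hφe h))
    rw [hB]
    simp only [extDeriv_eq_zero_of_notMem_tsupport this]
    exact mul_zero _
  have hBi : ∀ σ, Integrable (B σ) := hint
  constructor
  · rw [← integrableOn_iff_integrable_of_support_subset (s := e.source)
      fun x hx => by_contra fun h => hx (hR0 x h), IntegrableOn, restrict_riemannianVolume he,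
      integrable_chartVolume_iff he]
    have : Integrable (fun y => (l.factorial * (k + 1).factorial : ℝ)⁻¹ *
        ∑ σ : Equiv.Perm (Fin l ⊕ Fin (k + 1)), (Equiv.Perm.sign σ : ℝ) * B σ y) :=
      (integrable_finsetSum _ fun σ _ => (hBi σ).const_mul _).const_mul _
    exact this.integrableOn.congr_fun (fun y hy => (hRB y hy).symm) e.open_target.measurableSet
  · rw [← setIntegral_eq_integral_of_forall_compl_eq_zero (s := e.source) hR0,
      restrict_riemannianVolume he, integral_chartVolume he,
      setIntegral_congr_fun e.open_target.measurableSet hRB,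
      setIntegral_eq_integral_of_forall_compl_eq_zero fun y hy => by simp [hB0 _ y hy],
      integral_const_mul, integral_finsetSum _ fun σ _ => (hBi σ).const_mul _]
    simp_rw [integral_const_mul]
    exact (congrArg _ hsum).trans (mul_zero _)

end LocalIntegral

/-! ### Localization by a partition of unity -/

section Localization

variable {m k : ℕ} {M : Type*} [TopologicalSpace M]
  [ChartedSpace (EuclideanSpace ℝ (Fin m)) M]

theorem formSupport_smul_subset (χ : M → ℝ) (φ : DiffForm m M k) :
    formSupport (fun x => χ x • φ x : DiffForm m M k) ⊆ tsupport χ ∩ formSupport φ :=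
  subset_inter
    (closure_mono fun x (hx : χ x • φ x ≠ 0) => fun h => hx (by rw [h, zero_smul]))
    (closure_mono fun x (hx : χ x • φ x ≠ 0) => fun h => hx (by rw [h, smul_zero]))

theorem chartForm_smul (e : OpenPartialHomeomorph M (EuclideanSpace ℝ (Fin m))) (χ : M → ℝ)
    (φ : DiffForm m M k) (y : EuclideanSpace ℝ (Fin m)) :
    chartForm e (fun x => χ x • φ x : DiffForm m M k) y = χ (e.symm y) • chartForm e φ y := by
  ext v
  rfl

theorem formDeriv_sum {I : Type*} (s : Finset I) {φ : DiffForm m M k} {ψ : I → DiffForm m M k}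
    (hψ : ∀ i, IsSmoothForm (ψ i)) (h : ∀ x, φ x = ∑ i ∈ s, ψ i x) (x : M) :
    formDeriv φ x = ∑ i ∈ s, formDeriv (ψ i) x := by
  set c := chartAt (EuclideanSpace ℝ (Fin m)) x with hc
  have hd : ∀ i ∈ s, DifferentiableAt ℝ (chartForm c (ψ i)) (c x) := fun i _ =>
    ((hψ i c (chart_mem_atlas _ _)).contDiffAt
      (c.open_target.mem_nhds (mem_chart_target _ _))).differentiableAt (by simp)
  have h1 : chartForm c φ = fun y => ∑ i ∈ s, chartForm c (ψ i) y := by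
    funext y
    ext v
    rw [ContinuousAlternatingMap.sum_apply, chartForm, h]
    exact ContinuousAlternatingMap.sum_apply _ _
  have h2 : extDeriv (chartForm c φ) (c x) = ∑ i ∈ s, extDeriv (chartForm c (ψ i)) (c x) := by
    rw [extDeriv, h1, fderiv_fun_sum hd]
    exact map_sum (ContinuousAlternatingMap.alternatizeUncurryFinCLM ℝ
      (EuclideanSpace ℝ (Fin m)) ℝ) _ s
  rw [formDeriv, ← hc, h2]
  ext v
  rw [ContinuousAlternatingMap.sum_apply]
  exact ContinuousAlternatingMap.sum_apply _ _

variable [IsManifold (𝓡 m) ∞ M]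

theorem IsSmoothForm.smul {χ : M → ℝ} (hχ : ContMDiff (𝓡 m) 𝓘(ℝ, ℝ) ∞ χ) {φ : DiffForm m M k}
    (hφ : IsSmoothForm φ) : IsSmoothForm (fun x => χ x • φ x : DiffForm m M k) := by
  intro e he
  have h1 : ContDiffOn ℝ ∞ (fun y => χ (e.symm y)) e.target :=
    contMDiffOn_iff_contDiffOn.mp (hχ.comp_contMDiffOn (chart_symm_contMDiffOn he))
  exact (h1.smul (hφ e he)).congr fun y _ => chartForm_smul e χ φ y

/-- A smooth form with compact support is a finite sum of smooth forms supported in charts. -/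
theorem exists_sum_forms_support_subset_chart [T2Space M] [SigmaCompactSpace M]
    {φ : DiffForm m M k} (hφ : IsSmoothForm φ) (hφc : IsCompact (formSupport φ)) :
    ∃ (t : Finset M) (ψ : M → DiffForm m M k), (∀ i, IsSmoothForm (ψ i)) ∧
      (∀ i, formSupport (ψ i) ⊆ formSupport φ) ∧
      (∀ i, formSupport (ψ i) ⊆ (chartAt (EuclideanSpace ℝ (Fin m)) i).source) ∧
      ∀ x, φ x = ∑ i ∈ t, ψ i x := by
  obtain ⟨f, hf⟩ := SmoothPartitionOfUnity.exists_isSubordinate (𝓡 m) (s := formSupport φ)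
    isClosed_closure (fun i : M => (chartAt (EuclideanSpace ℝ (Fin m)) i).source)
    (fun i => (chartAt _ i).open_source) (fun x _ => mem_iUnion.mpr ⟨x, mem_chart_source _ x⟩)
  have hfin := f.locallyFinite.finite_nonempty_inter_compact hφc
  refine ⟨hfin.toFinset, fun i x => f i x • φ x, fun i => hφ.smul (f i).contMDiff,
    fun i => (formSupport_smul_subset _ _).trans inter_subset_right,
    fun i => (formSupport_smul_subset _ _).trans (inter_subset_left.trans (hf i)), fun x => ?_⟩
  rw [← Finset.sum_smul]
  by_cases hx : x ∈ formSupport φ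
  · have h1 : ∑ i ∈ hfin.toFinset, f i x = ∑ᶠ i, f i x := by
      rw [finsum_eq_sum_of_support_subset]
      intro i hi
      rw [Finite.coe_toFinset]
      exact ⟨x, hi, hx⟩
    rw [h1, f.sum_eq_one hx, one_smul]
  · have : φ x = 0 := by_contra fun h => hx (subset_closure h)
    rw [this, smul_zero]

end Localization

end

theorem mainTheorem3
    {m n ν k : ℕ} {p : ℝ} (hp : 1 ≤ p) (hk : ⌊p⌋₊ + (k + 1) = m)
    {M : Type*} [TopologicalSpace M] [T2Space M] [SigmaCompactSpace M]
    [ChartedSpace (EuclideanSpace ℝ (Fin m)) M] [IsManifold (𝓡 m) ∞ M]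
    [RiemannianBundle (fun x : M => TangentSpace (𝓡 m) x)]
    [IsContMDiffRiemannianBundle (𝓡 m) ∞ (EuclideanSpace ℝ (Fin m))
      (fun x : M => TangentSpace (𝓡 m) x)]
    [MeasurableSpace M] [BorelSpace M]
    {N : Type*} [TopologicalSpace N] [T2Space N] [CompactSpace N]
    [ChartedSpace (EuclideanSpace ℝ (Fin n)) N] [IsManifold (𝓡 n) ∞ N]
    [RiemannianBundle (fun y : N => TangentSpace (𝓡 n) y)]
    [IsContMDiffRiemannianBundle (𝓡 n) ∞ (EuclideanSpace ℝ (Fin n))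
      (fun y : N => TangentSpace (𝓡 n) y)]
    (ι : N → EuclideanSpace ℝ (Fin ν)) (hι : IsIsometricEmbedding (n := n) ι)
    (u : M → EuclideanSpace ℝ (Fin ν)) (hu : u ∈ equiIntegrableClosure m n p ι)
    (Du : ∀ x : M, TangentSpace (𝓡 m) x →L[ℝ] EuclideanSpace ℝ (Fin ν))
    (hDu : HasWeakDeriv u Du)
    (α : DiffForm n N ⌊p⌋₊) (hα : IsSmoothForm α) (hdα : IsClosedForm α)
    (φ : DiffForm m M k) (hφ : IsSmoothForm φ) (hφc : IsCompact (formSupport φ))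
    (o : ∀ x : M, Orientation ℝ (TangentSpace (𝓡 m) x) (Fin m))
    (ho : IsOrientationOn o (formSupport φ)) :
    Integrable (fun x => topFormRatio (o x)
        ((wedgeForm (sobolevPullback ι u Du α x) (formDeriv φ x)).domDomCongr (finCongr hk)))
      (riemannianVolume m M) ∧
    ∫ x, topFormRatio (o x)
        ((wedgeForm (sobolevPullback ι u Du α x) (formDeriv φ x)).domDomCongr (finCongr hk))
      ∂(riemannianVolume m M) = 0 := by
  obtain ⟨t, ψ, hψ, hψS, hψe, hsum⟩ := exists_sum_forms_support_subset_chart hφ hφc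
  -- Each piece is supported inside the support of `φ`, so the given orientation restricts to it;
  -- `M` itself need not be orientable.
  have key := fun i : M => integral_wedgeForm_eq_zero_of_support_subset hp
    (Nat.floor_le (by linarith)) hk (chart_mem_atlas _ i) hι hu hDu hα hdα (hψ i)
    (hφc.of_isClosed_subset isClosed_closure (hψS i)) (hψe i)
    fun e he => (ho e he).mono (inter_subset_inter_right _ (preimage_mono (hψS i)))
  have hR := fun x : M => (congrArg (fun b => topFormRatio (o x)
    ((wedgeForm (sobolevPullback ι u Du α x) b).domDomCongr (finCongr hk)))
    (formDeriv_sum t hψ hsum x)).trans (topFormRatio_wedgeForm_sum (o := o) hk t _ _)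
  simp_rw [hR]
  refine ⟨integrable_finsetSum t fun i _ => (key i).1, ?_⟩
  rw [integral_finsetSum t fun i _ => (key i).1]
  exact Finset.sum_eq_zero fun i _ => (key i).2
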